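/- **Setting.** Let $B\subset\mathbb{R}^2$ be a bounded domain (non-empty, open, connected) with Lipschitz boundary such that $B\subset\{|x_1|<\tfrac12,\ x_2>0\}$ and, for some $R\in(0,\tfrac12)$, $\{|x_1|<R,\ x_2=0\}\subset\partial B$; $|B|$ is its area. For small $\varepsilon>0$ let $d^\varepsilon,h^\varepsilon>0$ satisfy, as $\varepsilon\to0$, $$\frac{d^\varepsilon}{\varepsilon}\to0,\qquad h^\varepsilon\to0,\qquad \varepsilon^2\ln d^\varepsilon\to0,\qquad \frac{d^\varepsilon}{h^\varepsilon\varepsilon^2|B|}\to q\in[0,\infty).$$ Put $x_j^\varepsilon=\varepsilon(j+\tfrac12)$ for $j\in\mathbb{Z}$, and $$\Pi^\varepsilon=\{-\varepsilon<x_2<0\},\quad T_j^\varepsilon=\{|x_1-x_j^\varepsilon|<\tfrac{d^\varepsilon}{2},\ 0\le x_2\le h^\varepsilon\},\quad B_j^\varepsilon=(x_j^\varepsilon,h^\varepsilon)+\varepsilon B,\quad \Omega^\varepsilon=\Pi^\varepsilon\cup\bigcup_{j\in\mathbb{Z}}(B_j^\varepsilon\cup T_j^\varepsilon).$$ Let $\mathcal{H}^\varepsilon$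 be the Neumann Laplacian in $L_2(\Omega^\varepsilon)$, i.e. the self-adjoint operator associated with the form $\int_{\Omega^\varepsilon}\nabla u\cdot\overline{\nabla v}\,d\mathbf{x}$ with domain $H^1(\Omega^\varepsilon)$. Define $$(J_1^\varepsilon u)(x)=\frac1{\sqrt\varepsilon}\int_{-\varepsilon}^0u(x,x_2)\,dx_2,\qquad (J_2^\varepsilon u)(x)=\sum_{j\in\mathbb{Z}}\Big(\frac1{\sqrt{\varepsilon|B_j^\varepsilon|}}\int_{B_j^\varepsilon}u\,d\mathbf{x}\Big)\chi_j(x),$$ where $\chi_j$ is the indicator function of $(x_j^\varepsilon-\tfrac\varepsilon2,x_j^\varepsilon+\tfrac\varepsilon2)$. **Theorem 2.1.** Let $\mu>0$, and let $f^\varepsilon\in L_2(\Omega^\varepsilon)$ satisfy $\|f^\varepsilon\|_{L_2(\Omega^\varepsilon)}\le C$ with $C$ independent of $\varepsilon$, and $J_1^\varepsilon f^\varepsilon\rightharpoonup f_1$, $J_2^\varepsilon f^\varepsilon\rightharpoonup f_2$ weakly in $L_2(\mathbb{R})$ as $\varepsilon\to0$, where $f_1,f_2\in L_2(\mathbb{R})$.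 Set $u^\varepsilon=(\mathcal{H}^\varepsilon+\mu I)^{-1}f^\varepsilon$. Then the problem $$-u_1''+\mu\Big(1+\frac{q|B|}{q+\mu}\Big)u_1=f_1+\frac{q|B|^{1/2}}{q+\mu}f_2$$ has a unique solution $u_1\in H^2(\mathbb{R})$, and, as $\varepsilon\to0$, $$J_1^\varepsilon u^\varepsilon\rightharpoonup u_1\ \text{ weakly in }H^1(\mathbb{R}),\qquad J_2^\varepsilon u^\varepsilon\rightharpoonup u_2:=\frac{q|B|^{1/2}}{q+\mu}u_1+\frac1{q+\mu}f_2\ \text{ weakly in }L_2(\mathbb{R}).$$ Moreover $(u_1,u_2)=(\mathcal{H}+\mu I)^{-1}(f_1,f_2)$, where $\mathcal{H}$ is the operator in $[L_2(\mathbb{R})]^2$ with domain $H^2(\mathbb{R})\times L_2(\mathbb{R})$ given by $$\mathcal{H}\begin{pmatrix}u_1\\u_2\end{pmatrix}=\begin{pmatrix}-u_1''+q|B|u_1-q|B|^{1/2}u_2\\-q|B|^{1/2}u_1+qu_2\end{pmatrix}.$$ -/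

import Mathlib

open Filter Topology MeasureTheory
open scoped NNReal ENNReal Pointwise ComplexConjugate ContDiff

noncomputable section

namespace ThinWaveguide

/-! ### Weak derivatives and Sobolev spaces -/

/-- `g` is the weak derivative of `u` in the direction `e` in the open set `Ω`
(the integrals make sense as soon as `u`, `g` are locally integrable in `Ω`). -/
def HasWeakDeriv {E : Type*} [NormedAddCommGroup E] [NormedSpace ℝ E] [MeasureSpace E]
    (Ω : Set E) (e : E) (u g : E → ℂ) : Prop :=
  ∀ φ : E → ℝ, ContDiff ℝ ∞ φ → HasCompactSupport φ → tsupport φ ⊆ Ω →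
    ∫ x in Ω, u x * ((fderiv ℝ φ x e : ℝ) : ℂ) = -∫ x in Ω, g x * ((φ x : ℝ) : ℂ)

/-- `u ∈ H¹(Ω)`, `Ω ⊆ ℝ²`, with weak gradient `(u₁, u₂)`. -/
structure IsH1 (Ω : Set (ℝ × ℝ)) (u u₁ u₂ : ℝ × ℝ → ℂ) : Prop where
  memLp : MemLp u 2 (volume.restrict Ω)
  memLp_fst : MemLp u₁ 2 (volume.restrict Ω)
  memLp_snd : MemLp u₂ 2 (volume.restrict Ω)
  deriv_fst : HasWeakDeriv Ω ((1, 0) : ℝ × ℝ) u u₁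
  deriv_snd : HasWeakDeriv Ω ((0, 1) : ℝ × ℝ) u u₂

/-- `u ∈ H¹(ℝ)` with weak derivative `u'`. -/
structure IsH1Line (u u' : ℝ → ℂ) : Prop where
  memLp : MemLp u 2
  memLp_deriv : MemLp u' 2
  hasWeakDeriv : HasWeakDeriv Set.univ (1 : ℝ) u u'

/-- `u ∈ H²(ℝ)` with first and second weak derivatives `u'`, `u''`. -/
def IsH2Line (u u' u'' : ℝ → ℂ) : Prop :=
  IsH1Line u u' ∧ IsH1Line u' u''

/-! ### Weak convergence -/

/-- `F i ⇀ F₀` weakly in `L₂(ℝ)` along the filter `l`. -/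
def WeakTendstoL2 {ι : Type*} (l : Filter ι) (F : ι → ℝ → ℂ) (F₀ : ℝ → ℂ) : Prop :=
  (∀ᶠ i in l, MemLp (F i) 2) ∧ MemLp F₀ 2 ∧
    ∀ v : ℝ → ℂ, MemLp v 2 →
      Tendsto (fun i => ∫ x, F i x * conj (v x)) l (𝓝 (∫ x, F₀ x * conj (v x)))

/-- `F i ⇀ F₀` weakly in `H¹(ℝ)` along the filter `l`: the `F i` and `F₀` belong to `H¹(ℝ)` and
the `H¹` scalar products with every element of `H¹(ℝ)` converge. -/
def WeakTendstoH1 {ι : Type*} (l : Filter ι) (F : ι → ℝ → ℂ) (F₀ : ℝ → ℂ) : Prop :=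
  ∃ (F' : ι → ℝ → ℂ) (F₀' : ℝ → ℂ),
    (∀ᶠ i in l, IsH1Line (F i) (F' i)) ∧ IsH1Line F₀ F₀' ∧
    ∀ v v' : ℝ → ℂ, IsH1Line v v' →
      Tendsto (fun i => ∫ x, (F i x * conj (v x) + F' i x * conj (v' x))) l
        (𝓝 (∫ x, (F₀ x * conj (v x) + F₀' x * conj (v' x))))

/-! ### The Neumann Laplacian and its resolvent -/

/-- `u ∈ dom (H)` and `H u = g`, where `H` is the Neumann Laplacian in `L₂(Ω)`, i.e. the operator
associated with the form `∫_Ω ∇u · conj ∇v` with domain `H¹(Ω)`. -/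
def IsNeumannLaplacian (Ω : Set (ℝ × ℝ)) (u g : ℝ × ℝ → ℂ) : Prop :=
  MemLp g 2 (volume.restrict Ω) ∧
  ∃ u₁ u₂ : ℝ × ℝ → ℂ, IsH1 Ω u u₁ u₂ ∧
    ∀ v v₁ v₂ : ℝ × ℝ → ℂ, IsH1 Ω v v₁ v₂ →
      ∫ x in Ω, (u₁ x * conj (v₁ x) + u₂ x * conj (v₂ x)) = ∫ x in Ω, g x * conj (v x)

/-- `u = (H + μ)⁻¹ f` in `L₂(Ω)`, where `H` is the Neumann Laplacian in `L₂(Ω)`. -/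
def IsNeumannResolvent (Ω : Set (ℝ × ℝ)) (μ : ℝ) (f u : ℝ × ℝ → ℂ) : Prop :=
  ∃ g : ℝ × ℝ → ℂ, IsNeumannLaplacian Ω u g ∧
    ∀ᵐ x ∂(volume.restrict Ω), g x + (μ : ℂ) * u x = f x

/-! ### The resolvent is a well-defined operator on `L₂(Ω)` -/

lemma memLp_ofReal {ν : Measure (ℝ × ℝ)} [IsFiniteMeasureOnCompacts ν] {ψ : ℝ × ℝ → ℝ}
    (hc : Continuous ψ) (hs : HasCompactSupport ψ) :
    MemLp (fun x => ((ψ x : ℝ) : ℂ)) 2 ν :=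
  (hc.memLp_of_hasCompactSupport hs).ofReal

lemma memLp_test {ν : Measure (ℝ × ℝ)} [IsFiniteMeasureOnCompacts ν] {φ : ℝ × ℝ → ℝ}
    (hc : ContDiff ℝ ∞ φ) (hs : HasCompactSupport φ) (e : ℝ × ℝ) :
    MemLp (fun x => ((φ x : ℝ) : ℂ)) 2 ν ∧ MemLp (fun x => ((fderiv ℝ φ x e : ℝ) : ℂ)) 2 ν :=
  ⟨memLp_ofReal hc.continuous hs,
    memLp_ofReal ((hc.continuous_fderiv (by simp)).clm_apply continuous_const)
      (hs.fderiv_apply ℝ e)⟩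

/-- The scalar product of the class of a real function with the class of another function. -/
lemma inner_toLp_ofReal {ν : Measure (ℝ × ℝ)} {w : ℝ × ℝ → ℝ}
    (hw : MemLp (fun x => ((w x : ℝ) : ℂ)) 2 ν) (a : Lp ℂ 2 ν) :
    inner ℂ (hw.toLp _) a = ∫ x, a x * ((w x : ℝ) : ℂ) ∂ν := by
  rw [L2.inner_def]
  refine integral_congr_ae ?_
  filter_upwards [hw.coeFn_toLp] with x hx
  simp [hx]

lemma inner_toLp {ν : Measure (ℝ × ℝ)} {w : ℝ × ℝ → ℂ}
    (hw : MemLp w 2 ν) (a : Lp ℂ 2 ν) :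
    inner ℂ (hw.toLp _) a = ∫ x, a x * conj (w x) ∂ν := by
  rw [L2.inner_def]
  refine integral_congr_ae ?_
  filter_upwards [hw.coeFn_toLp] with x hx
  simp [hx]

/-- Orthogonal projection of `(F, 0, 0)` onto the orthogonal complement of `S` in `H³`. -/
lemma exists_projection {H : Type*} [NormedAddCommGroup H] [InnerProductSpace ℂ H]
    [CompleteSpace H] (S : Set (H × H × H)) (F : H) :
    ∃ a b c : H, (∀ s ∈ S, inner ℂ s.1 a + inner ℂ s.2.1 b + inner ℂ s.2.2 c = 0) ∧
      ∀ a' b' c' : H, (∀ s ∈ S, inner ℂ s.1 a' + inner ℂ s.2.1 b' + inner ℂ s.2.2 c' = 0) →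
        inner ℂ a' a + inner ℂ b' b + inner ℂ c' c = inner ℂ a' F := by
  let mk (s : H × H × H) : PiLp 2 (fun _ : Fin 3 => H) := WithLp.toLp 2 ![s.1, s.2.1, s.2.2]
  have hmk (s : H × H × H) (a : PiLp 2 (fun _ : Fin 3 => H)) : inner ℂ (mk s) a
      = inner ℂ s.1 (a 0) + inner ℂ s.2.1 (a 1) + inner ℂ s.2.2 (a 2) := by
    simp [mk, PiLp.inner_apply, Fin.sum_univ_three]
  let K := (Submodule.span ℂ (mk '' S))ᗮ
  have hK (a : PiLp 2 (fun _ : Fin 3 => H)) : a ∈ K ↔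
      ∀ s ∈ S, inner ℂ s.1 (a 0) + inner ℂ s.2.1 (a 1) + inner ℂ s.2.2 (a 2) = 0 := by
    simp only [← hmk]
    refine ⟨fun h s hs => h _ (Submodule.subset_span ⟨s, hs, rfl⟩), fun h s hs => ?_⟩
    induction hs using Submodule.span_induction with
    | mem s hs => obtain ⟨s, hs, rfl⟩ := hs; exact h s hs
    | zero => simp
    | add x y _ _ hx hy => rw [inner_add_left, hx, hy, add_zero]
    | smul r x _ hx => rw [inner_smul_left, hx, mul_zero]
  have : CompleteSpace K := (Submodule.isClosed_orthogonal _).completeSpace_coe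
  have : K.HasOrthogonalProjection := Submodule.HasOrthogonalProjection.ofCompleteSpace K
  let a := K.starProjection (mk (F, 0, 0))
  refine ⟨a 0, a 1, a 2, (hK a).1 (K.starProjection_apply_mem _), fun a' b' c' h => ?_⟩
  have hm : mk (a', b', c') ∈ K := (hK _).2 h
  have h0 : inner ℂ (mk (a', b', c')) (mk (F, 0, 0) - a) = 0 :=
    Submodule.inner_right_of_mem_orthogonal hm (K.sub_starProjection_mem_orthogonal _)
  rw [inner_sub_right, sub_eq_zero, hmk, hmk] at h0
  simpa [mk] using h0.symm

/-- Admissible test functions. -/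
def IsTest (Ω : Set (ℝ × ℝ)) (φ : ℝ × ℝ → ℝ) : Prop :=
  ContDiff ℝ ∞ φ ∧ HasCompactSupport φ ∧ tsupport φ ⊆ Ω

lemma HasWeakDeriv.const_mul {Ω : Set (ℝ × ℝ)} {e : ℝ × ℝ} {u g : ℝ × ℝ → ℂ} (c : ℂ)
    (hug : HasWeakDeriv Ω e u g) :
    HasWeakDeriv Ω e (fun x => c * u x) (fun x => c * g x) := by
  intro φ h1 h2 h3
  simp only [mul_assoc]
  rw [integral_const_mul, integral_const_mul, hug φ h1 h2 h3, mul_neg]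

lemma HasWeakDeriv.congr {Ω : Set (ℝ × ℝ)} {e : ℝ × ℝ} {u g u' g' : ℝ × ℝ → ℂ}
    (hug : HasWeakDeriv Ω e u g) (hu : u =ᵐ[volume.restrict Ω] u')
    (hg : g =ᵐ[volume.restrict Ω] g') : HasWeakDeriv Ω e u' g' := by
  intro φ h1 h2 h3
  have := hug φ h1 h2 h3
  rw [integral_congr_ae (g := fun x => u x * ((fderiv ℝ φ x e : ℝ) : ℂ))
      (by filter_upwards [hu] with x hx; simp [hx]),
    integral_congr_ae (f := fun x => g' x * ((φ x : ℝ) : ℂ))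
      (g := fun x => g x * ((φ x : ℝ) : ℂ)) (by filter_upwards [hg] with x hx; simp [hx]), this]

/-- Every `f ∈ L₂(Ω)` has an image under `(H + μ)⁻¹`. -/
theorem exists_isNeumannResolvent (Ω : Set (ℝ × ℝ)) {μ : ℝ} (hμ : 0 < μ) {f : ℝ × ℝ → ℂ}
    (hf : MemLp f 2 (volume.restrict Ω)) : ∃ u, IsNeumannResolvent Ω μ f u := by
  set ν : Measure (ℝ × ℝ) := volume.restrict Ω with hν
  obtain ⟨c, hc0, hcμ⟩ : ∃ c : ℝ, 0 < c ∧ c * c = μ :=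
    ⟨√μ, Real.sqrt_pos.2 hμ, Real.mul_self_sqrt hμ.le⟩
  have hc : (c : ℂ) ≠ 0 := by exact_mod_cast hc0.ne'
  have hcμ' : (c : ℂ) * c = μ := by exact_mod_cast hcμ
  let S : Set (Lp ℂ 2 ν × Lp ℂ 2 ν × Lp ℂ 2 ν) := {s | ∃ (φ : ℝ × ℝ → ℝ) (t : IsTest Ω φ),
    s = ((memLp_test t.1 t.2.1 (1, 0)).2.toLp _, (c : ℂ) • (memLp_test t.1 t.2.1 0).1.toLp _, 0) ∨
    s = ((memLp_test t.1 t.2.1 (0, 1)).2.toLp _, 0, (c : ℂ) • (memLp_test t.1 t.2.1 0).1.toLp _)}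
  have hK (a₀ a₁ a₂ : Lp ℂ 2 ν) :
      (∀ s ∈ S, inner ℂ s.1 a₀ + inner ℂ s.2.1 a₁ + inner ℂ s.2.2 a₂ = 0) ↔
      HasWeakDeriv Ω ((1, 0) : ℝ × ℝ) a₀ (fun x => c * a₁ x) ∧
      HasWeakDeriv Ω ((0, 1) : ℝ × ℝ) a₀ (fun x => c * a₂ x) := by
    constructor
    · intro H
      refine ⟨fun φ h1 h2 h3 => ?_, fun φ h1 h2 h3 => ?_⟩
      · have := H _ ⟨φ, ⟨h1, h2, h3⟩, Or.inl rfl⟩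
        simp only [inner_zero_left, inner_smul_left, inner_toLp_ofReal, Complex.conj_ofReal,
          add_zero] at this
        simp only [mul_assoc]
        rw [integral_const_mul]
        exact eq_neg_of_add_eq_zero_left this
      · have := H _ ⟨φ, ⟨h1, h2, h3⟩, Or.inr rfl⟩
        simp only [inner_zero_left, inner_smul_left, inner_toLp_ofReal, Complex.conj_ofReal,
          add_zero] at this
        simp only [mul_assoc]
        rw [integral_const_mul]
        exact eq_neg_of_add_eq_zero_left this
    · rintro ⟨H1, H2⟩ s ⟨φ, t, rfl | rfl⟩
      · have := H1 φ t.1 t.2.1 t.2.2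
        simp only [mul_assoc] at this
        rw [integral_const_mul] at this
        simp only [inner_zero_left, inner_smul_left, inner_toLp_ofReal, Complex.conj_ofReal,
          add_zero]
        exact add_eq_zero_iff_eq_neg.2 this
      · have := H2 φ t.1 t.2.1 t.2.2
        simp only [mul_assoc] at this
        rw [integral_const_mul] at this
        simp only [inner_zero_left, inner_smul_left, inner_toLp_ofReal, Complex.conj_ofReal,
          add_zero]
        exact add_eq_zero_iff_eq_neg.2 this
  have hfc : MemLp (fun x => (c : ℂ)⁻¹ * f x) 2 ν := hf.const_mul _
  obtain ⟨a₀, a₁, a₂, haK, horth⟩ := exists_projection S (hfc.toLp _)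
  obtain ⟨ha1, ha2⟩ := (hK a₀ a₁ a₂).1 haK
  have hL (a : Lp ℂ 2 ν) : MemLp a 2 ν := Lp.memLp _
  refine ⟨fun x => (c : ℂ)⁻¹ * a₀ x, fun x => f x - c * a₀ x,
    ⟨hf.sub ((hL a₀).const_mul _), a₁, a₂,
      ⟨(hL a₀).const_mul _, hL a₁, hL a₂, ?_, ?_⟩, ?_⟩, ?_⟩
  · simpa [← mul_assoc, hc] using ha1.const_mul (c : ℂ)⁻¹
  · simpa [← mul_assoc, hc] using ha2.const_mul (c : ℂ)⁻¹
  · intro v v₁ v₂ hv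
    have hcv : MemLp (fun x => (c : ℂ) * v x) 2 ν := hv.memLp.const_mul _
    have key := horth (hcv.toLp _) (hv.memLp_fst.toLp _) (hv.memLp_snd.toLp _) <| by
      refine (hK _ _ _).2 ⟨?_, ?_⟩
      · refine (hv.deriv_fst.const_mul (c : ℂ)).congr hcv.coeFn_toLp.symm ?_
        filter_upwards [hv.memLp_fst.coeFn_toLp] with x hx
        simp [hx]
      · refine (hv.deriv_snd.const_mul (c : ℂ)).congr hcv.coeFn_toLp.symm ?_
        filter_upwards [hv.memLp_snd.coeFn_toLp] with x hx
        simp [hx]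
    simp only [inner_toLp] at key
    have e1 : ∫ x, (hfc.toLp _ : Lp ℂ 2 ν) x * conj ((c : ℂ) * v x) ∂ν
        = ∫ x, f x * conj (v x) ∂ν := by
      refine integral_congr_ae ?_
      filter_upwards [hfc.coeFn_toLp] with x hx
      rw [hx]; simp; field_simp
    have e2 : ∫ x, a₀ x * conj ((c : ℂ) * v x) ∂ν = ∫ x, (c * a₀ x) * conj (v x) ∂ν := by
      congr 1; ext x; simp; ring
    have I1 : Integrable (fun x => a₁ x * conj (v₁ x)) ν :=
      (hL a₁).integrable_mul hv.memLp_fst.star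
    have I2 : Integrable (fun x => a₂ x * conj (v₂ x)) ν :=
      (hL a₂).integrable_mul hv.memLp_snd.star
    have I3 : Integrable (fun x => f x * conj (v x)) ν := hf.integrable_mul hv.memLp.star
    have I4 : Integrable (fun x => (c * a₀ x) * conj (v x)) ν :=
      ((hL a₀).const_mul (c : ℂ)).integrable_mul hv.memLp.star
    rw [e1, e2] at key
    rw [integral_add I1 I2]
    simp only [sub_mul]
    rw [integral_sub I3 I4, ← key]
    ring
  · refine Eventually.of_forall fun x => ?_
    simp only [← hcμ']
    field_simp
    ring

/-- The image of `f` under `(H + μ)⁻¹` is unique, as an element of `L₂(Ω)`. -/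
theorem IsNeumannResolvent.ae_eq {Ω : Set (ℝ × ℝ)} {μ : ℝ} (hμ : 0 < μ) {f u w : ℝ × ℝ → ℂ}
    (hu : IsNeumannResolvent Ω μ f u) (hw : IsNeumannResolvent Ω μ f w) :
    u =ᵐ[volume.restrict Ω] w := by
  obtain ⟨g, ⟨hg, u₁, u₂, hu, hug⟩, huf⟩ := hu
  obtain ⟨k, ⟨hk, w₁, w₂, hw, hwk⟩, hwf⟩ := hw
  set ν : Measure (ℝ × ℝ) := volume.restrict Ω with hν
  have key (v v₁ v₂) (hv : IsH1 Ω v v₁ v₂) :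
      ∫ x, ((u₁ x - w₁ x) * conj (v₁ x) + (u₂ x - w₂ x) * conj (v₂ x)) ∂ν
        + μ * ∫ x, (u x - w x) * conj (v x) ∂ν = 0 := by
    have e1 := hug v v₁ v₂ hv
    have e2 := hwk v v₁ v₂ hv
    have i1 : Integrable (fun x => u₁ x * conj (v₁ x) + u₂ x * conj (v₂ x)) ν :=
      (hu.memLp_fst.integrable_mul hv.memLp_fst.star).add
        (hu.memLp_snd.integrable_mul hv.memLp_snd.star)
    have i2 : Integrable (fun x => w₁ x * conj (v₁ x) + w₂ x * conj (v₂ x)) ν :=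
      (hw.memLp_fst.integrable_mul hv.memLp_fst.star).add
        (hw.memLp_snd.integrable_mul hv.memLp_snd.star)
    have i3 : Integrable (fun x => g x * conj (v x)) ν := hg.integrable_mul hv.memLp.star
    have i4 : Integrable (fun x => k x * conj (v x)) ν := hk.integrable_mul hv.memLp.star
    have e3 : ∫ x, ((u₁ x - w₁ x) * conj (v₁ x) + (u₂ x - w₂ x) * conj (v₂ x)) ∂ν
        = ∫ x, (g x * conj (v x) - k x * conj (v x)) ∂ν := by
      rw [integral_sub i3 i4, ← e1, ← e2, ← integral_sub i1 i2]
      congr 1; ext x; ring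
    have i5 : Integrable (fun x => (μ : ℂ) * ((u x - w x) * conj (v x))) ν :=
      ((hu.memLp.sub hw.memLp).integrable_mul hv.memLp.star).const_mul _
    have i6 : Integrable (fun x => g x * conj (v x) - k x * conj (v x)) ν := i3.sub i4
    rw [e3, ← integral_const_mul, ← integral_add i6 i5]
    refine integral_eq_zero_of_ae ?_
    filter_upwards [huf, hwf] with x h1 h2
    simp only [Pi.zero_apply]
    linear_combination (h1 - h2) * conj (v x)
  have e := congrArg₂ (· - ·) (key u u₁ u₂ hu) (key w w₁ w₂ hw)
  simp only [sub_zero] at e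
  have dI {p r s : ℝ × ℝ → ℂ} (hp : MemLp p 2 ν) (hr : MemLp r 2 ν) (hs : MemLp s 2 ν) :
      Integrable (fun x => (p x - r x) * conj (s x)) ν :=
    (hp.sub hr).integrable_mul hs.star
  have e' : ∫ x, ((‖u₁ x - w₁ x‖ ^ 2 + ‖u₂ x - w₂ x‖ ^ 2 + μ * ‖u x - w x‖ ^ 2 : ℝ) : ℂ) ∂ν = 0 := by
    rw [← e, ← integral_const_mul, ← integral_const_mul, ← integral_add, ← integral_add,
      ← integral_sub]
    · refine integral_congr_ae (Eventually.of_forall fun x => ?_)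
      simp only [Complex.ofReal_add, Complex.ofReal_mul, Complex.ofReal_pow,
        ← Complex.mul_conj', map_sub]
      ring
    all_goals
      first
      | exact ((dI hu.memLp_fst hw.memLp_fst hu.memLp_fst).add
          (dI hu.memLp_snd hw.memLp_snd hu.memLp_snd)).add
          ((dI hu.memLp hw.memLp hu.memLp).const_mul _)
      | exact ((dI hu.memLp_fst hw.memLp_fst hw.memLp_fst).add
          (dI hu.memLp_snd hw.memLp_snd hw.memLp_snd)).add
          ((dI hu.memLp hw.memLp hw.memLp).const_mul _)
      | exact (dI hu.memLp_fst hw.memLp_fst hu.memLp_fst).add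
          (dI hu.memLp_snd hw.memLp_snd hu.memLp_snd)
      | exact (dI hu.memLp_fst hw.memLp_fst hw.memLp_fst).add
          (dI hu.memLp_snd hw.memLp_snd hw.memLp_snd)
      | exact (dI hu.memLp hw.memLp hu.memLp).const_mul _
      | exact (dI hu.memLp hw.memLp hw.memLp).const_mul _
  rw [integral_complex_ofReal, Complex.ofReal_eq_zero, integral_eq_zero_iff_of_nonneg] at e'
  · filter_upwards [e'] with x hx
    simp only [Pi.zero_apply] at hx
    have h1 : 0 ≤ ‖u₁ x - w₁ x‖ ^ 2 := by positivity
    have h2 : 0 ≤ ‖u₂ x - w₂ x‖ ^ 2 := by positivity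
    have h3 : 0 ≤ μ * ‖u x - w x‖ ^ 2 := by positivity
    have h4 : μ * ‖u x - w x‖ ^ 2 = 0 := by linarith
    have h5 : ‖u x - w x‖ = 0 := by simpa [hμ.ne'] using h4
    exact sub_eq_zero.1 (norm_eq_zero.1 h5)
  · intro x; positivity
  · have n {p r : ℝ × ℝ → ℂ} (hp : MemLp p 2 ν) (hr : MemLp r 2 ν) :
        Integrable (fun x => ‖p x - r x‖ ^ 2) ν :=
      (hp.sub hr).integrable_norm_pow (by norm_num)
    exact ((n hu.memLp_fst hw.memLp_fst).add (n hu.memLp_snd hw.memLp_snd)).add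
      ((n hu.memLp hw.memLp).const_mul _)

/-! ### The waveguide -/

/-- Lipschitz boundary: near each boundary point the set is, in suitable rotated Cartesian
coordinates `(ξ, η)` centred at the point, the set above the graph of a Lipschitz function. -/
def HasLipschitzBoundary (B : Set (ℝ × ℝ)) : Prop :=
  ∀ p ∈ frontier B, ∃ (θ r s : ℝ) (L : ℝ≥0) (γ : ℝ → ℝ), 0 < r ∧ 0 < s ∧ LipschitzWith L γ ∧
    ∀ ξ η : ℝ, |ξ| < r → |η| < s →
      ((p.1 + ξ * Real.cos θ - η * Real.sin θ, p.2 + ξ * Real.sin θ + η * Real.cos θ) ∈ B ↔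
        γ ξ < η)

/-- The admissible shapes of the rooms. -/
structure IsRoom (B : Set (ℝ × ℝ)) : Prop where
  isOpen : IsOpen B
  isConnected : IsConnected B
  isBounded : Bornology.IsBounded B
  lipschitz : HasLipschitzBoundary B
  subset : B ⊆ {x | |x.1| < 1 / 2 ∧ 0 < x.2}
  flat : ∃ R : ℝ, 0 < R ∧ R < 1 / 2 ∧ {x : ℝ × ℝ | |x.1| < R ∧ x.2 = 0} ⊆ frontier B

/-- The first coordinate `ε (j + 1/2)` of the centre of the `j`-th period cell. -/
def cellCenter (ε : ℝ) (j : ℤ) : ℝ := ε * ((j : ℝ) + 1 / 2)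

/-- The straight strip of width `ε`. -/
def strip (ε : ℝ) : Set (ℝ × ℝ) := {x | -ε < x.2 ∧ x.2 < 0}

/-- The `j`-th passage, of width `d` and height `h`. -/
def passage (ε d h : ℝ) (j : ℤ) : Set (ℝ × ℝ) :=
  {x | |x.1 - cellCenter ε j| < d / 2 ∧ 0 ≤ x.2 ∧ x.2 ≤ h}

/-- The `j`-th room, the translate of `ε B` by `(cellCenter ε j, h)`. -/
def room (B : Set (ℝ × ℝ)) (ε h : ℝ) (j : ℤ) : Set (ℝ × ℝ) :=
  {x | x - (cellCenter ε j, h) ∈ ε • B}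

/-- The waveguide. -/
def waveguide (B : Set (ℝ × ℝ)) (ε d h : ℝ) : Set (ℝ × ℝ) :=
  strip ε ∪ ⋃ j : ℤ, (room B ε h j ∪ passage ε d h j)

/-- The averaging operator `J₁` over the cross-section of the strip. -/
def J₁ (ε : ℝ) (u : ℝ × ℝ → ℂ) (x : ℝ) : ℂ :=
  ((1 / √ε : ℝ) : ℂ) * ∫ y in Set.Ioo (-ε) 0, u (x, y)

/-- The averaging operator `J₂` over the rooms (for each `x` at most one term of the series is
non-zero). -/
def J₂ (B : Set (ℝ × ℝ)) (ε h : ℝ) (u : ℝ × ℝ → ℂ) (x : ℝ) : ℂ :=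
  ∑' j : ℤ, (Set.Ioo (cellCenter ε j - ε / 2) (cellCenter ε j + ε / 2)).indicator
    (fun _ => ((1 / √(ε * volume.real (room B ε h j)) : ℝ) : ℂ) * ∫ y in room B ε h j, u y) x

/-! ### The limit problem -/

/-- `u ∈ H²(ℝ)` and `-u'' + μ (1 + q b / (q + μ)) u = f₁ + (q √b / (q + μ)) f₂`. -/
def SolvesLimitProblem (q b μ : ℝ) (f₁ f₂ u : ℝ → ℂ) : Prop :=
  ∃ u' u'' : ℝ → ℂ, IsH2Line u u' u'' ∧
    ∀ᵐ x : ℝ, -u'' x + ((μ * (1 + q * b / (q + μ)) : ℝ) : ℂ) * u x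
      = f₁ x + ((q * √b / (q + μ) : ℝ) : ℂ) * f₂ x

/-- `(u₁, u₂) ∈ H²(ℝ) × L₂(ℝ)` and `H (u₁, u₂) = (g₁, g₂)`, where `H` is the operator in
`L₂(ℝ)²` with matrix `((-d²/dx² + q b, -q √b), (-q √b, q))`. -/
def IsLimitOperator (q b : ℝ) (u₁ u₂ g₁ g₂ : ℝ → ℂ) : Prop :=
  MemLp u₂ 2 ∧ ∃ u₁' u₁'' : ℝ → ℂ, IsH2Line u₁ u₁' u₁'' ∧
    (∀ᵐ x : ℝ, g₁ x = -u₁'' x + ((q * b : ℝ) : ℂ) * u₁ x - ((q * √b : ℝ) : ℂ) * u₂ x) ∧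
    (∀ᵐ x : ℝ, g₂ x = -((q * √b : ℝ) : ℂ) * u₁ x + (q : ℂ) * u₂ x)

/-- `(u₁, u₂) = (H + μ)⁻¹ (f₁, f₂)` for the above operator `H` in `L₂(ℝ)²`. -/
def IsLimitResolvent (q b μ : ℝ) (f₁ f₂ u₁ u₂ : ℝ → ℂ) : Prop :=
  ∃ g₁ g₂ : ℝ → ℂ, IsLimitOperator q b u₁ u₂ g₁ g₂ ∧
    (∀ᵐ x : ℝ, g₁ x + (μ : ℂ) * u₁ x = f₁ x) ∧ (∀ᵐ x : ℝ, g₂ x + (μ : ℂ) * u₂ x = f₂ x)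

end ThinWaveguide

end

open ThinWaveguide

/-! The proof passes to the limit directly in the weak form of the resolvent equation. The test
function (`testFun`) equals `φ₁ x₁` in the strip, equals in each room the value of `φ₂` at the
centre of the cell, and is interpolated linearly in height through the passages. Strip and rooms
then contribute exactly integrals of `J₁ u`, `J₁ ∂₁u`, `J₂ u` and of the averages of `f`. Up to
small terms, a passage contributes `h⁻¹ (φ₂ - φ₁)(x_j)` times the flux `∫_{T_j} ∂₂u`. The whole
difficulty is to express this flux by the averages.

`IsRoom.exists_flux_estimate` shows that `d⁻¹ ∫_{T_j} ∂₂u` is the average of `u` over the room minus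
its average over the adjacent cell of the strip, with an error whose square is at most `C (N + 1)`
times the energy in the cell, where `2 ^ N` is comparable with `ε / d`. The vertical fundamental
theorem of calculus gives this for squares of side `d` near the two mouths
(`HasGrad.average_sub_average_flux`). Squares of side `d` and of side comparable with `ε` are
compared in `N` dyadic steps (`HasGrad.average_sub_average_dyadic`); the regions used overlap at
most twice, so the loss is only logarithmic. Inside the room, the last comparison is the Poincaré
inequality in a bounded Lipschitz domain (`exists_poincareOn`). Both it and the dyadic steps rest on
the translation inequality `HasWeakDeriv.lintegral_sub_sq_le`; connectedness and compactness spread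
it over the room.

The test functions see about `1 / ε` cells. By Cauchy-Schwarz over the cells, the flux errors,
summed with the weight `ε^(-1/2) d / h`, are of order `d / (h ε²) * √(ε² (N + 1))`. The first factor
is bounded because `d / (h ε² |B|)` converges to `q`, and the second tends to zero because `ε² ln d`
does. The main part of the flux carries the coefficient `d / (h ε² |B|)` and produces the coupling
by `q` (`IsRoom.tendsto_averaged_equation`).

The choices `(φ, 0)` and `(0, φ)` of the pair of test functions give two limit identities for the
bounded families `J₁ u` and `J₂ u`. No subsequence is extracted: in
`exists_limit_of_averaged_equations` the unknown `J₂ u` is eliminated by a linear combination, the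
weak solution `u₁` of the limit problem is subtracted, and the difference converges weakly to zero
because it may be tested with solutions of the same equation. The second identity then yields the
limit of `J₂ u`. -/

namespace ThinWaveguide

/-! ### Fundamental theorem of calculus and translation inequality for weak derivatives -/

section WeakFTC

variable {E : Type*} [NormedAddCommGroup E] [NormedSpace ℝ E]

lemma contDiff_test_translate {φ : E → ℝ} (h1 : ContDiff ℝ ∞ φ) (h2 : HasCompactSupport φ)
    {U Ω : Set E} (h3 : tsupport φ ⊆ U) {a : E} (hU : ∀ x ∈ U, x + a ∈ Ω) :
    ContDiff ℝ ∞ (fun x => φ (x - a)) ∧ HasCompactSupport (fun x => φ (x - a)) ∧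
      tsupport (fun x => φ (x - a)) ⊆ Ω := by
  have e : (fun x => φ (x - a)) = φ ∘ (Homeomorph.subRight a) := rfl
  refine ⟨h1.comp (contDiff_id.sub contDiff_const), ?_, ?_⟩
  · rw [e]; exact h2.comp_homeomorph _
  · rw [e, tsupport_comp_eq_preimage]
    intro x hx
    have := hU _ (h3 hx)
    simpa using this

variable [FiniteDimensional ℝ E] [MeasureSpace E] [BorelSpace E]
  [(volume : Measure E).IsAddHaarMeasure]

/-- In the definition of the weak derivative, one may integrate over the whole space. -/
lemma hasWeakDeriv_iff {E : Type*} [NormedAddCommGroup E] [NormedSpace ℝ E] [MeasureSpace E]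
    {Ω : Set E} {e : E} {u g : E → ℂ} : HasWeakDeriv Ω e u g ↔
    ∀ φ : E → ℝ, ContDiff ℝ ∞ φ → HasCompactSupport φ → tsupport φ ⊆ Ω →
      ∫ x, u x * ((fderiv ℝ φ x e : ℝ) : ℂ) = -∫ x, g x * ((φ x : ℝ) : ℂ) := by
  refine forall_congr' fun φ => forall_congr' fun _ => forall_congr' fun _ =>
    forall_congr' fun h3 => ?_
  rw [setIntegral_eq_integral_of_forall_compl_eq_zero,
    setIntegral_eq_integral_of_forall_compl_eq_zero]
  · intro x hx
    have : φ x = 0 := by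
      by_contra h0
      exact hx (h3 (subset_tsupport _ h0))
    simp [this]
  · intro x hx
    have : fderiv ℝ φ x = 0 := by
      by_contra h0
      exact hx (h3 (support_fderiv_subset ℝ h0))
    simp [this]

/-- Products of a locally integrable function with a translated compactly supported function are
integrable over the segment of translations. -/
lemma integrable_mul_translate {u : E → ℂ} (hu : LocallyIntegrable u) {ψ : E → ℝ}
    (hc : Continuous ψ) (hs : HasCompactSupport ψ) (w : E) :
    Integrable (fun p : ℝ × E => u p.2 * ((ψ (p.2 - p.1 • w) : ℝ) : ℂ))
      ((volume.restrict (Set.Ioc (0 : ℝ) 1)).prod volume) := by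
  -- The compact set swept by the translated supports. Only the values of `u` on it matter, so `u`
  -- may be replaced by an integrable function.
  set K : Set E := (fun p : ℝ × E => p.2 + p.1 • w) '' (Set.Icc (0 : ℝ) 1 ×ˢ tsupport ψ) with hK
  have hKc : IsCompact K := (isCompact_Icc.prod hs.isCompact).image (by fun_prop)
  have hKm : MeasurableSet K := hKc.isClosed.measurableSet
  have huK : Integrable (K.indicator u) :=
    (integrable_indicator_iff hKm).2 (hu.integrableOn_isCompact hKc)
  obtain ⟨M, hM⟩ := hs.exists_bound_of_continuous hc
  have h1 : Integrable (fun p : ℝ × E => K.indicator u p.2)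
      ((volume.restrict (Set.Ioc (0 : ℝ) 1)).prod volume) := huK.comp_snd _
  have hcont : Continuous fun p : ℝ × E => ((ψ (p.2 - p.1 • w) : ℝ) : ℂ) :=
    Complex.continuous_ofReal.comp (hc.comp (by fun_prop))
  have h2 := h1.mul_bdd (c := M) (g := fun p : ℝ × E => ((ψ (p.2 - p.1 • w) : ℝ) : ℂ))
    hcont.aestronglyMeasurable (Eventually.of_forall fun p => by simpa using hM _)
  refine h2.congr ?_
  have : ∀ᵐ p ∂((volume.restrict (Set.Ioc (0 : ℝ) 1)).prod (volume : Measure E)),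
      p.1 ∈ Set.Ioc (0 : ℝ) 1 :=
    Measure.quasiMeasurePreserving_fst.ae (ae_restrict_mem measurableSet_Ioc)
  filter_upwards [this] with p hp
  by_cases hx : p.2 ∈ K
  · simp [hx]
  · have : ψ (p.2 - p.1 • w) = 0 := by
      by_contra h0
      exact hx ⟨(p.1, p.2 - p.1 • w), ⟨⟨hp.1.le, hp.2⟩, subset_tsupport _ h0⟩, by simp⟩
    simp [this]

/-- The fundamental theorem of calculus along segments, for weak derivatives. -/
theorem HasWeakDeriv.ae_sub_eq_integral {Ω U : Set E} (hU : IsOpen U) {w : E} {u g : E → ℂ}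
    (hu : LocallyIntegrable u) (hg : LocallyIntegrable g) (hug : HasWeakDeriv Ω w u g)
    (hseg : ∀ x ∈ U, ∀ s ∈ Set.Icc (0 : ℝ) 1, x + s • w ∈ Ω) :
    ∀ᵐ x : E, x ∈ U → u (x + w) - u x = ∫ s in (0 : ℝ)..1, g (x + s • w) := by
  set ν : Measure ℝ := volume.restrict (Set.Ioc (0 : ℝ) 1) with hν
  -- The shear `(s, x) ↦ (s, x + s w)` transfers measurability and integrability between `g x * φ (x
  -- - s w)` and `g (x + s w) * φ x`.
  have hshear : MeasurePreserving (fun p : ℝ × E => (p.1, p.2 + p.1 • w))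
      (ν.prod volume) (ν.prod volume) :=
    (MeasurePreserving.id ν).skew_product (g := fun s x => x + s • w)
      (by fun_prop) (Eventually.of_forall fun s =>
        (measurePreserving_add_right volume (s • w)).map_eq)
  have hgφ {φ : E → ℝ} (h1 : Continuous φ) (h2 : HasCompactSupport φ) :
      Integrable (fun p : ℝ × E => g (p.2 + p.1 • w) * ((φ p.2 : ℝ) : ℂ)) (ν.prod volume) := by
    have := integrable_mul_translate hg h1 h2 w
    have h' := (hshear.integrable_comp this.aestronglyMeasurable).2 this
    simpa [Function.comp_def] using h'
  have hI {φ : E → ℝ} (h1 : Continuous φ) (h2 : HasCompactSupport φ) :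
      Integrable fun x => (∫ s in (0 : ℝ)..1, g (x + s • w)) * ((φ x : ℝ) : ℂ) := by
    have := (hgφ h1 h2).integral_prod_right
    refine this.congr (Eventually.of_forall fun x => ?_)
    simp only [integral_mul_const]
    rw [intervalIntegral.integral_of_le zero_le_one]
  have hloc : LocallyIntegrable (fun x => u (x + w) - u x - ∫ s in (0 : ℝ)..1, g (x + s • w)) := by
    refine LocallyIntegrable.sub (LocallyIntegrable.sub ?_ hu) ?_
    · rw [locallyIntegrable_iff] at hu ⊢
      intro K hK
      have h1 := hu ((fun x => x + w) '' K) (hK.image (by fun_prop))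
      have := (measurePreserving_add_right (volume : Measure E) w).integrableOn_image
        (Homeomorph.addRight w).measurableEmbedding (f := u) (s := K)
      exact this.1 h1
    · rw [locallyIntegrable_iff]
      intro K hK
      obtain ⟨φ, hφ1, -, hφ2, -⟩ := exists_continuous_one_zero_of_isCompact hK isClosed_empty
        (Set.disjoint_empty K)
      refine ((hI φ.continuous hφ2).integrableOn (s := K)).congr_fun ?_ hK.isClosed.measurableSet
      intro x hx
      simp [hφ1 hx]
  refine (hU.ae_eq_zero_of_integral_contDiff_smul_eq_zero (hloc.locallyIntegrableOn U) ?_).mono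
    fun x hx hxU => sub_eq_zero.1 (hx hxU)
  -- By the du Bois-Reymond lemma it suffices to integrate against test functions supported in `U`;
  -- their translates along the segment stay supported in `Ω` by `hseg`.
  intro φ h1 h2 h3
  have htr (s : ℝ) (hs : s ∈ Set.Icc (0 : ℝ) 1) :=
    contDiff_test_translate h1 h2 h3 (a := s • w) (Ω := Ω) fun x hx => hseg x hx s hs
  have hφ'c : Continuous fun x => fderiv ℝ φ x w :=
    (h1.continuous_fderiv (by simp)).clm_apply continuous_const
  have hφ's : HasCompactSupport fun x => fderiv ℝ φ x w := h2.fderiv_apply ℝ w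
  -- The weak derivative is applied to the translate `φ (· - s w)`; averaging the result over `s ∈
  -- [0, 1]` will give the claim.
  have hA (s : ℝ) (hs : s ∈ Set.Icc (0 : ℝ) 1) :
      ∫ x, u x * ((fderiv ℝ φ (x - s • w) w : ℝ) : ℂ) = -∫ x, g (x + s • w) * ((φ x : ℝ) : ℂ) := by
    obtain ⟨t1, t2, t3⟩ := htr s hs
    have := hasWeakDeriv_iff.1 hug _ t1 t2 t3
    simp only [fderiv_comp_sub] at this
    rw [this, ← integral_add_right_eq_self _ (s • w)]
    simp
  have hswap1 := integral_integral_swap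
    (f := fun s x => u x * ((fderiv ℝ φ (x - s • w) w : ℝ) : ℂ))
    (integrable_mul_translate hu hφ'c hφ's w)
  have hswap2 := integral_integral_swap
    (f := fun s x => g (x + s • w) * ((φ x : ℝ) : ℂ)) (hgφ h1.continuous h2)
  -- The derivative of `s ↦ -φ (x - s w)` is the directional derivative of `φ`, so its integral over
  -- the segment telescopes.
  have hL (x : E) : ∫ s in Set.Ioc (0 : ℝ) 1, ((fderiv ℝ φ (x - s • w) w : ℝ) : ℂ)
      = ((φ x : ℝ) : ℂ) - ((φ (x - w) : ℝ) : ℂ) := by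
    rw [integral_complex_ofReal, ← intervalIntegral.integral_of_le zero_le_one]
    have := intervalIntegral.integral_eq_sub_of_hasDerivAt (a := 0) (b := 1)
      (f := fun s : ℝ => -φ (x - s • w)) (f' := fun s => fderiv ℝ φ (x - s • w) w) ?_ ?_
    · rw [this]; simp; ring
    · intro s _
      have hd : HasDerivAt (fun s : ℝ => x - s • w) (-w) s := by
        simpa using ((hasDerivAt_id s).smul_const w).const_sub x
      have := ((h1.differentiable (by simp)) (x - s • w)).hasFDerivAt.comp_hasDerivAt s hd
      simpa using HasDerivAt.fun_neg (f := fun s : ℝ => φ (x - s • w)) this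
    · exact (hφ'c.comp (by fun_prop)).intervalIntegrable _ _
  have hmain : ∫ x, u x * (((φ x : ℝ) : ℂ) - ((φ (x - w) : ℝ) : ℂ))
      = -∫ x, (∫ s in (0 : ℝ)..1, g (x + s • w)) * ((φ x : ℝ) : ℂ) := by
    calc _ = ∫ x, ∫ s in Set.Ioc (0 : ℝ) 1, u x * ((fderiv ℝ φ (x - s • w) w : ℝ) : ℂ) := by
          congr 1; ext x; rw [integral_const_mul, hL]
      _ = ∫ s in Set.Ioc (0 : ℝ) 1, -∫ x, g (x + s • w) * ((φ x : ℝ) : ℂ) := by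
          rw [← hswap1]
          exact setIntegral_congr_fun measurableSet_Ioc fun s hs => hA s ⟨hs.1.le, hs.2⟩
      _ = _ := by
          rw [integral_neg, hswap2]
          congr 2; ext x
          rw [integral_mul_const, intervalIntegral.integral_of_le zero_le_one]
  have hmul {ψ : E → ℝ} (hc : Continuous ψ) (hs : HasCompactSupport ψ) :
      Integrable fun x => u x * ((ψ x : ℝ) : ℂ) := by
    have := hu.integrable_smul_left_of_hasCompactSupport hc hs
    refine this.congr (Eventually.of_forall fun x => ?_)
    simp [mul_comm]
  obtain ⟨t1, t2, -⟩ := htr 1 (by simp)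
  simp only [one_smul] at t1 t2
  have i1 := hmul h1.continuous h2
  have i2 := hmul t1.continuous t2
  have i3 := hI h1.continuous h2
  have i4 : Integrable fun x => u (x + w) * ((φ x : ℝ) : ℂ) := by
    simpa using i2.comp_add_right w
  have e4 : ∫ x, u (x + w) * ((φ x : ℝ) : ℂ) = ∫ x, u x * ((φ (x - w) : ℝ) : ℂ) := by
    rw [← integral_add_right_eq_self (fun x => u x * ((φ (x - w) : ℝ) : ℂ)) w]
    simp
  simp only [mul_sub] at hmain
  rw [integral_sub i1 i2] at hmain
  have : ∀ x, φ x • (u (x + w) - u x - ∫ s in (0 : ℝ)..1, g (x + s • w))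
      = u (x + w) * ((φ x : ℝ) : ℂ) - u x * ((φ x : ℝ) : ℂ)
        - (∫ s in (0 : ℝ)..1, g (x + s • w)) * ((φ x : ℝ) : ℂ) := fun x => by
    rw [Complex.real_smul]; ring
  simp only [this]
  have i5 : Integrable fun x => u (x + w) * ((φ x : ℝ) : ℂ) - u x * ((φ x : ℝ) : ℂ) := i4.sub i1
  rw [integral_sub i5 i3, integral_sub i4 i1, e4]
  linear_combination -hmain

lemma sq_lintegral_le_lintegral_sq {α : Type*} [MeasurableSpace α] {ν : Measure α}
    [IsProbabilityMeasure ν] {f : α → ℝ≥0∞} (hf : AEMeasurable f ν) :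
    (∫⁻ x, f x ∂ν) ^ 2 ≤ ∫⁻ x, f x ^ 2 ∂ν := by
  have h := ENNReal.lintegral_mul_le_Lp_mul_Lq ν Real.HolderConjugate.two_two hf
    (aemeasurable_const (b := (1 : ℝ≥0∞)))
  simp only [Pi.mul_apply, mul_one, ENNReal.one_rpow, lintegral_const, measure_univ] at h
  calc _ ≤ ((∫⁻ x, f x ^ (2 : ℝ) ∂ν) ^ (1 / 2 : ℝ)) ^ 2 := by gcongr
    _ = ∫⁻ x, f x ^ 2 ∂ν := by
      rw [← ENNReal.rpow_natCast, ← ENNReal.rpow_mul]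
      simp

/-- Translation inequality for weak derivatives. -/
theorem HasWeakDeriv.lintegral_sub_sq_le {Ω U V : Set E} (hU : IsOpen U) {w : E}
    {u g : E → ℂ} (hu : LocallyIntegrable u) (hg : LocallyIntegrable g)
    (hug : HasWeakDeriv Ω w u g) (hV : MeasurableSet V) (hVΩ : V ⊆ Ω)
    (hseg : ∀ x ∈ U, ∀ s ∈ Set.Icc (0 : ℝ) 1, x + s • w ∈ V) :
    ∫⁻ x in U, ‖u (x + w) - u x‖ₑ ^ 2 ≤ ∫⁻ x in V, ‖g x‖ₑ ^ 2 := by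
  set ν : Measure ℝ := volume.restrict (Set.Ioc (0 : ℝ) 1) with hν
  have : IsProbabilityMeasure ν := ⟨by simp [hν]⟩
  have hshear : MeasurePreserving (fun p : ℝ × E => (p.1, p.2 + p.1 • w))
      (ν.prod volume) (ν.prod volume) :=
    (MeasurePreserving.id ν).skew_product (g := fun s x => x + s • w)
      (by fun_prop) (Eventually.of_forall fun s =>
        (measurePreserving_add_right volume (s • w)).map_eq)
  have hgm : AEStronglyMeasurable g := hg.aestronglyMeasurable
  have hms : AEStronglyMeasurable (fun p : ℝ × E => g (p.2 + p.1 • w)) (ν.prod volume) :=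
    (hgm.comp_snd (μ := ν)).comp_quasiMeasurePreserving hshear.quasiMeasurePreserving
  have hm : AEMeasurable (fun p : ℝ × E => ‖g (p.2 + p.1 • w)‖ₑ) (ν.prod volume) := hms.enorm
  have hm' : AEMeasurable (fun p : E × ℝ => ‖g (p.1 + p.2 • w)‖ₑ ^ 2) ((volume.restrict U).prod ν) := by
    have h0 : AEMeasurable (fun p : E × ℝ => ‖g (p.1 + p.2 • w)‖ₑ ^ 2) (volume.prod ν) :=
      (hm.comp_quasiMeasurePreserving Measure.measurePreserving_swap.quasiMeasurePreserving).pow_const 2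
    exact h0.mono_measure (Measure.prod_mono Measure.restrict_le_self le_rfl)
  have hae : ∀ᵐ x : E, AEMeasurable (fun s => ‖g (x + s • w)‖ₑ) ν := by
    have h0 : AEStronglyMeasurable (fun p : E × ℝ => g (p.1 + p.2 • w)) (volume.prod ν) :=
      hms.comp_quasiMeasurePreserving Measure.measurePreserving_swap.quasiMeasurePreserving
    filter_upwards [h0.prodMk_left] with x hx using hx.enorm
  calc ∫⁻ x in U, ‖u (x + w) - u x‖ₑ ^ 2
      ≤ ∫⁻ x in U, ∫⁻ s, ‖g (x + s • w)‖ₑ ^ 2 ∂ν := by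
        refine lintegral_mono_ae ?_
        have h0 := hug.ae_sub_eq_integral hU hu hg (fun x hx s hs => hVΩ (hseg x hx s hs))
        filter_upwards [ae_restrict_mem hU.measurableSet, ae_restrict_of_ae h0,
          ae_restrict_of_ae hae] with x hx h1 h2
        rw [h1 hx, intervalIntegral.integral_of_le zero_le_one]
        refine le_trans ?_ (sq_lintegral_le_lintegral_sq h2)
        gcongr
        exact enorm_integral_le_lintegral_enorm _
    _ = ∫⁻ s, (∫⁻ x in U, ‖g (x + s • w)‖ₑ ^ 2) ∂ν := lintegral_lintegral_swap hm'
    -- For fixed `s` the translation by `s w` preserves the measure and carries `U` into `V`.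
    _ ≤ ∫⁻ s, (∫⁻ x in V, ‖g x‖ₑ ^ 2) ∂ν := by
        refine lintegral_mono_ae ?_
        filter_upwards [ae_restrict_mem measurableSet_Ioc] with s hs
        rw [← lintegral_indicator hU.measurableSet, ← lintegral_indicator hV,
          ← lintegral_add_right_eq_self (V.indicator fun x => ‖g x‖ₑ ^ 2) (s • w)]
        refine lintegral_mono (Set.indicator_le fun x hx => ?_)
        rw [Set.indicator_of_mem (hseg x hx s ⟨hs.1.le, hs.2⟩)]
    _ = ∫⁻ x in V, ‖g x‖ₑ ^ 2 := by simp

end WeakFTC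

/-! ### Averages and Poincaré inequalities in convex sets -/

/-- Deviation of an average from a constant. -/
lemma enorm_average_sub_sq_le {α : Type*} [MeasurableSpace α] {ν : Measure α} {A : Set α}
    (h0 : ν A ≠ 0) (h1 : ν A ≠ ⊤) {u : α → ℂ} (hu : IntegrableOn u A ν) (c : ℂ) :
    ‖(⨍ x in A, u x ∂ν) - c‖ₑ ^ 2 ≤ (ν A)⁻¹ * ∫⁻ x in A, ‖u x - c‖ₑ ^ 2 ∂ν := by
  have hfin : IsFiniteMeasure (ν.restrict A) := ⟨by simpa using h1.lt_top⟩
  set ρ : Measure α := ((ν.restrict A) Set.univ)⁻¹ • ν.restrict A with hρ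
  have hρ1 : IsProbabilityMeasure ρ := ⟨by
    rw [hρ]; simpa using ENNReal.inv_mul_cancel h0 h1⟩
  have huρ : Integrable u ρ := hu.smul_measure (by simpa using h0)
  have e : (⨍ x in A, u x ∂ν) - c = ∫ x, (u x - c) ∂ρ := by
    rw [integral_sub huρ (integrable_const c)]
    rw [integral_const, probReal_univ, one_smul]
    rfl
  rw [e]
  calc ‖∫ x, (u x - c) ∂ρ‖ₑ ^ 2 ≤ (∫⁻ x, ‖u x - c‖ₑ ∂ρ) ^ 2 := by
        gcongr; exact enorm_integral_le_lintegral_enorm _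
    _ ≤ ∫⁻ x, ‖u x - c‖ₑ ^ 2 ∂ρ :=
        sq_lintegral_le_lintegral_sq (huρ.sub (integrable_const c)).aestronglyMeasurable.enorm
    _ = _ := by rw [hρ, lintegral_smul_measure]; simp

/-- `u ∈ L₂(ℝ²)` has the weak gradient `(u₁, u₂) ∈ L₂` in `Ω`; outside of `Ω` the functions are
arbitrary. -/
structure HasGrad (Ω : Set (ℝ × ℝ)) (u u₁ u₂ : ℝ × ℝ → ℂ) : Prop where
  memLp : MemLp u 2
  memLp_fst : MemLp u₁ 2
  memLp_snd : MemLp u₂ 2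
  deriv_fst : HasWeakDeriv Ω ((1, 0) : ℝ × ℝ) u u₁
  deriv_snd : HasWeakDeriv Ω ((0, 1) : ℝ × ℝ) u u₂

lemma _root_.MeasureTheory.MemLp.locInt {E : Type*} [NormedAddCommGroup E] [MeasureSpace E]
    [IsLocallyFiniteMeasure (volume : Measure E)] {u : E → ℂ} (hu : MemLp u 2) :
    LocallyIntegrable u := hu.locallyIntegrable (by norm_num)

lemma locallyIntegrable_mul_test {u : ℝ × ℝ → ℂ} (hu : LocallyIntegrable u) {ψ : ℝ × ℝ → ℝ}
    (hc : Continuous ψ) (hs : HasCompactSupport ψ) :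
    Integrable fun x => u x * ((ψ x : ℝ) : ℂ) := by
  have := hu.integrable_smul_left_of_hasCompactSupport hc hs
  refine this.congr (Eventually.of_forall fun x => ?_)
  simp [mul_comm]

lemma HasGrad.hasWeakDeriv {Ω : Set (ℝ × ℝ)} {u u₁ u₂ : ℝ × ℝ → ℂ} (h : HasGrad Ω u u₁ u₂)
    (w : ℝ × ℝ) : HasWeakDeriv Ω w u (fun x => w.1 * u₁ x + w.2 * u₂ x) := by
  intro φ h1 h2 h3
  have e1 := h.deriv_fst φ h1 h2 h3
  have e2 := h.deriv_snd φ h1 h2 h3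
  have hc (e : ℝ × ℝ) : Continuous fun x => fderiv ℝ φ x e :=
    (h1.continuous_fderiv (by simp)).clm_apply continuous_const
  have i1 (e : ℝ × ℝ) : Integrable (fun x => u x * ((fderiv ℝ φ x e : ℝ) : ℂ))
      (volume.restrict Ω) :=
    (locallyIntegrable_mul_test h.memLp.locInt (hc e) (h2.fderiv_apply ℝ e)).restrict
  have i2 : Integrable (fun x => u₁ x * ((φ x : ℝ) : ℂ)) (volume.restrict Ω) :=
    (locallyIntegrable_mul_test h.memLp_fst.locInt h1.continuous h2).restrict
  have i3 : Integrable (fun x => u₂ x * ((φ x : ℝ) : ℂ)) (volume.restrict Ω) :=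
    (locallyIntegrable_mul_test h.memLp_snd.locInt h1.continuous h2).restrict
  have hw (x : ℝ × ℝ) : u x * ((fderiv ℝ φ x w : ℝ) : ℂ)
      = w.1 * (u x * ((fderiv ℝ φ x (1, 0) : ℝ) : ℂ))
        + w.2 * (u x * ((fderiv ℝ φ x (0, 1) : ℝ) : ℂ)) := by
    have : w = w.1 • ((1, 0) : ℝ × ℝ) + w.2 • ((0, 1) : ℝ × ℝ) := by ext <;> simp
    conv_lhs => rw [this]
    simp only [map_add, map_smul, smul_eq_mul, Complex.ofReal_add, Complex.ofReal_mul]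
    ring
  simp only [hw]
  rw [integral_add ((i1 _).const_mul _) ((i1 _).const_mul _), integral_const_mul,
    integral_const_mul, e1, e2]
  have hr (x : ℝ × ℝ) : ((w.1 : ℂ) * u₁ x + w.2 * u₂ x) * ((φ x : ℝ) : ℂ)
      = w.1 * (u₁ x * ((φ x : ℝ) : ℂ)) + w.2 * (u₂ x * ((φ x : ℝ) : ℂ)) := by ring
  simp only [hr]
  rw [integral_add (i2.const_mul _) (i3.const_mul _), integral_const_mul, integral_const_mul]
  ring

/-- Translation inequality for functions with a square integrable gradient. -/
lemma HasGrad.lintegral_sub_sq_le {Ω U V : Set (ℝ × ℝ)} {u u₁ u₂ : ℝ × ℝ → ℂ}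
    (h : HasGrad Ω u u₁ u₂) (hU : IsOpen U) (hV : MeasurableSet V) (hVΩ : V ⊆ Ω) {w : ℝ × ℝ}
    (hseg : ∀ x ∈ U, ∀ s ∈ Set.Icc (0 : ℝ) 1, x + s • w ∈ V) {D : ℝ}
    (hD : w.1 ^ 2 + w.2 ^ 2 ≤ D) :
    ∫⁻ x in U, ‖u (x + w) - u x‖ₑ ^ 2
      ≤ ENNReal.ofReal D * ∫⁻ x in V, (‖u₁ x‖ₑ ^ 2 + ‖u₂ x‖ₑ ^ 2) := by
  have hg : LocallyIntegrable (fun x => (w.1 : ℂ) * u₁ x + w.2 * u₂ x) :=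
    ((h.memLp_fst.const_mul _).add (h.memLp_snd.const_mul _)).locInt
  refine ((h.hasWeakDeriv w).lintegral_sub_sq_le hU h.memLp.locInt hg hV hVΩ hseg).trans ?_
  rw [← lintegral_const_mul' _ _ ENNReal.ofReal_ne_top]
  refine lintegral_mono fun x => ?_
  have key : ‖(w.1 : ℂ) * u₁ x + w.2 * u₂ x‖ ^ 2 ≤ D * (‖u₁ x‖ ^ 2 + ‖u₂ x‖ ^ 2) := by
    have h1 : ‖(w.1 : ℂ) * u₁ x + w.2 * u₂ x‖ ≤ |w.1| * ‖u₁ x‖ + |w.2| * ‖u₂ x‖ := by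
      refine (norm_add_le _ _).trans ?_
      simp
    calc _ ≤ (|w.1| * ‖u₁ x‖ + |w.2| * ‖u₂ x‖) ^ 2 := by gcongr
      _ ≤ (|w.1| ^ 2 + |w.2| ^ 2) * (‖u₁ x‖ ^ 2 + ‖u₂ x‖ ^ 2) := by
        nlinarith [sq_nonneg (|w.1| * ‖u₂ x‖ - |w.2| * ‖u₁ x‖)]
      _ ≤ _ := by simp only [sq_abs]; gcongr
  have e (z : ℂ) : ‖z‖ₑ ^ 2 = ENNReal.ofReal (‖z‖ ^ 2) := by
    rw [← ofReal_norm, ENNReal.ofReal_pow (norm_nonneg _)]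
  rw [e, e, e, ← ENNReal.ofReal_add (by positivity) (by positivity),
    ← ENNReal.ofReal_mul (le_trans (by positivity) hD)]
  exact ENNReal.ofReal_le_ofReal key

/-- Poincaré type inequality in a convex set. -/
lemma HasGrad.lintegral_lintegral_sub_sq_le {Ω K W A A' : Set (ℝ × ℝ)} {u u₁ u₂ : ℝ × ℝ → ℂ}
    (h : HasGrad Ω u u₁ u₂) (hK : IsOpen K) (hconv : Convex ℝ K) (hKΩ : K ⊆ Ω)
    (hW : MeasurableSet W) {D : ℝ} (hD : ∀ w ∈ W, w.1 ^ 2 + w.2 ^ 2 ≤ D)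
    (hKW : ∀ x ∈ K, ∀ y ∈ K, y - x ∈ W) (hA : MeasurableSet A) (hA' : MeasurableSet A')
    (hAK : A ⊆ K) (hAK' : A' ⊆ K) :
    ∫⁻ x in A', ∫⁻ y in A, ‖u y - u x‖ₑ ^ 2
      ≤ volume W * ENNReal.ofReal D * ∫⁻ x in K, (‖u₁ x‖ₑ ^ 2 + ‖u₂ x‖ₑ ^ 2) := by
  set F : (ℝ × ℝ) × (ℝ × ℝ) → ℝ≥0∞ := fun p => (K ×ˢ K).indicator
    (fun p => ‖u p.2 - u p.1‖ₑ ^ 2) p with hF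
  have hum : AEStronglyMeasurable u := h.memLp.aestronglyMeasurable
  have hFm : AEMeasurable F (volume.prod volume) := by
    have h0 : AEStronglyMeasurable (fun p : (ℝ × ℝ) × (ℝ × ℝ) => u p.2 - u p.1)
        (volume.prod volume) := hum.comp_snd.sub hum.comp_fst
    exact (h0.enorm.pow_const 2).indicator (hK.measurableSet.prod hK.measurableSet)
  have hmp := measurePreserving_prod_add (volume : Measure (ℝ × ℝ)) (volume : Measure (ℝ × ℝ))
  have hFm' : AEMeasurable (fun p : (ℝ × ℝ) × (ℝ × ℝ) => F (p.1, p.1 + p.2))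
      (volume.prod volume) := hFm.comp_quasiMeasurePreserving hmp.quasiMeasurePreserving
  calc ∫⁻ x in A', ∫⁻ y in A, ‖u y - u x‖ₑ ^ 2
      ≤ ∫⁻ x, ∫⁻ y, F (x, y) := by
        rw [← lintegral_indicator hA']
        refine lintegral_mono (Set.indicator_le fun x hx => ?_)
        rw [← lintegral_indicator hA]
        refine lintegral_mono (Set.indicator_le fun y hy => ?_)
        rw [hF]
        simp only
        rw [Set.indicator_of_mem (Set.mk_mem_prod (hAK' hx) (hAK hy))]
    -- With `y = x + w` and the order of integration exchanged, the inner integral is a translation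
    -- estimate for the fixed vector `w`, and `w` runs only through the set `W` of differences.
    _ = ∫⁻ x, ∫⁻ w, F (x, x + w) := by
        congr 1; ext x
        rw [lintegral_add_left_eq_self (fun y => F (x, y)) x]
    _ = ∫⁻ w, ∫⁻ x, F (x, x + w) := lintegral_lintegral_swap hFm'
    _ ≤ ∫⁻ w, W.indicator (fun _ => ENNReal.ofReal D *
          ∫⁻ x in K, (‖u₁ x‖ₑ ^ 2 + ‖u₂ x‖ₑ ^ 2)) w := by
        refine lintegral_mono fun w => ?_
        by_cases hw : w ∈ W
        · rw [Set.indicator_of_mem hw]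
          -- The points that remain in `K` after the shift; by convexity the whole segment then lies
          -- in `K`.
          set U : Set (ℝ × ℝ) := K ∩ (fun x => x + w) ⁻¹' K with hU
          have hUo : IsOpen U := hK.inter (hK.preimage (by fun_prop))
          refine le_trans (le_of_eq ?_) (h.lintegral_sub_sq_le hUo hK.measurableSet hKΩ
            (w := w) ?_ (hD w hw))
          · rw [← lintegral_indicator hUo.measurableSet]
            rfl
          · intro x hx s hs
            have := hconv hx.1 hx.2 (a := 1 - s) (b := s) (by linarith [hs.2]) hs.1 (by ring)
            convert this using 1
            module
        · rw [Set.indicator_of_notMem hw]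
          refine le_of_eq ?_
          rw [lintegral_eq_zero_iff']
          · refine Eventually.of_forall fun x => ?_
            simp only [hF, Pi.zero_apply]
            refine Set.indicator_of_notMem (fun hx => hw ?_) _
            have := hKW _ hx.1 _ hx.2
            simpa using this
          · have : (fun x => F (x, x + w)) = ((K ∩ (fun x => x + w) ⁻¹' K)).indicator
                (fun x => ‖u (x + w) - u x‖ₑ ^ 2) := by
              rfl
            rw [this]
            refine AEMeasurable.indicator ?_
              (hK.inter (hK.preimage (by fun_prop))).measurableSet
            exact ((hum.comp_quasiMeasurePreserving
              (measurePreserving_add_right _ w).quasiMeasurePreserving).sub hum).enorm.pow_const 2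
    _ = _ := by
        rw [lintegral_indicator hW, setLIntegral_const]; ring

lemma _root_.MeasureTheory.MemLp.integrable_norm_sq {α : Type*} [MeasurableSpace α]
    {ν : Measure α} {f : α → ℂ} (hf : MemLp f 2 ν) : Integrable (fun x => ‖f x‖ ^ 2) ν :=
  hf.integrable_norm_pow (by norm_num)

lemma enorm_sq_eq_ofReal (z : ℂ) : ‖z‖ₑ ^ 2 = ENNReal.ofReal (‖z‖ ^ 2) := by
  rw [← ofReal_norm, ENNReal.ofReal_pow (norm_nonneg _)]

lemma _root_.MeasureTheory.MemLp.lintegral_enorm_sq {α : Type*} [MeasurableSpace α]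
    {ν : Measure α} {f : α → ℂ} (hf : MemLp f 2 ν) :
    ∫⁻ x, ‖f x‖ₑ ^ 2 ∂ν = ENNReal.ofReal (∫ x, ‖f x‖ ^ 2 ∂ν) := by
  rw [ofReal_integral_eq_lintegral_ofReal hf.integrable_norm_sq
    (Eventually.of_forall fun x => by positivity)]
  simp only [enorm_sq_eq_ofReal]

lemma HasGrad.integrable_energy {Ω : Set (ℝ × ℝ)} {u u₁ u₂ : ℝ × ℝ → ℂ}
    (h : HasGrad Ω u u₁ u₂) : Integrable fun x => ‖u₁ x‖ ^ 2 + ‖u₂ x‖ ^ 2 :=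
  h.memLp_fst.integrable_norm_sq.add h.memLp_snd.integrable_norm_sq

lemma HasGrad.lintegral_energy {Ω : Set (ℝ × ℝ)} {u u₁ u₂ : ℝ × ℝ → ℂ}
    (h : HasGrad Ω u u₁ u₂) (K : Set (ℝ × ℝ)) :
    ∫⁻ x in K, (‖u₁ x‖ₑ ^ 2 + ‖u₂ x‖ₑ ^ 2)
      = ENNReal.ofReal (∫ x in K, (‖u₁ x‖ ^ 2 + ‖u₂ x‖ ^ 2)) := by
  rw [ofReal_integral_eq_lintegral_ofReal h.integrable_energy.integrableOn
    (Eventually.of_forall fun x => by positivity)]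
  congr 1; ext x
  rw [ENNReal.ofReal_add (by positivity) (by positivity), enorm_sq_eq_ofReal, enorm_sq_eq_ofReal]

lemma energy_nonneg (u₁ u₂ : ℝ × ℝ → ℂ) (K : Set (ℝ × ℝ)) :
    0 ≤ ∫ x in K, (‖u₁ x‖ ^ 2 + ‖u₂ x‖ ^ 2) :=
  integral_nonneg fun x => by positivity

lemma HasGrad.energy_mono {Ω : Set (ℝ × ℝ)} {u u₁ u₂ : ℝ × ℝ → ℂ}
    (h : HasGrad Ω u u₁ u₂) {K L : Set (ℝ × ℝ)} (hKL : K ⊆ L) :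
    ∫ x in K, (‖u₁ x‖ ^ 2 + ‖u₂ x‖ ^ 2) ≤ ∫ x in L, (‖u₁ x‖ ^ 2 + ‖u₂ x‖ ^ 2) :=
  setIntegral_mono_set h.integrable_energy.integrableOn
    (Eventually.of_forall fun x => by positivity) (Eventually.of_forall hKL)

lemma norm_average_sub_sq_le {A : Set (ℝ × ℝ)} (h0 : volume A ≠ 0) (h1 : volume A ≠ ⊤)
    {u : ℝ × ℝ → ℂ} (hu : MemLp u 2 (volume.restrict A)) (c : ℂ) :
    ‖(⨍ x in A, u x) - c‖ ^ 2 ≤ (volume.real A)⁻¹ * ∫ x in A, ‖u x - c‖ ^ 2 := by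
  have hfin : IsFiniteMeasure (volume.restrict A) := ⟨by simpa using h1.lt_top⟩
  have hi : IntegrableOn u A := hu.integrable (by norm_num)
  have key := enorm_average_sub_sq_le h0 h1 hi c
  have hm : MemLp (fun x => u x - c) 2 (volume.restrict A) := hu.sub (memLp_const c)
  rw [enorm_sq_eq_ofReal, hm.lintegral_enorm_sq] at key
  have hA : (volume A)⁻¹ = ENNReal.ofReal ((volume.real A)⁻¹) := by
    rw [measureReal_def, ENNReal.ofReal_inv_of_pos (ENNReal.toReal_pos h0 h1), ENNReal.ofReal_toReal h1]
  rw [hA, ← ENNReal.ofReal_mul (by positivity)] at key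
  exact (ENNReal.ofReal_le_ofReal_iff (mul_nonneg (by positivity)
    (integral_nonneg fun x => by positivity))).1 key

/-- Deviation from the average over a subset in a convex set. -/
lemma HasGrad.integral_sub_average_sq_le {Ω K W A A' : Set (ℝ × ℝ)} {u u₁ u₂ : ℝ × ℝ → ℂ}
    (h : HasGrad Ω u u₁ u₂) (hK : IsOpen K) (hconv : Convex ℝ K) (hKΩ : K ⊆ Ω)
    (hW : MeasurableSet W) (hWf : volume W ≠ ⊤) {D : ℝ} (hD : ∀ w ∈ W, w.1 ^ 2 + w.2 ^ 2 ≤ D)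
    (hKW : ∀ x ∈ K, ∀ y ∈ K, y - x ∈ W) (hA : MeasurableSet A) (hA' : MeasurableSet A')
    (hAK : A ⊆ K) (hAK' : A' ⊆ K) (h0 : volume A ≠ 0) (h1 : volume A ≠ ⊤)
    (h1' : volume A' ≠ ⊤) (hD0 : 0 ≤ D) :
    ∫ x in A', ‖u x - ⨍ y in A, u y‖ ^ 2
      ≤ (volume.real A)⁻¹ * (volume.real W * D) * ∫ x in K, (‖u₁ x‖ ^ 2 + ‖u₂ x‖ ^ 2) := by
  have hfin : IsFiniteMeasure (volume.restrict A') := ⟨by simpa using h1'.lt_top⟩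
  have hfinA : IsFiniteMeasure (volume.restrict A) := ⟨by simpa using h1.lt_top⟩
  have hi : IntegrableOn u A := h.memLp.restrict A |>.integrable (by norm_num)
  have hm : MemLp (fun x => u x - ⨍ y in A, u y) 2 (volume.restrict A') :=
    (h.memLp.restrict A').sub (memLp_const _)
  -- Jensen's inequality, applied for each `x` with the constant `u x` in place of the free
  -- constant.
  have key : ∫⁻ x in A', ‖u x - ⨍ y in A, u y‖ₑ ^ 2
      ≤ (volume A)⁻¹ * ∫⁻ x in A', ∫⁻ y in A, ‖u y - u x‖ₑ ^ 2 := by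
    rw [← lintegral_const_mul' _ _ (ENNReal.inv_ne_top.2 h0)]
    refine lintegral_mono fun x => ?_
    have := enorm_average_sub_sq_le h0 h1 hi (u x)
    rwa [enorm_sub_rev] at this
  have key2 := key.trans (mul_le_mul_right (h.lintegral_lintegral_sub_sq_le hK hconv hKΩ hW hD hKW
    hA hA' hAK hAK') _)
  rw [hm.lintegral_enorm_sq, h.lintegral_energy, ← ofReal_measureReal hWf] at key2
  have hA : (volume A)⁻¹ = ENNReal.ofReal ((volume.real A)⁻¹) := by
    rw [measureReal_def, ENNReal.ofReal_inv_of_pos (ENNReal.toReal_pos h0 h1), ENNReal.ofReal_toReal h1]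
  rw [hA, ← ENNReal.ofReal_mul (by positivity), ← ENNReal.ofReal_mul (by positivity),
    ← ENNReal.ofReal_mul (by positivity)] at key2
  have he := energy_nonneg u₁ u₂ K
  rw [mul_assoc]
  exact (ENNReal.ofReal_le_ofReal_iff (by positivity)).1 key2

/-- Difference of averages over two subsets of a convex set. -/
lemma HasGrad.norm_average_sub_average_sq_le {Ω K W A A' : Set (ℝ × ℝ)} {u u₁ u₂ : ℝ × ℝ → ℂ}
    (h : HasGrad Ω u u₁ u₂) (hK : IsOpen K) (hconv : Convex ℝ K) (hKΩ : K ⊆ Ω)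
    (hW : MeasurableSet W) (hWf : volume W ≠ ⊤) {D : ℝ} (hD : ∀ w ∈ W, w.1 ^ 2 + w.2 ^ 2 ≤ D)
    (hKW : ∀ x ∈ K, ∀ y ∈ K, y - x ∈ W) (hA : MeasurableSet A) (hA' : MeasurableSet A')
    (hAK : A ⊆ K) (hAK' : A' ⊆ K) (h0 : volume A ≠ 0) (h1 : volume A ≠ ⊤)
    (h0' : volume A' ≠ 0) (h1' : volume A' ≠ ⊤) (hD0 : 0 ≤ D) :
    ‖(⨍ x in A', u x) - ⨍ x in A, u x‖ ^ 2 ≤ (volume.real A')⁻¹ * ((volume.real A)⁻¹ *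
      (volume.real W * D) * ∫ x in K, (‖u₁ x‖ ^ 2 + ‖u₂ x‖ ^ 2)) := by
  refine (norm_average_sub_sq_le h0' h1' (h.memLp.restrict A') _).trans ?_
  gcongr
  exact h.integral_sub_average_sq_le hK hconv hKΩ hW hWf hD hKW hA hA' hAK hAK' h0 h1 h1' hD0

/-! ### The Poincaré inequality in a bounded Lipschitz domain -/

/-- `∫_G |u - ⨍_Q u|²` is controlled by the Dirichlet energy of `u` in `B`. -/
def PoincareOn (B Q G : Set (ℝ × ℝ)) : Prop :=
  ∃ C : ℝ≥0, ∀ u u₁ u₂ : ℝ × ℝ → ℂ, HasGrad B u u₁ u₂ →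
    ∫⁻ x in G, ‖u x - ⨍ y in Q, u y‖ₑ ^ 2 ≤ C * ∫⁻ x in B, (‖u₁ x‖ₑ ^ 2 + ‖u₂ x‖ₑ ^ 2)

/-- Together with `PoincareOn.union` and `PoincareOn.empty`, these are the closure properties needed
by the compactness induction in `exists_poincareOn`. -/
lemma PoincareOn.mono {B Q G G' : Set (ℝ × ℝ)} (h : PoincareOn B Q G') (hG : G ⊆ G') :
    PoincareOn B Q G := by
  obtain ⟨C, hC⟩ := h
  exact ⟨C, fun u u₁ u₂ hu => (lintegral_mono_set hG).trans (hC u u₁ u₂ hu)⟩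

lemma PoincareOn.union {B Q G G' : Set (ℝ × ℝ)} (h : PoincareOn B Q G) (h' : PoincareOn B Q G') :
    PoincareOn B Q (G ∪ G') := by
  obtain ⟨C, hC⟩ := h
  obtain ⟨C', hC'⟩ := h'
  refine ⟨C + C', fun u u₁ u₂ hu => (lintegral_union_le _ _ _).trans ?_⟩
  rw [ENNReal.coe_add, add_mul]
  exact add_le_add (hC u u₁ u₂ hu) (hC' u u₁ u₂ hu)

lemma PoincareOn.empty (B Q : Set (ℝ × ℝ)) : PoincareOn B Q ∅ :=
  ⟨0, fun u u₁ u₂ _ => by simp⟩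

/-- The Poincaré inequality spreads along translations inside of `B`. -/
lemma PoincareOn.translate {B Q G G' : Set (ℝ × ℝ)} (hB : IsOpen B) (hG : IsOpen G)
    (hG' : IsOpen G') (h : PoincareOn B Q G') {w : ℝ × ℝ}
    (hw : ∀ x ∈ G, x + w ∈ G') (hseg : ∀ x ∈ G, ∀ s ∈ Set.Icc (0 : ℝ) 1, x + s • w ∈ B) :
    PoincareOn B Q G := by
  obtain ⟨C, hC⟩ := h
  -- The constant comes from `|u x - c|² ≤ 2 (|u (x + w) - u x|² + |u (x + w) - c|²)`: the first
  -- term is the translation inequality, the second is the known estimate on `G'`.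
  refine ⟨2 * ((w.1 ^ 2 + w.2 ^ 2).toNNReal + C), fun u u₁ u₂ hu => ?_⟩
  set c := ⨍ y in Q, u y
  have h1 := hu.lintegral_sub_sq_le hG hB.measurableSet subset_rfl hseg le_rfl
  have h2 : ∫⁻ x in G, ‖u (x + w) - c‖ₑ ^ 2 ≤ ∫⁻ x in G', ‖u x - c‖ₑ ^ 2 := by
    rw [← lintegral_indicator hG.measurableSet, ← lintegral_indicator hG'.measurableSet,
      ← lintegral_add_right_eq_self (G'.indicator fun x => ‖u x - c‖ₑ ^ 2) w]
    refine lintegral_mono (Set.indicator_le fun x hx => ?_)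
    rw [Set.indicator_of_mem (hw x hx)]
  have hum : AEStronglyMeasurable (fun x => u (x + w)) volume :=
    hu.memLp.aestronglyMeasurable.comp_quasiMeasurePreserving
      (measurePreserving_add_right _ w).quasiMeasurePreserving
  have hm : AEMeasurable (fun x => ‖u (x + w) - u x‖ₑ ^ 2) (volume.restrict G) :=
    (hum.sub hu.memLp.aestronglyMeasurable).restrict.enorm.pow_const 2
  calc ∫⁻ x in G, ‖u x - c‖ₑ ^ 2
      ≤ ∫⁻ x in G, 2 * (‖u (x + w) - u x‖ₑ ^ 2 + ‖u (x + w) - c‖ₑ ^ 2) := by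
        refine lintegral_mono fun x => ?_
        simp only [enorm_sq_eq_ofReal]
        rw [← ENNReal.ofReal_add (by positivity) (by positivity),
          show (2 : ℝ≥0∞) = ENNReal.ofReal 2 by simp, ← ENNReal.ofReal_mul (by norm_num)]
        refine ENNReal.ofReal_le_ofReal ?_
        have h3 : ‖u x - c‖ ≤ ‖u (x + w) - u x‖ + ‖u (x + w) - c‖ := by
          have := norm_sub_le (u (x + w) - c) (u (x + w) - u x)
          rw [sub_sub_sub_cancel_left] at this
          linarith
        nlinarith [norm_nonneg (u x - c), sq_nonneg (‖u (x + w) - u x‖ - ‖u (x + w) - c‖)]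
    _ = 2 * ((∫⁻ x in G, ‖u (x + w) - u x‖ₑ ^ 2) + ∫⁻ x in G, ‖u (x + w) - c‖ₑ ^ 2) := by
        rw [lintegral_const_mul' _ _ (by simp), lintegral_add_left' hm]
    _ ≤ 2 * (ENNReal.ofReal (w.1 ^ 2 + w.2 ^ 2) * (∫⁻ x in B, (‖u₁ x‖ₑ ^ 2 + ‖u₂ x‖ₑ ^ 2))
          + C * ∫⁻ x in B, (‖u₁ x‖ₑ ^ 2 + ‖u₂ x‖ₑ ^ 2)) := by
        gcongr
        exact h2.trans (hC u u₁ u₂ hu)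
    _ = _ := by
        simp only [ENNReal.coe_mul, ENNReal.coe_add, ENNReal.ofReal]
        push_cast
        ring

lemma volume_ball_ne_zero (x : ℝ × ℝ) {r : ℝ} (hr : 0 < r) : volume (Metric.ball x r) ≠ 0 :=
  (Metric.measure_ball_pos _ _ hr).ne'

/-- The ball is convex, so the estimate holds with its own mean value. This is the seed of the chain
of balls. -/
lemma PoincareOn.ball_self {B : Set (ℝ × ℝ)} {x : ℝ × ℝ} {r : ℝ} (hr : 0 < r)
    (hb : Metric.ball x r ⊆ B) : PoincareOn B (Metric.ball x r) (Metric.ball x r) := by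
  have hfin : volume (Metric.ball x r) ≠ ⊤ := measure_ball_lt_top.ne
  set c : ℝ := (volume.real (Metric.ball x r))⁻¹ *
    (volume.real (Metric.ball (0 : ℝ × ℝ) (2 * r)) * (2 * (2 * r) ^ 2)) with hc
  have hc0 : 0 ≤ c := by positivity
  refine ⟨c.toNNReal, fun u u₁ u₂ hu => ?_⟩
  -- Balls are taken in the sup norm: a difference of two points has both coordinates below `2 r`,
  -- hence squared Euclidean length at most `2 (2 r)²`.
  have := hu.integral_sub_average_sq_le (W := Metric.ball 0 (2 * r)) (D := 2 * (2 * r) ^ 2)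
    Metric.isOpen_ball (convex_ball x r) hb Metric.isOpen_ball.measurableSet
    measure_ball_lt_top.ne ?_ ?_ Metric.isOpen_ball.measurableSet Metric.isOpen_ball.measurableSet
    subset_rfl subset_rfl (volume_ball_ne_zero x hr) hfin hfin (by positivity)
  · have hfin' : IsFiniteMeasure (volume.restrict (Metric.ball x r)) := ⟨by simpa using hfin.lt_top⟩
    have hm : MemLp (fun y => u y - ⨍ z in Metric.ball x r, u z) 2
        (volume.restrict (Metric.ball x r)) := (hu.memLp.restrict _).sub (memLp_const _)
    rw [hm.lintegral_enorm_sq, hu.lintegral_energy]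
    change _ ≤ ENNReal.ofReal c * _
    rw [← ENNReal.ofReal_mul hc0]
    refine ENNReal.ofReal_le_ofReal (this.trans ?_)
    exact mul_le_mul_of_nonneg_left (hu.energy_mono hb) hc0
  · intro w hw
    rw [mem_ball_zero_iff, Prod.norm_def, max_lt_iff, Real.norm_eq_abs, Real.norm_eq_abs] at hw
    have h1 := sq_lt_sq' (abs_lt.1 hw.1).1 (abs_lt.1 hw.1).2
    have h2 := sq_lt_sq' (abs_lt.1 hw.2).1 (abs_lt.1 hw.2).2
    linarith
  · intro y hy z hz
    rw [mem_ball_zero_iff]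
    rw [Metric.mem_ball, dist_eq_norm] at hy hz
    have := norm_sub_le (z - x) (y - x)
    rw [sub_sub_sub_cancel_right] at this
    linarith

/-- Every point of a connected open set has a ball where the Poincaré inequality holds. -/
lemma exists_ball_poincareOn {B : Set (ℝ × ℝ)} (hB : IsOpen B) (hc : IsConnected B) :
    ∃ (x₀ : ℝ × ℝ) (r₀ : ℝ), 0 < r₀ ∧ Metric.ball x₀ r₀ ⊆ B ∧
      ∀ x ∈ B, ∃ ρ > 0, Metric.ball x ρ ⊆ B ∧
        PoincareOn B (Metric.ball x₀ r₀) (Metric.ball x ρ) := by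
  obtain ⟨x₀, hx₀⟩ := hc.nonempty
  obtain ⟨r₀, hr₀, hb₀⟩ := Metric.isOpen_iff.1 hB x₀ hx₀
  refine ⟨x₀, r₀, hr₀, hb₀, ?_⟩
  set S : Set (ℝ × ℝ) := {x | ∃ ρ > 0, Metric.ball x ρ ⊆ B ∧
        PoincareOn B (Metric.ball x₀ r₀) (Metric.ball x ρ)} with hS
  -- The set of good points is open, contains `x₀` and is relatively closed in `B`, so it contains
  -- `B` by connectedness.
  refine hc.isPreconnected.subset_of_closure_inter_subset (u := S) ?_ ?_ ?_
  · rw [Metric.isOpen_iff]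
    rintro x ⟨ρ, hρ, hb, hP⟩
    refine ⟨ρ, hρ, fun y hy => ?_⟩
    have hsub : Metric.ball y (ρ - dist y x) ⊆ Metric.ball x ρ :=
      Metric.ball_subset_ball' (by linarith)
    exact ⟨ρ - dist y x, by rw [Metric.mem_ball] at hy; linarith, hsub.trans hb, hP.mono hsub⟩
  · exact ⟨x₀, hx₀, r₀, hr₀, hb₀, PoincareOn.ball_self hr₀ hb₀⟩
  · rintro x ⟨hxS, hxB⟩
    obtain ⟨r, hr, hb⟩ := Metric.isOpen_iff.1 hB x hxB
    obtain ⟨y, ⟨ρ', hρ', hb', hP⟩, hxy⟩ := Metric.mem_closure_iff.1 hxS (r / 2) (by positivity)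
    have hρ : 0 < min ρ' (r / 2) := by positivity
    refine ⟨min ρ' (r / 2), hρ, (Metric.ball_subset_ball ?_).trans hb, ?_⟩
    · exact (min_le_right _ _).trans (by linarith)
    -- A limit point `x` of good points is reached by shifting a small ball around `x` onto a ball
    -- around a good point `y`. As `|y - x| < r / 2` and the radius is at most `r / 2`, all segments
    -- stay in `ball x r ⊆ B`.
    · refine PoincareOn.translate hB Metric.isOpen_ball Metric.isOpen_ball hP (w := y - x) ?_ ?_
      · intro z hz
        rw [Metric.mem_ball, dist_eq_norm] at hz ⊢
        have : z + (y - x) - y = z - x := by abel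
        rw [this]
        exact hz.trans_le (min_le_left _ _)
      · intro z hz s hs
        apply hb
        rw [Metric.mem_ball, dist_eq_norm] at hz ⊢
        rw [dist_comm, dist_eq_norm] at hxy
        have e : z + s • (y - x) - x = (z - x) + s • (y - x) := by abel
        have h1 := norm_add_le (z - x) (s • (y - x))
        rw [norm_smul, Real.norm_eq_abs, abs_of_nonneg hs.1] at h1
        have h2 := min_le_right ρ' (r / 2)
        have h3 : s * ‖y - x‖ ≤ ‖y - x‖ := by nlinarith [hs.2, norm_nonneg (y - x)]
        rw [e]
        linarith

/-- The description of a set with Lipschitz boundary near a boundary point, in terms of the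
rotated coordinates of a point. -/
lemma HasLipschitzBoundary.chart {B : Set (ℝ × ℝ)} (h : HasLipschitzBoundary B) {p : ℝ × ℝ}
    (hp : p ∈ frontier B) : ∃ (θ r s : ℝ) (γ : ℝ → ℝ), 0 < r ∧ 0 < s ∧ Continuous γ ∧
      ∀ x : ℝ × ℝ, |(x.1 - p.1) * Real.cos θ + (x.2 - p.2) * Real.sin θ| < r →
        |-((x.1 - p.1) * Real.sin θ) + (x.2 - p.2) * Real.cos θ| < s →
        (x ∈ B ↔ γ ((x.1 - p.1) * Real.cos θ + (x.2 - p.2) * Real.sin θ)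
          < -((x.1 - p.1) * Real.sin θ) + (x.2 - p.2) * Real.cos θ) := by
  obtain ⟨θ, r, s, L, γ, hr, hs, hγ, hB⟩ := h p hp
  refine ⟨θ, r, s, γ, hr, hs, hγ.continuous, fun x h1 h2 => ?_⟩
  rw [← hB _ _ h1 h2]
  have hsc := Real.sin_sq_add_cos_sq θ
  have : x = (p.1 + ((x.1 - p.1) * Real.cos θ + (x.2 - p.2) * Real.sin θ) * Real.cos θ
      - (-((x.1 - p.1) * Real.sin θ) + (x.2 - p.2) * Real.cos θ) * Real.sin θ,
      p.2 + ((x.1 - p.1) * Real.cos θ + (x.2 - p.2) * Real.sin θ) * Real.sin θ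
      + (-((x.1 - p.1) * Real.sin θ) + (x.2 - p.2) * Real.cos θ) * Real.cos θ) := by
    ext
    · simp only; linear_combination (-(x.1 - p.1)) * hsc
    · simp only; linear_combination (-(x.2 - p.2)) * hsc
  rw [← this]

/-- Sines and cosines are at most one in modulus. The factor `2` explains the halved radii chosen
wherever a chart is used. -/
lemma abs_rotate_lt {a b θ ρ : ℝ} (ha : |a| < ρ) (hb : |b| < ρ) :
    |a * Real.cos θ + b * Real.sin θ| < 2 * ρ ∧ |-(a * Real.sin θ) + b * Real.cos θ| < 2 * ρ := by
  have hc := Real.abs_cos_le_one θ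
  have hs := Real.abs_sin_le_one θ
  have h1 : |a * Real.cos θ| ≤ |a| := by
    rw [abs_mul]; nlinarith [abs_nonneg a]
  have h2 : |b * Real.sin θ| ≤ |b| := by
    rw [abs_mul]; nlinarith [abs_nonneg b]
  have h3 : |a * Real.sin θ| ≤ |a| := by
    rw [abs_mul]; nlinarith [abs_nonneg a]
  have h4 : |b * Real.cos θ| ≤ |b| := by
    rw [abs_mul]; nlinarith [abs_nonneg b]
  constructor
  · linarith [abs_add_le (a * Real.cos θ) (b * Real.sin θ)]
  · have := abs_add_le (-(a * Real.sin θ)) (b * Real.cos θ)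
    rw [abs_neg] at this
    linarith

/-- A point strictly below the graph has, by continuity of `γ`, a neighbourhood below the graph, and
this neighbourhood does not meet `B`. -/
lemma chart_le_of_mem_closure {B : Set (ℝ × ℝ)} {p : ℝ × ℝ} {θ r s : ℝ}
    {γ : ℝ → ℝ} (hγ : Continuous γ)
    (hchart : ∀ x : ℝ × ℝ, |(x.1 - p.1) * Real.cos θ + (x.2 - p.2) * Real.sin θ| < r →
        |-((x.1 - p.1) * Real.sin θ) + (x.2 - p.2) * Real.cos θ| < s →
        (x ∈ B ↔ γ ((x.1 - p.1) * Real.cos θ + (x.2 - p.2) * Real.sin θ)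
          < -((x.1 - p.1) * Real.sin θ) + (x.2 - p.2) * Real.cos θ))
    {y : ℝ × ℝ} (hy : y ∈ closure B)
    (hr : |(y.1 - p.1) * Real.cos θ + (y.2 - p.2) * Real.sin θ| < r)
    (hs : |-((y.1 - p.1) * Real.sin θ) + (y.2 - p.2) * Real.cos θ| < s) :
    γ ((y.1 - p.1) * Real.cos θ + (y.2 - p.2) * Real.sin θ)
      ≤ -((y.1 - p.1) * Real.sin θ) + (y.2 - p.2) * Real.cos θ := by
  by_contra! hpos
  set ξ : ℝ × ℝ → ℝ := fun x => (x.1 - p.1) * Real.cos θ + (x.2 - p.2) * Real.sin θ with hξ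
  set η : ℝ × ℝ → ℝ := fun x => -((x.1 - p.1) * Real.sin θ) + (x.2 - p.2) * Real.cos θ with hη
  have hξc : Continuous ξ := by fun_prop
  have hηc : Continuous η := by fun_prop
  have h1 : ∀ᶠ x in 𝓝 y, |ξ x| < r := (hξc.abs.tendsto y).eventually (gt_mem_nhds hr)
  have h2 : ∀ᶠ x in 𝓝 y, |η x| < s := (hηc.abs.tendsto y).eventually (gt_mem_nhds hs)
  have h3 : ∀ᶠ x in 𝓝 y, η x < γ (ξ x) :=
    (hηc.tendsto y).eventually_lt ((hγ.comp hξc).tendsto y) hpos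
  obtain ⟨x, hx, ⟨hx1, hx2⟩, hx3⟩ :=
    ((mem_closure_iff_frequently.1 hy).and_eventually ((h1.and h2).and h3)).exists
  exact absurd ((hchart x hx1 hx2).1 hx) (not_lt.2 hx3.le)

/-- The Poincaré inequality in a bounded Lipschitz domain. -/
theorem exists_poincareOn {B : Set (ℝ × ℝ)} (hB : IsOpen B) (hc : IsConnected B)
    (hb : Bornology.IsBounded B) (hL : HasLipschitzBoundary B) :
    ∃ (x₀ : ℝ × ℝ) (r₀ : ℝ), PoincareOn B (Metric.ball x₀ r₀) B := by
  obtain ⟨x₀, r₀, hr₀, hb₀, hP⟩ := exists_ball_poincareOn hB hc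
  refine ⟨x₀, r₀, ?_⟩
  have key : PoincareOn B (Metric.ball x₀ r₀) (closure B ∩ B) := by
    -- Compactness of the closure reduces the claim to a neighbourhood of each of its points.
    -- Interior points have been treated; near a boundary point, the set is pushed inside along the
    -- graph direction.
    refine hb.isCompact_closure.induction_on
      (p := fun N => PoincareOn B (Metric.ball x₀ r₀) (N ∩ B)) ?_ ?_ ?_ ?_
    · simpa using PoincareOn.empty _ _
    · exact fun s t hst ht => ht.mono (Set.inter_subset_inter_left _ hst)
    · intro s t hs ht
      rw [Set.union_inter_distrib_right]
      exact hs.union ht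
    · intro p hp
      by_cases hpB : p ∈ B
      · obtain ⟨ρ, hρ, -, h⟩ := hP p hpB
        exact ⟨Metric.ball p ρ, mem_nhdsWithin_of_mem_nhds (Metric.ball_mem_nhds p hρ),
          h.mono Set.inter_subset_left⟩
      · have hpf : p ∈ frontier B := ⟨hp, by rwa [hB.interior_eq]⟩
        obtain ⟨θ, r, s, γ, hr, hs, hγ, hchart⟩ := hL.chart hpf
        have hγ0 : γ 0 ≤ 0 := by
          simpa using chart_le_of_mem_closure hγ hchart hp (by simpa using hr) (by simpa using hs)
        have hsc := Real.sin_sq_add_cos_sq θ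
        -- The shift by `s / 2` in the direction of the `η` axis of the chart; it sends `p` to an
        -- interior point since `γ 0 ≤ 0`.
        set w : ℝ × ℝ := (-(s / 2 * Real.sin θ), s / 2 * Real.cos θ) with hw
        have hz : p + w ∈ B := by
          have e1 : ((p + w).1 - p.1) * Real.cos θ + ((p + w).2 - p.2) * Real.sin θ = 0 := by
            simp [hw]; ring
          have e2 : -(((p + w).1 - p.1) * Real.sin θ) + ((p + w).2 - p.2) * Real.cos θ = s / 2 := by
            simp [hw]; linear_combination (s / 2) * hsc
          rw [hchart, e1, e2]
          · linarith
          · rw [e1]; simpa using hr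
          · rw [e2, abs_of_pos (by positivity)]; linarith
        obtain ⟨ρ, hρ, -, h⟩ := hP _ hz
        -- In the ball of radius `ρ'` the chart coordinates satisfy `|ξ| < r` and `|η| < s / 2`, so
        -- a further upward shift by at most `s / 2` stays in the range of the chart.
        set ρ' := min ρ (min (r / 2) (s / 4)) with hρ'
        have hρ'0 : 0 < ρ' := by positivity
        have a1 : ρ' ≤ ρ := min_le_left _ _
        have a2 : ρ' ≤ r / 2 := (min_le_right _ _).trans (min_le_left _ _)
        have a3 : ρ' ≤ s / 4 := (min_le_right _ _).trans (min_le_right _ _)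
        refine ⟨Metric.ball p ρ', mem_nhdsWithin_of_mem_nhds (Metric.ball_mem_nhds p hρ'0), ?_⟩
        refine PoincareOn.translate hB (Metric.isOpen_ball.inter hB) Metric.isOpen_ball h
          (w := w) ?_ ?_
        · rintro x ⟨hx, -⟩
          rw [Metric.mem_ball, dist_eq_norm] at hx ⊢
          rw [add_sub_add_right_eq_sub]
          exact hx.trans_le a1
        · rintro x ⟨hx, hxB⟩ t ht
          rw [Metric.mem_ball, dist_eq_norm, Prod.norm_def, max_lt_iff, Real.norm_eq_abs,
            Real.norm_eq_abs, Prod.fst_sub, Prod.snd_sub] at hx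
          obtain ⟨b1, b2⟩ := abs_rotate_lt (θ := θ) hx.1 hx.2
          have b3 := (hchart x (by linarith) (by linarith)).1 hxB
          have e1 : ((x + t • w).1 - p.1) * Real.cos θ + ((x + t • w).2 - p.2) * Real.sin θ
              = (x.1 - p.1) * Real.cos θ + (x.2 - p.2) * Real.sin θ := by
            simp [hw]; ring
          have e2 : -(((x + t • w).1 - p.1) * Real.sin θ) + ((x + t • w).2 - p.2) * Real.cos θ
              = -((x.1 - p.1) * Real.sin θ) + (x.2 - p.2) * Real.cos θ + t * (s / 2) := by
            simp [hw]; linear_combination (t * (s / 2)) * hsc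
          have b4 : 0 ≤ t * (s / 2) := mul_nonneg ht.1 (by positivity)
          have b5 : t * (s / 2) ≤ s / 2 := by nlinarith [ht.2]
          rw [hchart, e1, e2]
          · linarith
          · rw [e1]; linarith
          · rw [e2]
            rw [abs_lt] at b2 ⊢
            constructor <;> linarith
  rwa [Set.inter_eq_self_of_subset_right subset_closure] at key

/-- Averages over subsets of a bounded Lipschitz domain are controlled by the energy. -/
lemma exists_average_sub_average_le {B : Set (ℝ × ℝ)} (hB : IsOpen B) (hc : IsConnected B)
    (hb : Bornology.IsBounded B) (hL : HasLipschitzBoundary B) :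
    ∃ C : ℝ, 0 ≤ C ∧ ∀ (u u₁ u₂ : ℝ × ℝ → ℂ) (A : Set (ℝ × ℝ)), HasGrad B u u₁ u₂ →
      A ⊆ B → volume A ≠ 0 →
      ‖(⨍ x in A, u x) - ⨍ x in B, u x‖ ^ 2
        ≤ C * (volume.real A)⁻¹ * ∫ x in B, (‖u₁ x‖ ^ 2 + ‖u₂ x‖ ^ 2) := by
  obtain ⟨x₀, r₀, C, hC⟩ := exists_poincareOn hB hc hb hL
  refine ⟨4 * C, by positivity, fun u u₁ u₂ A hu hA hA0 => ?_⟩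
  set c := ⨍ y in Metric.ball x₀ r₀, u y with hcdef
  have hBf : volume B ≠ ⊤ := hb.measure_lt_top.ne
  have hBfin : IsFiniteMeasure (volume.restrict B) := ⟨by simpa using hBf.lt_top⟩
  have hm : MemLp (fun x => u x - c) 2 (volume.restrict B) :=
    (hu.memLp.restrict B).sub (memLp_const c)
  have h1 : ∫ x in B, ‖u x - c‖ ^ 2 ≤ C * ∫ x in B, (‖u₁ x‖ ^ 2 + ‖u₂ x‖ ^ 2) := by
    have := hC u u₁ u₂ hu
    rw [hm.lintegral_enorm_sq, hu.lintegral_energy, ← ENNReal.ofReal_coe_nnreal,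
      ← ENNReal.ofReal_mul C.coe_nonneg] at this
    exact (ENNReal.ofReal_le_ofReal_iff (mul_nonneg C.2 (energy_nonneg _ _ _))).1 this
  -- Used with `S = A` and `S = B`. Since `A ⊆ S`, the factor `|S|⁻¹` is at most `|A|⁻¹`, so both
  -- means are compared with the reference mean `c` at the same price.
  have key (S : Set (ℝ × ℝ)) (hS : S ⊆ B) (hAS : A ⊆ S) : ‖(⨍ x in S, u x) - c‖ ^ 2
      ≤ (volume.real A)⁻¹ * (C * ∫ x in B, (‖u₁ x‖ ^ 2 + ‖u₂ x‖ ^ 2)) := by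
    have hSf : volume S ≠ ⊤ := ((measure_mono hS).trans_lt hBf.lt_top).ne
    have hS0 : volume S ≠ 0 := fun h => hA0 (measure_mono_null hAS h)
    refine (norm_average_sub_sq_le hS0 hSf (hu.memLp.restrict S) c).trans ?_
    have hAp : 0 < volume.real A :=
      ENNReal.toReal_pos hA0 ((measure_mono hA).trans_lt hBf.lt_top).ne
    have h2 : (volume.real S)⁻¹ ≤ (volume.real A)⁻¹ :=
      inv_anti₀ hAp (measureReal_mono hAS hSf)
    refine mul_le_mul h2 (le_trans ?_ h1) (integral_nonneg fun x => by positivity) (by positivity)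
    exact setIntegral_mono_set hm.integrable_norm_sq
      (Eventually.of_forall fun x => by positivity) (Eventually.of_forall hS)
  have k1 := key A hA subset_rfl
  have k2 := key B subset_rfl hA
  have h3 := norm_sub_le ((⨍ x in A, u x) - c) ((⨍ x in B, u x) - c)
  rw [sub_sub_sub_cancel_right] at h3
  have h4 : ‖(⨍ x in A, u x) - ⨍ x in B, u x‖ ^ 2
      ≤ 2 * (‖(⨍ x in A, u x) - c‖ ^ 2 + ‖(⨍ x in B, u x) - c‖ ^ 2) := by
    nlinarith [norm_nonneg ((⨍ x in A, u x) - ⨍ x in B, u x),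
      sq_nonneg (‖(⨍ x in A, u x) - c‖ - ‖(⨍ x in B, u x) - c‖)]
  calc _ ≤ _ := h4
    _ ≤ 2 * ((volume.real A)⁻¹ * (C * ∫ x in B, (‖u₁ x‖ ^ 2 + ‖u₂ x‖ ^ 2))
        + (volume.real A)⁻¹ * (C * ∫ x in B, (‖u₁ x‖ ^ 2 + ‖u₂ x‖ ^ 2))) := by gcongr
    _ = _ := by ring

/-! ### Scaling from the reference domain to the rooms -/

section Scaling

/-- The homothety `y ↦ z + ε y`. -/
def homothety (z : ℝ × ℝ) (ε : ℝ) (y : ℝ × ℝ) : ℝ × ℝ := z + ε • y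

lemma measurableEmbedding_homothety (z : ℝ × ℝ) {ε : ℝ} (hε : 0 < ε) :
    MeasurableEmbedding (homothety z ε) :=
  ((Homeomorph.smulOfNeZero ε hε.ne').trans (Homeomorph.addLeft z)).measurableEmbedding

lemma map_homothety (z : ℝ × ℝ) {ε : ℝ} (hε : 0 < ε) :
    Measure.map (homothety z ε) volume = ENNReal.ofReal ((ε ^ 2)⁻¹) • volume := by
  have h1 : Measure.map (fun y : ℝ × ℝ => ε • y) volume = ENNReal.ofReal ((ε ^ 2)⁻¹) • volume := by
    rw [Measure.map_addHaar_smul _ hε.ne', Module.finrank_prod, Module.finrank_self,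
      abs_of_pos (by positivity)]
  have h2 : homothety z ε = (fun y => z + y) ∘ fun y => ε • y := rfl
  rw [h2, ← Measure.map_map (by fun_prop) (by fun_prop), h1, Measure.map_smul,
    map_add_left_eq_self]

lemma setIntegral_homothety {F : Type*} [NormedAddCommGroup F] [NormedSpace ℝ F]
    (z : ℝ × ℝ) {ε : ℝ} (hε : 0 < ε) (f : ℝ × ℝ → F) (S : Set (ℝ × ℝ)) :
    ∫ y in homothety z ε ⁻¹' S, f (homothety z ε y) = (ε ^ 2)⁻¹ • ∫ x in S, f x := by
  rw [← (measurableEmbedding_homothety z hε).setIntegral_map, map_homothety z hε,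
    Measure.restrict_smul, integral_smul_measure, ENNReal.toReal_ofReal (by positivity)]

lemma volume_homothety_preimage (z : ℝ × ℝ) {ε : ℝ} (hε : 0 < ε) (S : Set (ℝ × ℝ)) :
    volume (homothety z ε ⁻¹' S) = ENNReal.ofReal ((ε ^ 2)⁻¹) * volume S := by
  rw [← (measurableEmbedding_homothety z hε).map_apply, map_homothety z hε]
  simp

lemma setAverage_homothety (z : ℝ × ℝ) {ε : ℝ} (hε : 0 < ε) (f : ℝ × ℝ → ℂ) (S : Set (ℝ × ℝ)) :
    ⨍ y in homothety z ε ⁻¹' S, f (homothety z ε y) = ⨍ x in S, f x := by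
  rw [setAverage_eq, setAverage_eq, setIntegral_homothety z hε, measureReal_def,
    volume_homothety_preimage z hε, ENNReal.toReal_mul, ENNReal.toReal_ofReal (by positivity),
    smul_smul, measureReal_def]
  congr 1
  field_simp

lemma memLp_homothety {f : ℝ × ℝ → ℂ} (hf : MemLp f 2) (z : ℝ × ℝ) {ε : ℝ} (hε : 0 < ε) :
    MemLp (fun y => f (homothety z ε y)) 2 := by
  have : MemLp f 2 (Measure.map (homothety z ε) volume) := by
    rw [map_homothety z hε]
    exact hf.smul_measure ENNReal.ofReal_ne_top
  exact (measurableEmbedding_homothety z hε).memLp_map_measure_iff.1 this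

/-- Test functions correspond to each other by the inverse homothety, and the chain rule gives the
factor `ε`. -/
lemma HasWeakDeriv.homothety {Ω B : Set (ℝ × ℝ)} {e : ℝ × ℝ} {u g : ℝ × ℝ → ℂ}
    (h : HasWeakDeriv Ω e u g) (z : ℝ × ℝ) {ε : ℝ} (hε : 0 < ε)
    (hB : ∀ y ∈ B, homothety z ε y ∈ Ω) :
    HasWeakDeriv B e (fun y => u (homothety z ε y)) (fun y => ε * g (homothety z ε y)) := by
  rw [hasWeakDeriv_iff]
  intro φ h1 h2 h3
  set T : (ℝ × ℝ) ≃ₜ (ℝ × ℝ) := (Homeomorph.smulOfNeZero ε hε.ne').trans (Homeomorph.addLeft z)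
    with hT
  have hTz (y : ℝ × ℝ) : T y = ThinWaveguide.homothety z ε y := rfl
  have hTs (x : ℝ × ℝ) : T.symm x = ε⁻¹ • (-z + x) := rfl
  set ψ : ℝ × ℝ → ℝ := φ ∘ T.symm with hψ
  have hφ (y : ℝ × ℝ) : φ y = ψ (ThinWaveguide.homothety z ε y) := by
    simp [hψ, ← hTz]
  have hsm : ContDiff ℝ ∞ (fun x => T.symm x) := by
    simp only [hTs]
    fun_prop
  have hψ1 : ContDiff ℝ ∞ ψ := h1.comp hsm
  have hψ2 : HasCompactSupport ψ := h2.comp_homeomorph T.symm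
  have hψ3 : tsupport ψ ⊆ Ω := by
    rw [hψ, tsupport_comp_eq_preimage]
    intro x hx
    have := hB _ (h3 hx)
    rwa [← hTz, T.apply_symm_apply] at this
  have hφ' (y : ℝ × ℝ) : fderiv ℝ φ y e = ε * fderiv ℝ ψ (ThinWaveguide.homothety z ε y) e := by
    have e1 : φ = ψ ∘ (ThinWaveguide.homothety z ε) := funext hφ
    have hd : HasFDerivAt (ThinWaveguide.homothety z ε)
        (ε • ContinuousLinearMap.id ℝ (ℝ × ℝ)) y :=
      ((hasFDerivAt_id y).const_smul ε).const_add z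
    have := ((hψ1.differentiable (by simp)) (ThinWaveguide.homothety z ε y)).hasFDerivAt.comp y hd
    conv_lhs => rw [e1, this.fderiv]
    simp
  have key := hasWeakDeriv_iff.1 h ψ hψ1 hψ2 hψ3
  have i1 := setIntegral_homothety z hε (fun x => u x * ((fderiv ℝ ψ x e : ℝ) : ℂ)) Set.univ
  have i2 := setIntegral_homothety z hε (fun x => g x * ((ψ x : ℝ) : ℂ)) Set.univ
  simp only [Set.preimage_univ, setIntegral_univ] at i1 i2
  simp only [hφ', Complex.ofReal_mul, mul_left_comm (_ : ℂ) (ε : ℂ), mul_assoc (ε : ℂ)]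
  rw [integral_const_mul, integral_const_mul, i1, key]
  simp only [hφ]
  rw [i2]
  simp

lemma HasGrad.homothety {Ω B : Set (ℝ × ℝ)} {u u₁ u₂ : ℝ × ℝ → ℂ} (h : HasGrad Ω u u₁ u₂)
    (z : ℝ × ℝ) {ε : ℝ} (hε : 0 < ε) (hB : ∀ y ∈ B, homothety z ε y ∈ Ω) :
    HasGrad B (fun y => u (ThinWaveguide.homothety z ε y))
      (fun y => ε * u₁ (ThinWaveguide.homothety z ε y))
      (fun y => ε * u₂ (ThinWaveguide.homothety z ε y)) where
  memLp := memLp_homothety h.memLp z hε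
  memLp_fst := (memLp_homothety h.memLp_fst z hε).const_mul _
  memLp_snd := (memLp_homothety h.memLp_snd z hε).const_mul _
  deriv_fst := h.deriv_fst.homothety z hε hB
  deriv_snd := h.deriv_snd.homothety z hε hB

end Scaling

lemma mem_room_iff {B : Set (ℝ × ℝ)} {ε h : ℝ} (hε : 0 < ε) {j : ℤ} {x : ℝ × ℝ} :
    x ∈ room B ε h j ↔ ε⁻¹ • (x - (cellCenter ε j, h)) ∈ B := by
  rw [room, Set.mem_ofPred_eq, Set.mem_smul_set_iff_inv_smul_mem₀ hε.ne']

lemma homothety_preimage_room {B : Set (ℝ × ℝ)} {ε h : ℝ} (hε : 0 < ε) {j : ℤ} :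
    homothety (cellCenter ε j, h) ε ⁻¹' room B ε h j = B := by
  ext y
  rw [Set.mem_preimage, mem_room_iff hε, homothety, add_sub_cancel_left, smul_smul,
    inv_mul_cancel₀ hε.ne', one_smul]

/-- Averages over subsets of a room, with the scaling of the constant. -/
lemma IsRoom.exists_average_sub_average_room_le {B : Set (ℝ × ℝ)} (hB : IsRoom B) :
    ∃ C : ℝ, 0 ≤ C ∧ ∀ (ε h : ℝ) (j : ℤ) (Ω : Set (ℝ × ℝ)) (u u₁ u₂ : ℝ × ℝ → ℂ)
      (A : Set (ℝ × ℝ)), 0 < ε → HasGrad Ω u u₁ u₂ → room B ε h j ⊆ Ω → A ⊆ room B ε h j →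
      volume A ≠ 0 →
      ‖(⨍ x in A, u x) - ⨍ x in room B ε h j, u x‖ ^ 2
        ≤ C * ε ^ 2 * (volume.real A)⁻¹ * ∫ x in room B ε h j, (‖u₁ x‖ ^ 2 + ‖u₂ x‖ ^ 2) := by
  obtain ⟨C, hC0, hC⟩ :=
    exists_average_sub_average_le hB.isOpen hB.isConnected hB.isBounded hB.lipschitz
  refine ⟨C, hC0, fun ε h j Ω u u₁ u₂ A hε hu hΩ hA hA0 => ?_⟩
  set z : ℝ × ℝ := (cellCenter ε j, h) with hz
  have hpre : homothety z ε ⁻¹' room B ε h j = B := homothety_preimage_room hε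
  have hg := hu.homothety z hε (B := B) fun y hy => by
    rw [← hpre] at hy
    exact hΩ hy
  have hv := volume_homothety_preimage z hε A
  have key := hC _ _ _ (homothety z ε ⁻¹' A) hg (by rw [← hpre]; exact Set.preimage_mono hA) (by
    rw [hv]
    refine mul_ne_zero ?_ hA0
    rw [Ne, ENNReal.ofReal_eq_zero, not_le]
    positivity)
  -- In dimension two the Dirichlet integral is scale invariant: `ε²` from the gradient cancels the
  -- Jacobian. The remaining `ε²` comes from the area of `A` alone.
  have hE := setIntegral_homothety z hε (fun x => ‖u₁ x‖ ^ 2 + ‖u₂ x‖ ^ 2) (room B ε h j)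
  have hav := setAverage_homothety z hε u (room B ε h j)
  rw [hpre] at hE hav
  have hvr : volume.real (homothety z ε ⁻¹' A) = (ε ^ 2)⁻¹ * volume.real A := by
    rw [measureReal_def, hv, ENNReal.toReal_mul, ENNReal.toReal_ofReal (by positivity),
      measureReal_def]
  have hG (y : ℝ × ℝ) : ‖(ε : ℂ) * u₁ (homothety z ε y)‖ ^ 2 + ‖(ε : ℂ) * u₂ (homothety z ε y)‖ ^ 2
      = ε ^ 2 * (‖u₁ (homothety z ε y)‖ ^ 2 + ‖u₂ (homothety z ε y)‖ ^ 2) := by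
    simp only [norm_mul, Complex.norm_real, mul_pow, Real.norm_eq_abs, sq_abs]
    ring
  rw [setAverage_homothety z hε, hav, hvr] at key
  simp only [hG] at key
  rw [integral_const_mul, hE] at key
  refine key.trans (le_of_eq ?_)
  rw [smul_eq_mul, mul_inv, inv_inv]
  field_simp

/-- Near the origin, a room fills a half-neighbourhood. -/
lemma IsRoom.exists_rectangle {B : Set (ℝ × ℝ)} (hB : IsRoom B) :
    ∃ δ : ℝ, 0 < δ ∧ δ ≤ 1 / 2 ∧ ∀ x : ℝ × ℝ, |x.1| < δ → 0 < x.2 → x.2 < δ → x ∈ B := by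
  obtain ⟨R, hR, hR2, hflat⟩ := hB.flat
  have h0 : ((0, 0) : ℝ × ℝ) ∈ frontier B := hflat ⟨by simpa using hR, rfl⟩
  obtain ⟨θ, r, s, γ, hr, hs, hγ, hchart⟩ := hB.lipschitz.chart h0
  simp only [sub_zero] at hchart
  set ρ := min (1 / 2) (min R (min (r / 2) (s / 2))) with hρ
  have hρ0 : 0 < ρ := by positivity
  have a0 : ρ ≤ 1 / 2 := min_le_left _ _
  have a1 : ρ ≤ R := (min_le_right _ _).trans (min_le_left _ _)
  have a2 : ρ ≤ r / 2 := (min_le_right _ _).trans ((min_le_right _ _).trans (min_le_left _ _))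
  have a3 : ρ ≤ s / 2 := (min_le_right _ _).trans ((min_le_right _ _).trans (min_le_right _ _))
  have hsc := Real.sin_sq_add_cos_sq θ
  -- The points of the flat bottom are in the closure of `B` but not in `B`, so in the chart they
  -- lie exactly on the graph of `γ`.
  have hseg (τ : ℝ) (hτ : |τ| < ρ) : γ (τ * Real.cos θ) = -(τ * Real.sin θ) := by
    have hx : ((τ, 0) : ℝ × ℝ) ∈ frontier B := hflat ⟨hτ.trans_le a1, rfl⟩
    obtain ⟨b1, b2⟩ := abs_rotate_lt (θ := θ) hτ (show |(0 : ℝ)| < ρ by simpa using hρ0)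
    have c1 := chart_le_of_mem_closure (p := (0, 0)) hγ (by simpa using hchart) hx.1
      (by simp only [sub_zero]; linarith) (by simp only [sub_zero]; linarith)
    have c2 := (hchart (τ, 0) (by simp only; linarith) (by simp only; linarith)).not.1
      fun h => hx.2 (by rwa [hB.isOpen.interior_eq])
    simp only [sub_zero, zero_mul, add_zero, not_lt] at c1 c2
    exact le_antisymm c1 c2
  -- If the cosine vanished, all points of the flat segment would have `ξ = 0` but different `η`,
  -- which is impossible on a graph.
  have hcos : Real.cos θ ≠ 0 := by
    intro hc
    have e1 := hseg 0 (by simpa using hρ0)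
    have e2 := hseg (ρ / 2) (by rw [abs_of_pos (by positivity)]; linarith)
    simp only [hc, mul_zero, zero_mul, neg_zero] at e1 e2
    rw [e1, eq_comm, neg_eq_zero, mul_eq_zero] at e2
    rcases e2 with e2 | e2
    · linarith
    · rw [hc, e2] at hsc; norm_num at hsc
  have hcpos : 0 < |Real.cos θ| := abs_pos.2 hcos
  have hcle := Real.abs_cos_le_one θ
  -- The point with `|x₁|, |x₂| < δ` has `|ξ| < 2 δ`, so `ξ / cos θ` is still a parameter of the
  -- flat segment.
  set δ := ρ * |Real.cos θ| / 2 with hδ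
  have hδ0 : 0 < δ := by positivity
  have hδρ : 2 * δ ≤ ρ := by rw [hδ]; nlinarith
  have hmem (x : ℝ × ℝ) (h1 : |x.1| < δ) (h2 : |x.2| < δ) :
      x ∈ B ↔ 0 < x.2 / Real.cos θ := by
    obtain ⟨b1, b2⟩ := abs_rotate_lt (θ := θ) h1 h2
    rw [hchart x (by linarith) (by linarith)]
    set ξ := x.1 * Real.cos θ + x.2 * Real.sin θ with hξ
    have hτ : |ξ / Real.cos θ| < ρ := by
      rw [abs_div, div_lt_iff₀ hcpos]
      linarith
    have e := hseg _ hτ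
    rw [div_mul_cancel₀ _ hcos] at e
    rw [e, ← sub_pos]
    have : -(x.1 * Real.sin θ) + x.2 * Real.cos θ - -(ξ / Real.cos θ * Real.sin θ)
        = x.2 / Real.cos θ := by
      rw [hξ]; field_simp; linear_combination x.2 * hsc
    rw [this]
  -- A negative cosine would put `B` below the axis near the origin, against `B ⊆ {x₂ > 0}`.
  have hpos : 0 < Real.cos θ := by
    by_contra! hneg
    have hlt : Real.cos θ < 0 := lt_of_le_of_ne hneg hcos
    have : ((0, -(δ / 2)) : ℝ × ℝ) ∈ B := by
      rw [hmem _ (by simpa using hδ0) (by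
        rw [abs_neg, abs_of_pos (by positivity)]; linarith)]
      exact div_pos_of_neg_of_neg (by simpa using hδ0) hlt
    have := (hB.subset this).2
    simp only at this
    linarith
  refine ⟨δ, hδ0, by linarith, fun x h1 h2 h3 => ?_⟩
  rw [hmem x h1 (by rwa [abs_of_pos h2])]
  positivity

/-! ### Averages over rectangles and their logarithmic comparison -/

/-- The open rectangle with centre `(a, b)` and half-widths `ℓ`, `m`. -/
def rect (a b ℓ m : ℝ) : Set (ℝ × ℝ) := Set.Ioo (a - ℓ) (a + ℓ) ×ˢ Set.Ioo (b - m) (b + m)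

lemma mem_rect {a b ℓ m : ℝ} {x : ℝ × ℝ} :
    x ∈ rect a b ℓ m ↔ |x.1 - a| < ℓ ∧ |x.2 - b| < m := by
  simp only [rect, Set.mem_prod, Set.mem_Ioo, abs_lt]
  constructor <;> rintro ⟨⟨h1, h2⟩, h3, h4⟩ <;> refine ⟨⟨?_, ?_⟩, ?_, ?_⟩ <;> linarith

lemma isOpen_rect (a b ℓ m : ℝ) : IsOpen (rect a b ℓ m) := isOpen_Ioo.prod isOpen_Ioo

lemma measurableSet_rect (a b ℓ m : ℝ) : MeasurableSet (rect a b ℓ m) :=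
  (isOpen_rect a b ℓ m).measurableSet

lemma convex_rect (a b ℓ m : ℝ) : Convex ℝ (rect a b ℓ m) :=
  (convex_Ioo _ _).prod (convex_Ioo _ _)

lemma volume_rect (a b ℓ m : ℝ) :
    volume (rect a b ℓ m) = ENNReal.ofReal (2 * ℓ) * ENNReal.ofReal (2 * m) := by
  rw [rect, Measure.volume_eq_prod, Measure.prod_prod, Real.volume_Ioo, Real.volume_Ioo]
  ring_nf

lemma volume_rect_ne_top (a b ℓ m : ℝ) : volume (rect a b ℓ m) ≠ ⊤ := by
  rw [volume_rect]; exact ENNReal.mul_ne_top ENNReal.ofReal_ne_top ENNReal.ofReal_ne_top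

lemma volume_rect_ne_zero (a b : ℝ) {ℓ m : ℝ} (hℓ : 0 < ℓ) (hm : 0 < m) :
    volume (rect a b ℓ m) ≠ 0 := by
  rw [volume_rect]
  simp [hℓ, hm]

lemma volume_real_rect (a b : ℝ) {ℓ m : ℝ} (hℓ : 0 ≤ ℓ) (hm : 0 ≤ m) :
    volume.real (rect a b ℓ m) = 4 * ℓ * m := by
  rw [measureReal_def, volume_rect, ENNReal.toReal_mul, ENNReal.toReal_ofReal (by positivity),
    ENNReal.toReal_ofReal (by positivity)]
  ring

/-- Difference of averages over two subsets of a rectangle. -/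
lemma HasGrad.average_sub_average_rect {Ω A A' : Set (ℝ × ℝ)} {u u₁ u₂ : ℝ × ℝ → ℂ}
    (h : HasGrad Ω u u₁ u₂) {a b ℓ m : ℝ} (hℓ : 0 < ℓ) (hm : 0 < m) (hK : rect a b ℓ m ⊆ Ω)
    (hA : MeasurableSet A) (hA' : MeasurableSet A')
    (hAK : A ⊆ rect a b ℓ m) (hAK' : A' ⊆ rect a b ℓ m) (h0 : volume A ≠ 0)
    (h0' : volume A' ≠ 0) :
    ‖(⨍ x in A', u x) - ⨍ x in A, u x‖ ^ 2 ≤ (volume.real A')⁻¹ * ((volume.real A)⁻¹ *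
      (16 * ℓ * m * (4 * ℓ ^ 2 + 4 * m ^ 2)) *
        ∫ x in rect a b ℓ m, (‖u₁ x‖ ^ 2 + ‖u₂ x‖ ^ 2)) := by
  have hf := volume_rect_ne_top a b ℓ m
  -- Differences of points lie in the doubled rectangle, whose area is `16 ℓ m`.
  have := h.norm_average_sub_average_sq_le (W := rect 0 0 (2 * ℓ) (2 * m))
    (D := 4 * ℓ ^ 2 + 4 * m ^ 2) (isOpen_rect a b ℓ m) (convex_rect a b ℓ m) hK
    (measurableSet_rect _ _ _ _) (volume_rect_ne_top _ _ _ _) ?_ ?_ hA hA' hAK hAK' h0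
    ((measure_mono hAK).trans_lt hf.lt_top).ne h0' ((measure_mono hAK').trans_lt hf.lt_top).ne
    (by positivity)
  · rw [volume_real_rect 0 0 (by positivity) (by positivity)] at this
    convert this using 4
    ring
  · intro w hw
    rw [mem_rect, sub_zero, sub_zero] at hw
    have h1 := sq_lt_sq' (abs_lt.1 hw.1).1 (abs_lt.1 hw.1).2
    have h2 := sq_lt_sq' (abs_lt.1 hw.2).1 (abs_lt.1 hw.2).2
    linarith
  · intro x hx y hy
    rw [mem_rect, abs_lt, abs_lt] at hx hy
    rw [mem_rect, abs_lt, abs_lt]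
    simp only [Prod.fst_sub, Prod.snd_sub]
    refine ⟨⟨?_, ?_⟩, ?_, ?_⟩ <;> linarith [hx.1.1, hx.1.2, hx.2.1, hx.2.2, hy.1.1, hy.1.2,
      hy.2.1, hy.2.2]

/-- At most two of the dyadic intervals `(2ᵏ d, 2ᵏ⁺² d)` contain a given point. -/
lemma card_dyadic_le_two {d : ℝ} (hd : 0 < d) (N : ℕ) (t : ℝ) :
    ((Finset.range N).filter fun k => 2 ^ k * d < t ∧ t < 4 * (2 ^ k * d)).card ≤ 2 := by
  set F := (Finset.range N).filter fun k => 2 ^ k * d < t ∧ t < 4 * (2 ^ k * d) with hF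
  rcases F.eq_empty_or_nonempty with h | h
  · simp [h]
  -- If `k₀` is the least index, any other index satisfies `2 ^ k d < t < 2 ^ (k₀ + 2) d`, hence `k
  -- ≤ k₀ + 1`.
  · have h0 := F.min'_mem h
    set k₀ := F.min' h
    have hsub : F ⊆ {k₀, k₀ + 1} := by
      intro k hk
      have h1 : k₀ ≤ k := F.min'_le k hk
      rw [hF, Finset.mem_filter] at hk h0
      have h2 : 2 ^ k * d < 2 ^ (k₀ + 2) * d := by
        have := hk.2.1.trans h0.2.2
        rw [pow_add]; linarith
      have h3 : k < k₀ + 2 := by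
        have := lt_of_mul_lt_mul_right h2 hd.le
        exact (pow_lt_pow_iff_right₀ (by norm_num : (1 : ℝ) < 2)).1 this
      simp only [Finset.mem_insert, Finset.mem_singleton]
      omega
    exact (Finset.card_le_card hsub).trans Finset.card_le_two

/-- Comparison of averages over squares of very different sizes, with the sharp logarithmic
dependence on the ratio of the sizes; `σ = ±1` is the direction of the cone of squares. -/
lemma HasGrad.average_sub_average_dyadic {Ω : Set (ℝ × ℝ)} {u u₁ u₂ : ℝ × ℝ → ℂ}
    (h : HasGrad Ω u u₁ u₂) {a b d σ : ℝ} (hd : 0 < d) (hσ : σ = 1 ∨ σ = -1) (N : ℕ)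
    (hK : rect a (b + σ * (2 ^ N * d)) (2 ^ N * d / 2) (2 ^ N * d) ⊆ Ω) :
    ‖(⨍ x in rect a (b + σ * (3 / 2 * (2 ^ N * d))) (2 ^ N * d / 2) (2 ^ N * d / 2), u x)
        - ⨍ x in rect a (b + σ * (3 / 2 * d)) (d / 2) (d / 2), u x‖ ^ 2
      ≤ 156 * N * ∫ x in rect a (b + σ * (2 ^ N * d)) (2 ^ N * d / 2) (2 ^ N * d),
          (‖u₁ x‖ ^ 2 + ‖u₂ x‖ ^ 2) := by
  set K := rect a (b + σ * (2 ^ N * d)) (2 ^ N * d / 2) (2 ^ N * d) with hKdef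
  set r : ℕ → ℝ := fun k => 2 ^ k * d with hr
  have hr0 (k : ℕ) : 0 < r k := by positivity
  -- With heights measured from `b` in the direction `σ`, `Q k` has side `r k` and occupies the
  -- heights `r k` to `2 r k`; `L k` has width `2 r k`, occupies the heights `r k` to `4 r k`, and
  -- contains both `Q k` and `Q (k + 1)`.
  set Q : ℕ → Set (ℝ × ℝ) := fun k => rect a (b + σ * (3 / 2 * r k)) (r k / 2) (r k / 2) with hQ
  set L : ℕ → Set (ℝ × ℝ) := fun k => rect a (b + σ * (5 / 2 * r k)) (r k) (3 / 2 * r k) with hL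
  set G : ℝ × ℝ → ℝ := fun x => ‖u₁ x‖ ^ 2 + ‖u₂ x‖ ^ 2 with hG
  have hG0 (x : ℝ × ℝ) : 0 ≤ G x := by positivity
  have hGi : Integrable G := h.integrable_energy
  have hsucc (k : ℕ) : r (k + 1) = 2 * r k := by simp only [hr, pow_succ]; ring
  have hLK (k : ℕ) (hk : k < N) : L k ⊆ K := by
    have h1 : 2 * r k ≤ r N := by
      rw [← hsucc]
      exact mul_le_mul_of_nonneg_right (pow_le_pow_right₀ (by norm_num) hk) hd.le
    have h2 := hr0 k
    change rect _ _ _ _ ⊆ rect a (b + σ * r N) (r N / 2) (r N)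
    intro x
    rw [mem_rect, mem_rect, abs_lt, abs_lt, abs_lt, abs_lt]
    rintro ⟨⟨h3, h4⟩, h5, h6⟩
    rcases hσ with rfl | rfl <;> refine ⟨⟨?_, ?_⟩, ?_, ?_⟩ <;> linarith
  -- By scale invariance the constant is independent of `k`: here `ℓ = r`, `m = 3 r / 2`, and `16 *
  -- (3 / 2) * (4 + 9) / (4 * 1) = 78`.
  have hstep (k : ℕ) (hk : k < N) :
      ‖(⨍ x in Q (k + 1), u x) - ⨍ x in Q k, u x‖ ^ 2 ≤ 78 * ∫ x in L k, G x := by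
    have h2 := hr0 k
    have hQ1 : Q k ⊆ L k := by
      intro x
      simp only [hQ, hL]
      rw [mem_rect, mem_rect, abs_lt, abs_lt, abs_lt, abs_lt]
      rintro ⟨⟨h3, h4⟩, h5, h6⟩
      rcases hσ with rfl | rfl <;> refine ⟨⟨?_, ?_⟩, ?_, ?_⟩ <;> linarith
    have hQ2 : Q (k + 1) ⊆ L k := by
      intro x
      simp only [hQ, hL, hsucc]
      rw [mem_rect, mem_rect, abs_lt, abs_lt, abs_lt, abs_lt]
      rintro ⟨⟨h3, h4⟩, h5, h6⟩
      rcases hσ with rfl | rfl <;> refine ⟨⟨?_, ?_⟩, ?_, ?_⟩ <;> linarith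
    have h3 := hr0 (k + 1)
    have := h.average_sub_average_rect h2 (by positivity) ((hLK k hk).trans hK)
      (measurableSet_rect _ _ _ _) (measurableSet_rect _ _ _ _) hQ1 hQ2
      (volume_rect_ne_zero _ _ (by positivity) (by positivity))
      (volume_rect_ne_zero _ _ (by positivity) (by positivity))
    refine this.trans (le_of_eq ?_)
    change _ = 78 * ∫ x in rect a (b + σ * (5 / 2 * r k)) (r k) (3 / 2 * r k),
      (‖u₁ x‖ ^ 2 + ‖u₂ x‖ ^ 2)
    generalize (∫ x in rect a (b + σ * (5 / 2 * r k)) (r k) (3 / 2 * r k),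
      (‖u₁ x‖ ^ 2 + ‖u₂ x‖ ^ 2)) = X
    rw [volume_real_rect _ _ (by positivity) (by positivity),
      volume_real_rect _ _ (by positivity) (by positivity), hsucc]
    field_simp
    ring
  -- The regions `L k` cover each point at most twice, by `card_dyadic_le_two` applied to the
  -- height. Hence the energies of all steps add up to at most twice the total.
  have hsum : ∑ k ∈ Finset.range N, ∫ x in L k, G x ≤ 2 * ∫ x in K, G x := by
    have hLm (k : ℕ) : MeasurableSet (L k) := measurableSet_rect _ _ _ _
    calc ∑ k ∈ Finset.range N, ∫ x in L k, G x
        = ∫ x, ∑ k ∈ Finset.range N, (L k).indicator G x := by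
          rw [integral_finsetSum _ fun k _ => hGi.indicator (hLm k)]
          exact Finset.sum_congr rfl fun k _ => (integral_indicator (hLm k)).symm
      _ ≤ ∫ x, K.indicator (fun x => 2 * G x) x := by
          refine integral_mono (integrable_finsetSum _ fun k _ => hGi.indicator (hLm k))
            ((hGi.const_mul 2).indicator (measurableSet_rect _ _ _ _)) fun x => ?_
          by_cases hx : x ∈ K
          · simp only [Set.indicator_of_mem hx]
            calc ∑ k ∈ Finset.range N, (L k).indicator G x
                ≤ ∑ k ∈ Finset.range N,
                    if r k < σ * (x.2 - b) ∧ σ * (x.2 - b) < 4 * r k then G x else 0 := by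
                  refine Finset.sum_le_sum fun k _ => ?_
                  by_cases hxk : x ∈ L k
                  · rw [Set.indicator_of_mem hxk, if_pos]
                    simp only [hL] at hxk
                    rw [mem_rect, abs_lt, abs_lt] at hxk
                    obtain ⟨-, h5, h6⟩ := hxk
                    rcases hσ with rfl | rfl <;> constructor <;> linarith
                  · rw [Set.indicator_of_notMem hxk]
                    split_ifs
                    · exact hG0 x
                    · exact le_rfl
              _ = ((Finset.range N).filter fun k =>
                    2 ^ k * d < σ * (x.2 - b) ∧ σ * (x.2 - b) < 4 * (2 ^ k * d)).card * G x := by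
                  rw [← Finset.sum_filter, Finset.sum_const, nsmul_eq_mul]
              _ ≤ 2 * G x := by
                  refine mul_le_mul_of_nonneg_right ?_ (hG0 x)
                  exact_mod_cast card_dyadic_le_two hd N _
          · rw [Set.indicator_of_notMem hx]
            refine (Finset.sum_eq_zero fun k hk => ?_).le
            exact Set.indicator_of_notMem (fun hxk => hx (hLK k (Finset.mem_range.1 hk) hxk)) _
      _ = _ := by
          rw [integral_indicator (measurableSet_rect _ _ _ _), integral_const_mul]
  have htri : ‖(⨍ x in Q N, u x) - ⨍ x in Q 0, u x‖
      ≤ ∑ k ∈ Finset.range N, ‖(⨍ x in Q (k + 1), u x) - ⨍ x in Q k, u x‖ := by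
    have := dist_le_range_sum_dist (fun k => ⨍ x in Q k, u x) N
    simp only [dist_eq_norm] at this
    rw [norm_sub_rev]
    refine this.trans (le_of_eq (Finset.sum_congr rfl fun k _ => norm_sub_rev _ _))
  have hQ0 : Q 0 = rect a (b + σ * (3 / 2 * d)) (d / 2) (d / 2) := by
    simp [hQ, hr]
  rw [← hQ0]
  calc ‖(⨍ x in Q N, u x) - ⨍ x in Q 0, u x‖ ^ 2
      ≤ (∑ k ∈ Finset.range N, ‖(⨍ x in Q (k + 1), u x) - ⨍ x in Q k, u x‖) ^ 2 := by
        gcongr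
    -- Cauchy-Schwarz over the `N` steps is the only loss, and it is linear in `N`; the final
    -- constant is `156 = 78 * 2`.
    _ ≤ N * ∑ k ∈ Finset.range N, ‖(⨍ x in Q (k + 1), u x) - ⨍ x in Q k, u x‖ ^ 2 := by
        simpa using sq_sum_le_card_mul_sum_sq (s := Finset.range N)
          (f := fun k => ‖(⨍ x in Q (k + 1), u x) - ⨍ x in Q k, u x‖)
    _ ≤ N * ∑ k ∈ Finset.range N, 78 * ∫ x in L k, G x := by
        gcongr with k hk
        exact hstep k (Finset.mem_range.1 hk)
    _ = N * (78 * ∑ k ∈ Finset.range N, ∫ x in L k, G x) := by simp only [← Finset.mul_sum]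
    _ ≤ N * (78 * (2 * ∫ x in K, G x)) := by gcongr
    _ = _ := by ring

/-! ### The flux through a passage -/

/-- The Cauchy-Schwarz inequality. -/
lemma norm_integral_mul_sq_le {α : Type*} [MeasurableSpace α] {ν : Measure α} {f g : α → ℂ}
    (hf : MemLp f 2 ν) (hg : MemLp g 2 ν) :
    ‖∫ x, f x * g x ∂ν‖ ^ 2 ≤ (∫ x, ‖f x‖ ^ 2 ∂ν) * ∫ x, ‖g x‖ ^ 2 ∂ν := by
  have h1 : ‖∫ x, f x * g x ∂ν‖ ≤ ∫ x, ‖f x‖ * ‖g x‖ ∂ν := by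
    simpa only [norm_mul] using norm_integral_le_integral_norm (fun x => f x * g x)
  have h2 := integral_mul_le_Lp_mul_Lq_of_nonneg (μ := ν) Real.HolderConjugate.two_two
    (f := fun x => ‖f x‖) (g := fun x => ‖g x‖) (Eventually.of_forall fun x => norm_nonneg _)
    (Eventually.of_forall fun x => norm_nonneg _) (by simpa using hf.norm) (by simpa using hg.norm)
  simp only [Real.rpow_two, ← Real.sqrt_eq_rpow] at h2
  have h3 : 0 ≤ ∫ x, ‖f x‖ ^ 2 ∂ν := integral_nonneg fun x => by positivity
  have h4 : 0 ≤ ∫ x, ‖g x‖ ^ 2 ∂ν := integral_nonneg fun x => by positivity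
  calc ‖∫ x, f x * g x ∂ν‖ ^ 2 ≤ (√(∫ x, ‖f x‖ ^ 2 ∂ν) * √(∫ x, ‖g x‖ ^ 2 ∂ν)) ^ 2 := by
        gcongr; exact h1.trans h2
    _ = _ := by rw [mul_pow, Real.sq_sqrt h3, Real.sq_sqrt h4]

lemma norm_setIntegral_sq_le {α : Type*} [MeasurableSpace α] {ν : Measure α} {f : α → ℂ}
    {A : Set α} (hA : ν A ≠ ⊤) (hf : MemLp f 2 (ν.restrict A)) :
    (∫ x in A, ‖f x‖ ∂ν) ^ 2 ≤ ν.real A * ∫ x in A, ‖f x‖ ^ 2 ∂ν := by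
  have hfin : IsFiniteMeasure (ν.restrict A) := ⟨by simpa using hA.lt_top⟩
  have hn : MemLp (fun x => ((‖f x‖ : ℝ) : ℂ)) 2 (ν.restrict A) := hf.norm.ofReal
  have := norm_integral_mul_sq_le hn (memLp_const (μ := ν.restrict A) (p := 2) (1 : ℂ))
  simp only [mul_one, integral_complex_ofReal, Complex.norm_real, norm_one, one_pow,
    integral_const, smul_eq_mul, Real.norm_eq_abs, sq_abs] at this
  rw [measureReal_restrict_apply_univ] at this
  linarith

/-- The mean flux through a passage and the difference of averages at its ends. -/
lemma HasGrad.average_sub_average_flux {Ω : Set (ℝ × ℝ)} {u u₁ u₂ : ℝ × ℝ → ℂ}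
    (hu : HasGrad Ω u u₁ u₂) {a d h : ℝ} (hd : 0 < d) (hh : 0 < h)
    (hΩ : ∀ x : ℝ × ℝ, |x.1 - a| < d / 2 → -(2 * d) < x.2 → x.2 < h + 2 * d → x ∈ Ω) :
    ‖(⨍ x in rect a (h + 3 / 2 * d) (d / 2) (d / 2), u x)
        - (⨍ x in rect a (-(3 / 2 * d)) (d / 2) (d / 2), u x)
        - (d : ℂ)⁻¹ * ∫ x in Set.Ioo (a - d / 2) (a + d / 2) ×ˢ Set.Icc 0 h, u₂ x‖ ^ 2
      ≤ 4 * ∫ x in Set.Ioo (a - d / 2) (a + d / 2) ×ˢ (Set.Ioc (-(2 * d)) 0 ∪ Set.Ioo h (h + 2 * d)),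
          (‖u₁ x‖ ^ 2 + ‖u₂ x‖ ^ 2) := by
  set I := Set.Ioo (a - d / 2) (a + d / 2) with hI
  set Jb := Set.Ioc (-(2 * d)) 0 with hJb
  set Jt := Set.Ioo h (h + 2 * d) with hJt
  set Qm := rect a (-(3 / 2 * d)) (d / 2) (d / 2) with hQm
  set Qp := rect a (h + 3 / 2 * d) (d / 2) (d / 2) with hQp
  -- The vertical shift by `h + 3 d` carries the lower square `Qm`, at heights `-2 d` to `-d`, onto
  -- the upper square `Qp`, at heights `h + d` to `h + 2 d`.
  set L : ℝ := h + 3 * d with hL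
  have hL0 : 0 < L := by positivity
  set w : ℝ × ℝ := (0, L) with hw
  have hloc : LocallyIntegrable u₂ := hu.memLp_snd.locInt
  have hQmI : Qm = I ×ˢ Set.Ioo (-(2 * d)) (-d) := by
    rw [hQm, rect, hI]; congr 2 <;> ring
  -- integrability on bounded sets
  have hbdd (J : Set ℝ) (hJ : J ⊆ Set.Icc (-(2 * d)) (h + 2 * d)) :
      IntegrableOn u₂ (I ×ˢ J) := by
    refine (hloc.integrableOn_isCompact (k := Set.Icc (a - d / 2) (a + d / 2) ×ˢ
      Set.Icc (-(2 * d)) (h + 2 * d)) (isCompact_Icc.prod isCompact_Icc)).mono_set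
      (Set.prod_mono Set.Ioo_subset_Icc_self hJ)
  have hprod (S T : Set ℝ) : (volume : Measure (ℝ × ℝ)).restrict (S ×ˢ T)
      = (volume.restrict S).prod (volume.restrict T) := by
    rw [Measure.volume_eq_prod, Measure.prod_restrict]
  have hint : ∀ᵐ x ∂(volume.restrict Qm), IntegrableOn (fun y => u₂ (x.1, y))
      (Set.Ioc (-(2 * d)) (h + 2 * d)) := by
    have h1 : Integrable u₂ ((volume.restrict I).prod
        (volume.restrict (Set.Ioc (-(2 * d)) (h + 2 * d)))) := by
      rw [← hprod]; exact hbdd _ Set.Ioc_subset_Icc_self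
    have h2 := h1.prod_right_ae
    rw [hQmI, hprod]
    exact Measure.quasiMeasurePreserving_fst.ae h2
  -- the pointwise identity
  have hftc := (hu.hasWeakDeriv w).ae_sub_eq_integral (U := Qm) (isOpen_rect _ _ _ _)
    hu.memLp.locInt (((hu.memLp_fst.const_mul _).add (hu.memLp_snd.const_mul _)).locInt) (by
      intro x hx s hs
      rw [hQm, mem_rect] at hx
      have h1 := abs_lt.1 hx.2
      have h2 : 0 ≤ s * L := mul_nonneg hs.1 hL0.le
      have h3 : s * L ≤ L := by nlinarith [hs.2]
      refine hΩ _ (by simpa [hw] using hx.1) ?_ ?_ <;> simp [hw] <;> linarith [h1.1, h1.2])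
  set F : ℝ → ℂ := fun x₁ => ∫ y in Set.Icc 0 h, u₂ (x₁, y) with hF
  set R : ℝ → ℝ := fun x₁ => ∫ y in Jb ∪ Jt, ‖u₂ (x₁, y)‖ with hR
  -- On almost every vertical line, the increment of `u` is the integral of `u₂` along the passage
  -- plus two end pieces, which lie in `Jb` and `Jt` whatever the height of the starting point.
  have hpt : ∀ᵐ x ∂(volume.restrict Qm), ‖u (x + w) - u x - F x.1‖ ≤ R x.1 := by
    filter_upwards [ae_restrict_of_ae hftc, hint, ae_restrict_mem (measurableSet_rect _ _ _ _)]
      with x h1 h2 hx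
    have hx2 : x.2 ∈ Set.Ioo (-(2 * d)) (-d) := by
      rw [hQmI] at hx
      exact hx.2
    set f : ℝ → ℂ := fun y => u₂ (x.1, y) with hf
    have e1 : ∫ s in (0 : ℝ)..1, (((w.1 : ℝ) : ℂ) * u₁ (x + s • w) + ((w.2 : ℝ) : ℂ) * u₂ (x + s • w))
        = ∫ y in x.2..(x.2 + L), f y := by
      have := intervalIntegral.smul_integral_comp_add_mul (a := 0) (b := 1) f L x.2
      rw [mul_zero, add_zero, mul_one] at this
      rw [← this, ← intervalIntegral.integral_smul]
      refine intervalIntegral.integral_congr fun s _ => ?_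
      simp only [hw, hf, Complex.ofReal_zero, zero_mul, zero_add, Complex.real_smul]
      congr 2
      ext <;> simp [mul_comm s L]
    have hii (p q : ℝ) (hp : -(2 * d) ≤ p) (hpq : p ≤ q) (hq : q ≤ h + 2 * d) :
        IntervalIntegrable f volume p q :=
      (intervalIntegrable_iff_integrableOn_Ioc_of_le hpq).2
        (h2.mono_set (Set.Ioc_subset_Ioc hp hq))
    have i1 := hii x.2 0 (by linarith [hx2.1]) (by linarith [hx2.2]) (by linarith)
    have i2 := hii 0 h (by linarith) (by linarith) (by linarith)
    have i3 := hii h (x.2 + L) (by linarith) (by linarith [hx2.1]) (by linarith [hx2.2])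
    have e2 : ∫ y in x.2..(x.2 + L), f y
        = (∫ y in x.2..0, f y) + (∫ y in (0 : ℝ)..h, f y) + ∫ y in h..(x.2 + L), f y := by
      rw [intervalIntegral.integral_add_adjacent_intervals i1 i2,
        intervalIntegral.integral_add_adjacent_intervals (i1.trans i2) i3]
    have e3 : F x.1 = ∫ y in (0 : ℝ)..h, f y := by
      change (∫ y in Set.Icc 0 h, f y) = _
      rw [integral_Icc_eq_integral_Ioc, intervalIntegral.integral_of_le hh.le]
    rw [(h1 hx).trans e1, e2, e3]
    have e4 : (∫ y in x.2..0, f y) + (∫ y in (0 : ℝ)..h, f y) + (∫ y in h..(x.2 + L), f y)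
        - (∫ y in (0 : ℝ)..h, f y) = (∫ y in x.2..0, f y) + ∫ y in h..(x.2 + L), f y := by ring
    rw [e4]
    have hJ0i : IntegrableOn f Jb := h2.mono_set (Set.Ioc_subset_Ioc le_rfl (by linarith))
    have hJ1i : IntegrableOn f Jt := h2.mono_set fun y hy => ⟨by linarith [hy.1], hy.2.le⟩
    have b1 : ‖∫ y in x.2..0, f y‖ ≤ ∫ y in Jb, ‖f y‖ := by
      refine (intervalIntegral.norm_integral_le_integral_norm (by linarith [hx2.2])).trans ?_
      rw [intervalIntegral.integral_of_le (by linarith [hx2.2])]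
      exact setIntegral_mono_set hJ0i.norm (Eventually.of_forall fun y => norm_nonneg _)
        (Eventually.of_forall (Set.Ioc_subset_Ioc hx2.1.le le_rfl))
    have b2 : ‖∫ y in h..(x.2 + L), f y‖ ≤ ∫ y in Jt, ‖f y‖ := by
      refine (intervalIntegral.norm_integral_le_integral_norm (by linarith [hx2.1])).trans ?_
      rw [intervalIntegral.integral_of_le (by linarith [hx2.1])]
      exact setIntegral_mono_set hJ1i.norm (Eventually.of_forall fun y => norm_nonneg _)
        (Eventually.of_forall fun y hy => ⟨hy.1, by linarith [hy.2, hx2.2]⟩)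
    refine (norm_add_le _ _).trans ((add_le_add b1 b2).trans (le_of_eq ?_))
    rw [hR]
    simp only
    rw [setIntegral_union ?_ measurableSet_Ioo hJ0i.norm hJ1i.norm]
    rw [Set.disjoint_left]
    intro y hy hy'
    linarith [hy.2, hy'.1]
  have hIr : volume.real I = d := by
    rw [hI, Real.volume_real_Ioo_of_le (by linarith)]; ring
  have hJr : volume.real (Set.Ioo (-(2 * d)) (-d)) = d := by
    rw [Real.volume_real_Ioo_of_le (by linarith)]; ring
  have hfst {X : Type} [NormedAddCommGroup X] [NormedSpace ℝ X] [CompleteSpace X] (g : ℝ → X) :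
      ∫ x in Qm, g x.1 = d • ∫ x in I, g x := by
    rw [hQmI, hprod, integral_fun_fst, measureReal_restrict_apply_univ, hJr]
  have hJ : Jb ∪ Jt ⊆ Set.Icc (-(2 * d)) (h + 2 * d) := by
    rintro y (hy | hy)
    · exact ⟨hy.1.le, by linarith [hy.2]⟩
    · exact ⟨by linarith [hy.1], hy.2.le⟩
  have hJ' : Set.Icc 0 h ⊆ Set.Icc (-(2 * d)) (h + 2 * d) :=
    Set.Icc_subset_Icc (by linarith) (by linarith)
  have hFi : Integrable (fun x : ℝ × ℝ => F x.1) (volume.restrict Qm) := by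
    have h1 := hbdd _ hJ'
    rw [IntegrableOn, hprod] at h1
    rw [hQmI, hprod]
    exact h1.integral_prod_left.comp_fst _
  have hRi : Integrable (fun x : ℝ × ℝ => R x.1) (volume.restrict Qm) := by
    have h1 := (hbdd _ hJ).norm
    rw [hprod] at h1
    rw [hQmI, hprod]
    exact h1.integral_prod_left.comp_fst _
  -- The flux along a line does not depend on the height of the starting point, so the integration
  -- over the square only multiplies it by `d`.
  have hFint : ∫ x in Qm, F x.1 = d • ∫ x in I ×ˢ Set.Icc 0 h, u₂ x := by
    have h1 := hbdd _ hJ'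
    rw [hfst, Measure.volume_eq_prod, setIntegral_prod _ h1]
  have hRint : ∫ x in Qm, R x.1 = d * ∫ x in I ×ˢ (Jb ∪ Jt), ‖u₂ x‖ := by
    have h1 := (hbdd _ hJ).norm
    rw [hfst, Measure.volume_eq_prod, setIntegral_prod _ h1, smul_eq_mul]
  have hQmf : volume Qm ≠ ⊤ := volume_rect_ne_top _ _ _ _
  have hfin : IsFiniteMeasure (volume.restrict Qm) := ⟨by simpa using hQmf.lt_top⟩
  have hpre : (fun x => x + w) ⁻¹' Qp = Qm := by
    ext x
    rw [Set.mem_preimage, hQp, hQm, mem_rect, mem_rect]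
    have : (x + w).2 - (h + 3 / 2 * d) = x.2 - -(3 / 2 * d) := by simp [hw, hL]; ring
    rw [this]
    simp [hw]
  have hemb : MeasurableEmbedding fun x : ℝ × ℝ => x + w :=
    (Homeomorph.addRight w).measurableEmbedding
  have hshift : ∫ x in Qm, u (x + w) = ∫ x in Qp, u x := by
    rw [← hpre]
    exact (measurePreserving_add_right volume w).setIntegral_preimage_emb hemb u Qp
  have hui : Integrable u (volume.restrict Qm) :=
    (hu.memLp.restrict Qm).integrable (by norm_num)
  have hui' : Integrable (fun x => u (x + w)) (volume.restrict Qm) :=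
    ((hu.memLp.comp_measurePreserving (measurePreserving_add_right volume w)).restrict
      Qm).integrable (by norm_num)
  have hsub : Integrable (fun x => u (x + w) - u x) (volume.restrict Qm) := hui'.sub hui
  have hmain : ‖(∫ x in Qp, u x) - (∫ x in Qm, u x) - d • ∫ x in I ×ˢ Set.Icc 0 h, u₂ x‖
      ≤ d * ∫ x in I ×ˢ (Jb ∪ Jt), ‖u₂ x‖ := by
    rw [← hRint, ← hFint, ← hshift, ← integral_sub hui' hui, ← integral_sub hsub hFi]
    exact norm_integral_le_of_norm_le hRi hpt
  have hvol (b : ℝ) : volume.real (rect a b (d / 2) (d / 2)) = d ^ 2 := by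
    rw [volume_real_rect _ _ (by positivity) (by positivity)]; ring
  have hdc : (d : ℂ) ≠ 0 := by exact_mod_cast hd.ne'
  have e5 : (⨍ x in Qp, u x) - (⨍ x in Qm, u x) - (d : ℂ)⁻¹ * ∫ x in I ×ˢ Set.Icc 0 h, u₂ x
      = ((d : ℂ) ^ 2)⁻¹ * ((∫ x in Qp, u x) - (∫ x in Qm, u x)
        - d • ∫ x in I ×ˢ Set.Icc 0 h, u₂ x) := by
    rw [setAverage_eq, setAverage_eq, hQp, hQm, hvol, hvol]
    simp only [Complex.real_smul, Complex.ofReal_inv, Complex.ofReal_pow]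
    field_simp
  have hvS : volume (I ×ˢ (Jb ∪ Jt)) = ENNReal.ofReal (4 * d ^ 2) := by
    rw [Measure.volume_eq_prod, Measure.prod_prod, measure_union ?_ measurableSet_Ioo,
      Real.volume_Ioo, Real.volume_Ioo, Real.volume_Ioc, ← ENNReal.ofReal_add (by linarith)
      (by linarith), ← ENNReal.ofReal_mul (by linarith)]
    · ring_nf
    · rw [Set.disjoint_left]
      intro y hy hy'
      linarith [hy.2, hy'.1]
  -- The end pieces have total area `4 d²`. After division by the area `d²` of a square, the powers
  -- of `d` cancel and the constant `4` remains.
  have hcs := norm_setIntegral_sq_le (A := I ×ˢ (Jb ∪ Jt)) (by rw [hvS]; exact ENNReal.ofReal_ne_top)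
    (hu.memLp_snd.restrict _)
  rw [measureReal_def, hvS, ENNReal.toReal_ofReal (by positivity)] at hcs
  have hle : ∫ x in I ×ˢ (Jb ∪ Jt), ‖u₂ x‖ ^ 2
      ≤ ∫ x in I ×ˢ (Jb ∪ Jt), (‖u₁ x‖ ^ 2 + ‖u₂ x‖ ^ 2) :=
    integral_mono hu.memLp_snd.integrable_norm_sq.integrableOn hu.integrable_energy.integrableOn
      fun x => by simp only; nlinarith [sq_nonneg ‖u₁ x‖]
  rw [e5, norm_mul, mul_pow, norm_inv, norm_pow, Complex.norm_real, Real.norm_eq_abs, sq_abs]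
  have h6 : 0 ≤ ∫ x in I ×ˢ (Jb ∪ Jt), ‖u₂ x‖ := integral_nonneg fun x => norm_nonneg _
  calc ((d ^ 2)⁻¹) ^ 2 * ‖(∫ x in Qp, u x) - (∫ x in Qm, u x)
        - d • ∫ x in I ×ˢ Set.Icc 0 h, u₂ x‖ ^ 2
      ≤ ((d ^ 2)⁻¹) ^ 2 * (d * ∫ x in I ×ˢ (Jb ∪ Jt), ‖u₂ x‖) ^ 2 := by gcongr
    _ = ((d ^ 2)⁻¹) ^ 2 * d ^ 2 * (∫ x in I ×ˢ (Jb ∪ Jt), ‖u₂ x‖) ^ 2 := by ring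
    _ ≤ ((d ^ 2)⁻¹) ^ 2 * d ^ 2 * (4 * d ^ 2 *
        ∫ x in I ×ˢ (Jb ∪ Jt), (‖u₁ x‖ ^ 2 + ‖u₂ x‖ ^ 2)) := by
        gcongr
        exact hcs.trans (by gcongr)
    _ = _ := by field_simp

/-! ### Geometry of the waveguide and the flux estimate in a cell -/

section Geometry

variable {B : Set (ℝ × ℝ)} {ε d h : ℝ} {j : ℤ}

lemma strip_subset_waveguide : strip ε ⊆ waveguide B ε d h := Set.subset_union_left

lemma room_subset_waveguide : room B ε h j ⊆ waveguide B ε d h :=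
  (Set.subset_union_left.trans (Set.subset_iUnion
    (fun j => room B ε h j ∪ passage ε d h j) j)).trans Set.subset_union_right

lemma passage_subset_waveguide : passage ε d h j ⊆ waveguide B ε d h :=
  (Set.subset_union_right.trans (Set.subset_iUnion
    (fun j => room B ε h j ∪ passage ε d h j) j)).trans Set.subset_union_right

lemma passage_eq_prod : passage ε d h j
    = Set.Ioo (cellCenter ε j - d / 2) (cellCenter ε j + d / 2) ×ˢ Set.Icc 0 h := by
  ext x
  simp only [passage, Set.mem_ofPred_eq, Set.mem_prod, Set.mem_Ioo, Set.mem_Icc, abs_lt]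
  constructor
  · rintro ⟨⟨h1, h2⟩, h3⟩
    exact ⟨⟨by linarith, by linarith⟩, h3⟩
  · rintro ⟨⟨h1, h2⟩, h3⟩
    exact ⟨⟨by linarith, by linarith⟩, h3⟩

lemma measurableSet_passage : MeasurableSet (passage ε d h j) := by
  rw [passage_eq_prod]; exact measurableSet_Ioo.prod measurableSet_Icc

lemma isOpen_room (hB : IsOpen B) (hε : 0 < ε) : IsOpen (room B ε h j) := by
  have : room B ε h j = (fun x => ε⁻¹ • (x - (cellCenter ε j, h))) ⁻¹' B := by
    ext x; exact mem_room_iff hε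
  rw [this]
  exact hB.preimage (by fun_prop)

lemma isOpen_strip : IsOpen (strip ε) :=
  (isOpen_lt continuous_const continuous_snd).inter (isOpen_lt continuous_snd continuous_const)

lemma measurableSet_waveguide (hB : IsOpen B) (hε : 0 < ε) :
    MeasurableSet (waveguide B ε d h) :=
  isOpen_strip.measurableSet.union
    (MeasurableSet.iUnion fun _ => (isOpen_room hB hε).measurableSet.union measurableSet_passage)

lemma IsRoom.mem_room (hB : IsRoom B) (hε : 0 < ε) {x : ℝ × ℝ} (hx : x ∈ room B ε h j) :
    |x.1 - cellCenter ε j| < ε / 2 ∧ h < x.2 := by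
  rw [mem_room_iff hε] at hx
  obtain ⟨h1, h2⟩ := hB.subset hx
  simp only [Prod.smul_fst, Prod.smul_snd, Prod.fst_sub, Prod.snd_sub, smul_eq_mul] at h1 h2
  rw [abs_mul, abs_of_pos (inv_pos.2 hε)] at h1
  constructor
  · rw [inv_mul_lt_iff₀ hε] at h1; linarith
  · have := (mul_pos_iff_of_pos_left (inv_pos.2 hε)).1 h2
    linarith

/-- The part of the waveguide in the `j`-th period cell. -/
def cell (B : Set (ℝ × ℝ)) (ε d h : ℝ) (j : ℤ) : Set (ℝ × ℝ) :=
  {x | x ∈ waveguide B ε d h ∧ |x.1 - cellCenter ε j| < ε / 2}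

lemma measurableSet_cell (hB : IsOpen B) (hε : 0 < ε) : MeasurableSet (cell B ε d h j) :=
  (measurableSet_waveguide hB hε).inter
    (isOpen_lt (continuous_fst.sub continuous_const).abs continuous_const).measurableSet

lemma cell_disjoint (hε : 0 < ε) {x : ℝ} {i j : ℤ} (hi : |x - cellCenter ε i| < ε / 2)
    (hj : |x - cellCenter ε j| < ε / 2) : i = j := by
  rw [abs_lt] at hi hj
  simp only [cellCenter] at hi hj
  have h1 : (i : ℝ) < j + 1 := by
    by_contra! hc
    nlinarith [mul_le_mul_of_nonneg_left hc hε.le]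
  have h2 : (j : ℝ) < i + 1 := by
    by_contra! hc
    nlinarith [mul_le_mul_of_nonneg_left hc hε.le]
  have h3 : i < j + 1 := by exact_mod_cast h1
  have h4 : j < i + 1 := by exact_mod_cast h2
  omega

end Geometry

/-- The difference of the averages over a room and over the adjacent cell of the strip is, up to
the energy, the mean flux through the passage. -/
theorem IsRoom.exists_flux_estimate {B : Set (ℝ × ℝ)} (hB : IsRoom B) :
    ∃ (δ C : ℝ), 0 < δ ∧ δ ≤ 1 / 2 ∧ 0 ≤ C ∧ ∀ (ε d h : ℝ) (N : ℕ) (j : ℤ)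
      (u u₁ u₂ : ℝ × ℝ → ℂ), 0 < ε → 0 < d → 0 < h → 2 ^ (N + 1) * d ≤ ε * δ →
      ε * δ < 2 ^ (N + 2) * d → HasGrad (waveguide B ε d h) u u₁ u₂ →
      ‖(⨍ x in room B ε h j, u x) - (⨍ x in rect (cellCenter ε j) (-(ε / 2)) (ε / 2) (ε / 2), u x)
        - (d : ℂ)⁻¹ * ∫ x in passage ε d h j, u₂ x‖ ^ 2
      ≤ C * (N + 1) * ∫ x in cell B ε d h j, (‖u₁ x‖ ^ 2 + ‖u₂ x‖ ^ 2) := by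
  obtain ⟨δ, hδ, hδ2, hrect⟩ := hB.exists_rectangle
  obtain ⟨C, hC0, hC⟩ := hB.exists_average_sub_average_room_le
  -- The factor `5` comes from squaring a sum of five terms. `16 C / δ²` is the comparison in the
  -- room and `128 / δ²` the one in the strip cell; the two dyadic chains and the ends of the
  -- passage give `2 * 156 * N + 4`, at most `316 (N + 1)`.
  refine ⟨δ, 5 * (16 * C / δ ^ 2 + 128 / δ ^ 2 + 316), hδ, hδ2, by positivity, ?_⟩
  intro ε d h N j u u₁ u₂ hε hd hh hN1 hN2 hu
  set a := cellCenter ε j with ha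
  -- The side of the largest dyadic square used. It lies between `ε δ / 4` and `ε δ / 2`, so the
  -- squares fit into the half-neighbourhood filled by the room and are still comparable with `ε`.
  set r : ℝ := 2 ^ N * d with hr
  have hr0 : 0 < r := by positivity
  have hr1 : 2 * r ≤ ε * δ := by rw [hr]; rw [pow_succ] at hN1; linarith
  have hr2 : ε * δ < 4 * r := by rw [hr]; rw [pow_add] at hN2; linarith
  have hdr : d ≤ r := by
    rw [hr]; nlinarith [one_le_pow₀ (M₀ := ℝ) (a := 2) (by norm_num) (n := N)]
  have hεδ : ε * δ ≤ ε / 2 := by nlinarith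
  have hroom (x : ℝ × ℝ) (h1 : |x.1 - a| < ε * δ) (h2 : h < x.2) (h3 : x.2 < h + ε * δ) :
      x ∈ room B ε h j := by
    rw [mem_room_iff hε]
    refine hrect _ ?_ ?_ ?_ <;>
      simp only [Prod.smul_fst, Prod.smul_snd, Prod.fst_sub, Prod.snd_sub, smul_eq_mul]
    · rwa [abs_mul, abs_of_pos (inv_pos.2 hε), inv_mul_lt_iff₀ hε]
    · exact mul_pos (inv_pos.2 hε) (by linarith)
    · rw [inv_mul_lt_iff₀ hε]; linarith
  set E := ∫ x in cell B ε d h j, (‖u₁ x‖ ^ 2 + ‖u₂ x‖ ^ 2) with hE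
  have hE0 : 0 ≤ E := energy_nonneg _ _ _
  have hrcell : room B ε h j ⊆ cell B ε d h j := fun x hx =>
    ⟨room_subset_waveguide hx, (hB.mem_room hε hx).1⟩
  have hscell {x : ℝ × ℝ} (h1 : |x.1 - a| < ε / 2) (h2 : -ε < x.2) (h3 : x.2 < 0) :
      x ∈ cell B ε d h j := ⟨strip_subset_waveguide ⟨h2, h3⟩, h1⟩
  have hcW : cell B ε d h j ⊆ waveguide B ε d h := fun x hx => hx.1
  have hratio : ε ^ 2 / r ^ 2 ≤ 16 / δ ^ 2 := by
    rw [div_le_div_iff₀ (by positivity) (by positivity)]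
    nlinarith [mul_pos hε hδ]
  -- the upper cone of squares
  have hQpN : rect a (h + 1 * (3 / 2 * r)) (r / 2) (r / 2) ⊆ room B ε h j := fun x hx => by
    rw [mem_rect] at hx
    have h2 := abs_lt.1 hx.2
    exact hroom x (by linarith [hx.1]) (by linarith [h2.1]) (by linarith [h2.2])
  have hKp : rect a (h + 1 * r) (r / 2) r ⊆ cell B ε d h j := fun x hx => hrcell <| by
    rw [mem_rect] at hx
    have h2 := abs_lt.1 hx.2
    exact hroom x (by linarith [hx.1]) (by linarith [h2.1]) (by linarith [h2.2])
  have hKm : rect a (0 + -1 * r) (r / 2) r ⊆ cell B ε d h j := fun x hx => by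
    rw [mem_rect] at hx
    have h2 := abs_lt.1 hx.2
    exact hscell (by linarith [hx.1]) (by linarith [h2.1]) (by linarith [h2.2])
  have hY : rect a (-(ε / 2)) (ε / 2) (ε / 2) ⊆ cell B ε d h j := fun x hx => by
    rw [mem_rect] at hx
    have h2 := abs_lt.1 hx.2
    exact hscell (by linarith [hx.1]) (by linarith [h2.1]) (by linarith [h2.2])
  have hQmN : rect a (0 + -1 * (3 / 2 * r)) (r / 2) (r / 2) ⊆ rect a (-(ε / 2)) (ε / 2) (ε / 2) :=
    fun x hx => by
      rw [mem_rect] at hx ⊢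
      have h2 := abs_lt.1 hx.2
      exact ⟨by linarith [hx.1], abs_lt.2 ⟨by linarith [h2.1], by linarith [h2.2]⟩⟩
  have hvQ (b : ℝ) : volume.real (rect a b (r / 2) (r / 2)) = r ^ 2 := by
    rw [volume_real_rect _ _ (by positivity) (by positivity)]; ring
  have hvY : volume.real (rect a (-(ε / 2)) (ε / 2) (ε / 2)) = ε ^ 2 := by
    rw [volume_real_rect _ _ (by positivity) (by positivity)]; ring
  have b1 := hC ε h j _ u u₁ u₂ _ hε hu room_subset_waveguide hQpN
    (volume_rect_ne_zero _ _ (by positivity) (by positivity))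
  have b2 := hu.average_sub_average_dyadic (a := a) (b := h) hd (Or.inl rfl) N (hKp.trans hcW)
  have b3 := hu.average_sub_average_flux (a := a) hd hh fun x h1 h2 h3 => by
    rcases lt_or_ge x.2 0 with h4 | h4
    · exact strip_subset_waveguide ⟨by linarith, h4⟩
    · rcases le_or_gt x.2 h with h5 | h5
      · exact passage_subset_waveguide (j := j) ⟨h1, h4, h5⟩
      · exact room_subset_waveguide (hroom x (by linarith) h5 (by linarith))
  have b4 := hu.average_sub_average_dyadic (a := a) (b := 0) hd (Or.inr rfl) N (hKm.trans hcW)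
  have b5 := hu.average_sub_average_rect (A := rect a (0 + -1 * (3 / 2 * r)) (r / 2) (r / 2))
    (A' := rect a (-(ε / 2)) (ε / 2) (ε / 2)) (half_pos hε) (half_pos hε) (hY.trans hcW)
    (measurableSet_rect _ _ _ _) (measurableSet_rect _ _ _ _) hQmN subset_rfl
    (volume_rect_ne_zero _ _ (by positivity) (by positivity))
    (volume_rect_ne_zero _ _ (by positivity) (by positivity))
  rw [← passage_eq_prod] at b3
  rw [hvQ] at b1 b5
  rw [hvY] at b5
  have c1 := b1.trans (mul_le_mul_of_nonneg_left (hu.energy_mono hrcell) (by positivity))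
  have c2 := b2.trans (mul_le_mul_of_nonneg_left (hu.energy_mono hKp) (by positivity))
  have c3 := b3.trans (mul_le_mul_of_nonneg_left (hu.energy_mono (L := cell B ε d h j) (by
    rintro x ⟨h1, h2⟩
    have h1' : |x.1 - a| < d / 2 := by
      rw [abs_lt]; constructor <;> linarith [h1.1, h1.2]
    rcases h2 with h2 | h2
    · rcases h2.2.lt_or_eq with h3 | h3
      · exact hscell (by linarith) (by linarith [h2.1]) h3
      · exact ⟨passage_subset_waveguide (j := j) ⟨h1', by linarith, by linarith⟩,
          by linarith⟩
    · exact hrcell (hroom x (by linarith) h2.1 (by linarith [h2.2])))) (by positivity))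
  have c4 := b4.trans (mul_le_mul_of_nonneg_left (hu.energy_mono hKm) (by positivity))
  have c5 : _ ≤ _ := b5.trans (mul_le_mul_of_nonneg_left (mul_le_mul_of_nonneg_left
    (hu.energy_mono hY) (by positivity)) (by positivity))
  rw [← hE] at c1 c2 c3 c4 c5
  have d1 : C * ε ^ 2 * (r ^ 2)⁻¹ * E ≤ 16 * C / δ ^ 2 * E := by
    refine mul_le_mul_of_nonneg_right ?_ hE0
    calc C * ε ^ 2 * (r ^ 2)⁻¹ = C * (ε ^ 2 / r ^ 2) := by ring
      _ ≤ C * (16 / δ ^ 2) := by gcongr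
      _ = _ := by ring
  have d5 : (ε ^ 2)⁻¹ * ((r ^ 2)⁻¹ * (16 * (ε / 2) * (ε / 2) *
      (4 * (ε / 2) ^ 2 + 4 * (ε / 2) ^ 2)) * E) ≤ 128 / δ ^ 2 * E := by
    calc _ = 8 * (ε ^ 2 / r ^ 2) * E := by field_simp; ring
      _ ≤ 8 * (16 / δ ^ 2) * E := by gcongr
      _ = _ := by ring
  have c1' := c1.trans d1
  have c5' := c5.trans d5
  have e2 : h + 1 * (3 / 2 * d) = h + 3 / 2 * d := by ring
  have e3 : 0 + -1 * (3 / 2 * d) = -(3 / 2 * d) := by ring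
  rw [e2] at c2
  rw [e3] at c4
  generalize (⨍ x in rect a (h + 1 * (3 / 2 * r)) (r / 2) (r / 2), u x) = PN at *
  generalize (⨍ x in rect a (h + 3 / 2 * d) (d / 2) (d / 2), u x) = P0 at *
  generalize (⨍ x in rect a (0 + -1 * (3 / 2 * r)) (r / 2) (r / 2), u x) = MN at *
  generalize (⨍ x in rect a (-(3 / 2 * d)) (d / 2) (d / 2), u x) = M0 at *
  generalize (⨍ x in room B ε h j, u x) = R at *
  generalize (⨍ x in rect a (-(ε / 2)) (ε / 2) (ε / 2), u x) = Y at *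
  generalize (d : ℂ)⁻¹ * ∫ x in passage ε d h j, u₂ x = F at *
  -- The chain of averages: room, large upper square, small upper square, passage, small lower
  -- square, large lower square, strip cell.
  have hdec : R - Y - F = -(PN - R) + (PN - P0) + (P0 - M0 - F) + -(MN - M0) + -(Y - MN) := by ring
  have h5 (x₁ x₂ x₃ x₄ x₅ : ℂ) : ‖x₁ + x₂ + x₃ + x₄ + x₅‖ ^ 2
      ≤ 5 * (‖x₁‖ ^ 2 + ‖x₂‖ ^ 2 + ‖x₃‖ ^ 2 + ‖x₄‖ ^ 2 + ‖x₅‖ ^ 2) := by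
    have h6 : ‖x₁ + x₂ + x₃ + x₄ + x₅‖ ≤ ‖x₁‖ + ‖x₂‖ + ‖x₃‖ + ‖x₄‖ + ‖x₅‖ := by
      refine (norm_add_le _ _).trans (add_le_add_left ((norm_add_le _ _).trans
        (add_le_add_left ((norm_add_le _ _).trans (add_le_add_left (norm_add_le _ _) _)) _)) _)
    refine (pow_le_pow_left₀ (norm_nonneg _) h6 2).trans ?_
    have := sq_sum_le_card_mul_sum_sq (s := (Finset.univ : Finset (Fin 5)))
      (f := ![‖x₁‖, ‖x₂‖, ‖x₃‖, ‖x₄‖, ‖x₅‖])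
    simpa [Fin.sum_univ_five] using this
  rw [hdec]
  refine (h5 _ _ _ _ _).trans ?_
  simp only [norm_neg]
  have hN0 : (0 : ℝ) ≤ N := Nat.cast_nonneg N
  have hx : 0 ≤ (16 * C / δ ^ 2 + 128 / δ ^ 2) * N * E := by positivity
  have hy : 0 ≤ (N : ℝ) * E := by positivity
  nlinarith

/-! ### Integration by parts in `H¹(ℝ)` -/

lemma HasWeakDeriv.smul_dir {E : Type*} [NormedAddCommGroup E] [NormedSpace ℝ E] [MeasureSpace E]
    {Ω : Set E} {e : E} {u g : E → ℂ} (h : HasWeakDeriv Ω e u g) (t : ℝ) :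
    HasWeakDeriv Ω (t • e) u (fun x => t * g x) := by
  intro φ h1 h2 h3
  have := h φ h1 h2 h3
  simp only [map_smul, smul_eq_mul, Complex.ofReal_mul, mul_left_comm _ (t : ℂ), mul_assoc]
  rw [integral_const_mul, integral_const_mul, this, mul_neg]

/-- The correlation of two square integrable functions is continuous. -/
lemma continuous_integral_translate_mul {f g : ℝ → ℂ} (hf : MemLp f 2) (hg : MemLp g 2) :
    Continuous fun s : ℝ => ∫ x, f (x + s) * g x := by
  have hmp (s : ℝ) : MeasurePreserving (fun x : ℝ => x + s) volume volume :=
    measurePreserving_add_right volume s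
  let T : ℝ → C(ℝ, ℝ) := fun s => ⟨fun x => x + s, by fun_prop⟩
  have hT : Continuous T := by
    refine ContinuousMap.continuous_of_continuous_uncurry _ ?_
    simp only [Function.uncurry_def, T, ContinuousMap.coe_mk]
    fun_prop
  -- Translations are strongly continuous in `L₂`; the correlation is the scalar product with a
  -- fixed element.
  have hc : Continuous fun s => Lp.compMeasurePreserving (T s) (hmp s) (hf.toLp f) :=
    continuous_const.compMeasurePreservingLp hT hmp (by norm_num : (2 : ℝ≥0∞) ≠ ⊤)
  have hgs : MemLp (fun x => conj (g x)) 2 := hg.star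
  have := (continuous_const (y := hgs.toLp _)).inner (𝕜 := ℂ) hc
  refine this.congr fun s => ?_
  rw [L2.inner_def]
  refine integral_congr_ae ?_
  have e1 := Lp.coeFn_compMeasurePreserving (hf.toLp f) (hmp s)
  have e2 := (hmp s).quasiMeasurePreserving.ae_eq_comp hf.coeFn_toLp
  filter_upwards [e1, e2, hgs.coeFn_toLp] with x h1 h2 h3
  simp only [Function.comp_apply] at h1 h2
  change inner ℂ (hgs.toLp _ x) (Lp.compMeasurePreserving (fun x => x + s) (hmp s) (hf.toLp f) x) = _
  rw [h1, h2, h3]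
  simp

/-- Integrated difference quotients of an `H¹` function. -/
lemma IsH1Line.integral_translate_sub_mul {u u' v : ℝ → ℂ} (hu : IsH1Line u u')
    (hv : MemLp v 2) (t : ℝ) :
    (∫ x, u (x + t) * v x) - ∫ x, u x * v x = ∫ s in (0 : ℝ)..t, ∫ x, u' (x + s) * v x := by
  set ν : Measure ℝ := volume.restrict (Set.Ioc (0 : ℝ) 1) with hν
  have hmp (s : ℝ) : MeasurePreserving (fun x : ℝ => x + s) volume volume :=
    measurePreserving_add_right volume s
  -- A shift by `t` is the fundamental theorem along the segment with direction `t`, whose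
  -- derivative is `t u'`.
  have hw : HasWeakDeriv Set.univ t u (fun x => t * u' x) := by
    simpa using hu.hasWeakDeriv.smul_dir t
  have hg : LocallyIntegrable fun x => (t : ℂ) * u' x := (hu.memLp_deriv.const_mul _).locInt
  have hftc := hw.ae_sub_eq_integral isOpen_univ hu.memLp.locInt hg (fun x _ s _ => Set.mem_univ _)
  have i1 : Integrable fun x => u (x + t) * v x :=
    (hu.memLp.comp_measurePreserving (hmp t)).integrable_mul hv
  have i2 : Integrable fun x => u x * v x := hu.memLp.integrable_mul hv
  have hshear : MeasurePreserving (fun p : ℝ × ℝ => (p.1, p.2 + p.1 * t))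
      (ν.prod volume) (ν.prod volume) :=
    (MeasurePreserving.id ν).skew_product (g := fun s x => x + s * t)
      (by fun_prop) (Eventually.of_forall fun s => (hmp (s * t)).map_eq)
  have hm : AEStronglyMeasurable (fun p : ℝ × ℝ => u' (p.2 + p.1 * t)) (ν.prod volume) :=
    (hu.memLp_deriv.aestronglyMeasurable.comp_snd (μ := ν)).comp_quasiMeasurePreserving
      hshear.quasiMeasurePreserving
  have hint : Integrable (fun p : ℝ × ℝ => (t : ℂ) * (u' (p.2 + p.1 * t) * v p.2))
      (ν.prod volume) := by
    refine Integrable.const_mul ?_ _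
    have hs : Integrable (fun p : ℝ × ℝ => ‖u' p.2‖ ^ 2) (ν.prod volume) :=
      hu.memLp_deriv.integrable_norm_sq.comp_snd _
    have hs1 : Integrable (fun p : ℝ × ℝ => ‖u' (p.2 + p.1 * t)‖ ^ 2) (ν.prod volume) :=
      hshear.integrable_comp_of_integrable hs
    have hs2 : Integrable (fun p : ℝ × ℝ => ‖v p.2‖ ^ 2) (ν.prod volume) :=
      hv.integrable_norm_sq.comp_snd _
    refine (hs1.add hs2).mono (hm.mul hv.aestronglyMeasurable.comp_snd)
      (Eventually.of_forall fun p => ?_)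
    rw [norm_mul, Pi.add_apply, Real.norm_eq_abs, abs_of_nonneg (by positivity)]
    nlinarith [sq_nonneg (‖u' (p.2 + p.1 * t)‖ - ‖v p.2‖), sq_nonneg ‖u' (p.2 + p.1 * t)‖,
      sq_nonneg ‖v p.2‖]
  have hswap := integral_integral_swap
    (f := fun s x => (t : ℂ) * (u' (x + s * t) * v x)) hint
  calc (∫ x, u (x + t) * v x) - ∫ x, u x * v x
      = ∫ x, (∫ s in (0 : ℝ)..1, (t : ℂ) * u' (x + s • t)) * v x := by
        rw [← integral_sub i1 i2]
        refine integral_congr_ae ?_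
        filter_upwards [hftc] with x hx
        rw [← hx (Set.mem_univ _)]; ring
    _ = ∫ x, (∫ s, (t : ℂ) * (u' (x + s * t) * v x) ∂ν) := by
        congr 1; ext x
        rw [intervalIntegral.integral_of_le zero_le_one, ← integral_mul_const]
        simp only [mul_assoc, smul_eq_mul]
        rfl
    _ = ∫ s, (∫ x, (t : ℂ) * (u' (x + s * t) * v x)) ∂ν := hswap.symm
    _ = ∫ s in (0 : ℝ)..1, t • ∫ x, u' (x + t * s) * v x := by
        rw [intervalIntegral.integral_of_le zero_le_one]
        refine integral_congr_ae (Eventually.of_forall fun s => ?_)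
        simp only [Complex.real_smul]
        rw [integral_const_mul, mul_comm t s]
    _ = _ := by
        rw [intervalIntegral.integral_smul]
        have := intervalIntegral.smul_integral_comp_mul_left (a := 0) (b := 1)
          (fun s => ∫ x, u' (x + s) * v x) t
        simpa using this

/-- Integration by parts in `H¹(ℝ)`. -/
theorem IsH1Line.integral_mul_deriv {u u' v v' : ℝ → ℂ} (hu : IsH1Line u u')
    (hv : IsH1Line v v') : ∫ x, u' x * v x = -∫ x, u x * v' x := by
  set A : ℝ → ℂ := fun s => ∫ x, u' (x + s) * v x with hA
  set A' : ℝ → ℂ := fun s => ∫ x, u (x + s) * v' x with hA'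
  have hAc : Continuous A := continuous_integral_translate_mul hu.memLp_deriv hv.memLp
  have hA'c : Continuous A' := continuous_integral_translate_mul hu.memLp hv.memLp_deriv
  -- The quantity `∫ u (x + t) v x = ∫ u x v (x - t)` is expanded once by moving `u` and once by
  -- moving `v`. Differentiation of the resulting identity at `t = 0` is the integration by parts.
  have key (t : ℝ) : ∫ s in (0 : ℝ)..t, A s = -∫ s in (0 : ℝ)..t, A' s := by
    have h1 := hu.integral_translate_sub_mul hv.memLp t
    have h2 := hv.integral_translate_sub_mul hu.memLp (-t)
    have h3 : ∫ x, v (x + -t) * u x = ∫ x, u (x + t) * v x := by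
      rw [← integral_add_right_eq_self (fun x => v (x + -t) * u x) t]
      simp only [add_neg_cancel_right, mul_comm]
    have h4 (s : ℝ) : ∫ x, v' (x + s) * u x = A' (-s) := by
      rw [← integral_add_right_eq_self (fun x => v' (x + s) * u x) (-s)]
      simp only [neg_add_cancel_right, mul_comm, hA']
    have h5 : ∫ x, v x * u x = ∫ x, u x * v x := by simp only [mul_comm]
    simp only [h4] at h2
    rw [h3, h5, h1, intervalIntegral.integral_comp_neg, neg_neg, neg_zero] at h2
    rw [h2, intervalIntegral.integral_symm]
  have h1 : HasDerivAt (fun t => ∫ s in (0 : ℝ)..t, A s) (A 0) 0 :=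
    intervalIntegral.integral_hasDerivAt_right (hAc.intervalIntegrable _ _)
      (hAc.stronglyMeasurableAtFilter _ _) hAc.continuousAt
  have h2 : HasDerivAt (fun t => -∫ s in (0 : ℝ)..t, A' s) (-A' 0) 0 :=
    (intervalIntegral.integral_hasDerivAt_right (hA'c.intervalIntegrable _ _)
      (hA'c.stronglyMeasurableAtFilter _ _) hA'c.continuousAt).fun_neg
  simp only [key] at h1
  have := h1.unique h2
  simpa [hA, hA'] using this

/-! ### Operations in `H¹(ℝ)` -/

lemma memLp_line_of_continuous {φ : ℝ → ℝ} (hc : Continuous φ) (hs : HasCompactSupport φ) :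
    MemLp (fun x => ((φ x : ℝ) : ℂ)) 2 :=
  (hc.memLp_of_hasCompactSupport hs).ofReal

lemma memLp_deriv_line {φ : ℝ → ℝ} (h1 : ContDiff ℝ ∞ φ) (h2 : HasCompactSupport φ) :
    MemLp (fun x => ((deriv φ x : ℝ) : ℂ)) 2 :=
  memLp_line_of_continuous (h1.continuous_deriv (by simp)) h2.deriv

lemma isH1Line_test {φ : ℝ → ℝ} (h1 : ContDiff ℝ ∞ φ) (h2 : HasCompactSupport φ) :
    IsH1Line (fun x => ((φ x : ℝ) : ℂ)) (fun x => ((deriv φ x : ℝ) : ℂ)) where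
  memLp := memLp_line_of_continuous h1.continuous h2
  memLp_deriv := memLp_deriv_line h1 h2
  hasWeakDeriv := by
    intro ψ p1 p2 _
    simp only [fderiv_apply_one_eq_deriv, setIntegral_univ, ← Complex.ofReal_mul,
      integral_complex_ofReal]
    rw [← Complex.ofReal_neg]
    congr 1
    have hd1 := h1.differentiable (by simp)
    have hd2 := p1.differentiable (by simp)
    have hc1 := h1.continuous_deriv (by simp)
    have hc2 := p1.continuous_deriv (by simp)
    exact integral_mul_deriv_eq_deriv_mul_of_integrable
      (fun x _ => (hd1 x).hasDerivAt) (fun x _ => (hd2 x).hasDerivAt)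
      ((h1.continuous.mul hc2).integrable_of_hasCompactSupport h2.mul_right)
      ((hc1.mul p1.continuous).integrable_of_hasCompactSupport p2.mul_left)
      ((h1.continuous.mul p1.continuous).integrable_of_hasCompactSupport h2.mul_right)

lemma HasWeakDeriv.conj {E : Type*} [NormedAddCommGroup E] [NormedSpace ℝ E] [MeasureSpace E]
    {Ω : Set E} {e : E} {u g : E → ℂ} (h : HasWeakDeriv Ω e u g) :
    HasWeakDeriv Ω e (fun x => conj (u x)) (fun x => conj (g x)) := by
  intro φ h1 h2 h3
  have := congrArg conj (h φ h1 h2 h3)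
  rw [map_neg, ← integral_conj, ← integral_conj] at this
  simpa using this

lemma IsH1Line.conj {u u' : ℝ → ℂ} (h : IsH1Line u u') :
    IsH1Line (fun x => conj (u x)) (fun x => conj (u' x)) :=
  ⟨h.memLp.star, h.memLp_deriv.star, h.hasWeakDeriv.conj⟩

lemma integrable_line_mul_test {u : ℝ → ℂ} (hu : MemLp u 2) {φ : ℝ → ℝ} (hc : Continuous φ)
    (hs : HasCompactSupport φ) : Integrable fun x => u x * ((φ x : ℝ) : ℂ) :=
  hu.integrable_mul (memLp_line_of_continuous hc hs)

lemma IsH1Line.add {u u' v v' : ℝ → ℂ} (hu : IsH1Line u u') (hv : IsH1Line v v') :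
    IsH1Line (fun x => u x + v x) (fun x => u' x + v' x) where
  memLp := hu.memLp.add hv.memLp
  memLp_deriv := hu.memLp_deriv.add hv.memLp_deriv
  hasWeakDeriv := by
    intro φ h1 h2 h3
    have e1 := hu.hasWeakDeriv φ h1 h2 h3
    have e2 := hv.hasWeakDeriv φ h1 h2 h3
    have hc : Continuous fun x => fderiv ℝ φ x 1 :=
      (h1.continuous_fderiv (by simp)).clm_apply continuous_const
    have hs : HasCompactSupport fun x => fderiv ℝ φ x 1 := h2.fderiv_apply ℝ 1
    simp only [setIntegral_univ] at e1 e2 ⊢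
    simp only [add_mul]
    rw [integral_add (integrable_line_mul_test hu.memLp hc hs)
      (integrable_line_mul_test hv.memLp hc hs),
      integral_add (integrable_line_mul_test hu.memLp_deriv h1.continuous h2)
      (integrable_line_mul_test hv.memLp_deriv h1.continuous h2), e1, e2]
    ring

lemma IsH1Line.const_mul {u u' : ℝ → ℂ} (hu : IsH1Line u u') (c : ℂ) :
    IsH1Line (fun x => c * u x) (fun x => c * u' x) where
  memLp := hu.memLp.const_mul c
  memLp_deriv := hu.memLp_deriv.const_mul c
  hasWeakDeriv := by
    intro φ h1 h2 h3
    have e1 := hu.hasWeakDeriv φ h1 h2 h3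
    simp only [mul_assoc]
    rw [integral_const_mul, integral_const_mul, e1, mul_neg]

lemma IsH1Line.sub {u u' v v' : ℝ → ℂ} (hu : IsH1Line u u') (hv : IsH1Line v v') :
    IsH1Line (fun x => u x - v x) (fun x => u' x - v' x) := by
  have := hu.add (hv.const_mul (-1))
  simpa [← sub_eq_add_neg] using this

/-! ### Density of test functions and the limit problem -/

/-- For a bounded family, the vectors along which the scalar products tend to zero form a closed
subspace. -/
lemma tendsto_inner_of_mem_closure {H ι : Type*} [NormedAddCommGroup H] [InnerProductSpace ℂ H]
    {l : Filter ι} {X : ι → H} {C : ℝ} (hX : ∀ᶠ i in l, ‖X i‖ ≤ C) {S : Set H}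
    (hS : ∀ s ∈ S, Tendsto (fun i => inner ℂ s (X i)) l (𝓝 0)) {w : H}
    (hw : w ∈ (Submodule.span ℂ S).topologicalClosure) :
    Tendsto (fun i => inner ℂ w (X i)) l (𝓝 0) := by
  have hspan : ∀ s ∈ Submodule.span ℂ S, Tendsto (fun i => inner ℂ s (X i)) l (𝓝 0) := by
    intro s hs
    induction hs using Submodule.span_induction with
    | mem s hs => exact hS s hs
    | zero => simpa only [inner_zero_left] using tendsto_const_nhds
    | add x y _ _ hx hy => simpa only [inner_add_left, add_zero] using hx.add hy
    | smul r x _ hx => simpa only [inner_smul_left, mul_zero] using hx.const_mul (conj r)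
  have hC : ∀ᶠ i in l, ‖X i‖ ≤ max C 1 := hX.mono fun i hi => hi.trans (le_max_left _ _)
  have hC0 : 0 < max C 1 := lt_max_of_lt_right one_pos
  rw [Metric.tendsto_nhds]
  intro ε hε
  have hw' : w ∈ closure (Submodule.span ℂ S : Set H) := hw
  obtain ⟨s, hs, hws⟩ := Metric.mem_closure_iff.1 hw' (ε / (2 * max C 1)) (by positivity)
  filter_upwards [hC, Metric.tendsto_nhds.1 (hspan s hs) (ε / 2) (by positivity)] with i h1 h2
  rw [dist_zero_right] at h2 ⊢
  have h3 : inner ℂ w (X i) = inner ℂ (w - s) (X i) + inner ℂ s (X i) := by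
    rw [inner_sub_left]; ring
  rw [dist_eq_norm] at hws
  calc ‖inner ℂ w (X i)‖ ≤ ‖inner ℂ (w - s) (X i)‖ + ‖inner ℂ s (X i)‖ := by
        rw [h3]; exact norm_add_le _ _
    _ ≤ ε / (2 * max C 1) * max C 1 + ‖inner ℂ s (X i)‖ := by
        gcongr
        exact (norm_inner_le_norm _ _).trans (by gcongr)
    _ < ε := by
        have : ε / (2 * max C 1) * max C 1 = ε / 2 := by field_simp
        linarith

lemma inner_toLp_line {v w : ℝ → ℂ} (hw : MemLp w 2) (hv : MemLp v 2) :
    inner ℂ (hw.toLp w) (hv.toLp v) = ∫ x, v x * conj (w x) := by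
  rw [L2.inner_def]
  refine integral_congr_ae ?_
  filter_upwards [hw.coeFn_toLp, hv.coeFn_toLp] with x hx hy
  simp [hx, hy]

lemma inner_toLp_line' {w : ℝ → ℂ} (hw : MemLp w 2) (a : Lp ℂ 2 (volume : Measure ℝ)) :
    inner ℂ (hw.toLp w) a = ∫ x, a x * conj (w x) := by
  rw [L2.inner_def]
  refine integral_congr_ae ?_
  filter_upwards [hw.coeFn_toLp] with x hx
  simp [hx]

lemma norm_toLp_line {v : ℝ → ℂ} (hv : MemLp v 2) :
    ‖hv.toLp v‖ ^ 2 = ∫ x, ‖v x‖ ^ 2 := by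
  have h := inner_toLp_line hv hv
  have h2 : ∫ x, v x * conj (v x) = ((∫ x, ‖v x‖ ^ 2 : ℝ) : ℂ) := by
    rw [← integral_complex_ofReal]
    congr 1; ext x; rw [Complex.mul_conj']; push_cast; rfl
  rw [h2, inner_self_eq_norm_sq_to_K] at h
  apply Complex.ofReal_injective
  simpa using h

/-- The space `L₂(ℝ)`. -/
noncomputable abbrev LineL2 := Lp ℂ 2 (volume : Measure ℝ)

/-- An element of `L₂` orthogonal to all test functions vanishes almost everywhere, so their span is
dense. -/
lemma tendsto_integral_of_test {ι : Type*} {l : Filter ι} {G : ι → ℝ → ℂ} {C : ℝ}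
    (hG : ∀ᶠ i in l, MemLp (G i) 2) (hC : ∀ᶠ i in l, ∫ x, ‖G i x‖ ^ 2 ≤ C)
    (ht : ∀ φ : ℝ → ℝ, ContDiff ℝ ∞ φ → HasCompactSupport φ →
      Tendsto (fun i => ∫ x, G i x * ((φ x : ℝ) : ℂ)) l (𝓝 0))
    {w : ℝ → ℂ} (hw : MemLp w 2) :
    Tendsto (fun i => ∫ x, G i x * conj (w x)) l (𝓝 0) := by
  classical
  let X : ι → Lp ℂ 2 (volume : Measure ℝ) := fun i =>
    if h : MemLp (G i) 2 then h.toLp (G i) else 0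
  let S : Set (Lp ℂ 2 (volume : Measure ℝ)) := {s | ∃ (φ : ℝ → ℝ) (h1 : ContDiff ℝ ∞ φ)
    (h2 : HasCompactSupport φ), s = (memLp_line_of_continuous h1.continuous h2).toLp _}
  have hX : ∀ᶠ i in l, ‖X i‖ ≤ √C := by
    filter_upwards [hG, hC] with i h1 h2
    simp only [X, dif_pos h1]
    exact Real.le_sqrt_of_sq_le (by rwa [norm_toLp_line])
  have hS : ∀ s ∈ S, Tendsto (fun i => inner ℂ s (X i)) l (𝓝 0) := by
    rintro s ⟨φ, h1, h2, rfl⟩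
    refine (ht φ h1 h2).congr' ?_
    filter_upwards [hG] with i hi
    simp only [X, dif_pos hi, inner_toLp_line, Complex.conj_ofReal]
  have hmem : hw.toLp w ∈ (Submodule.span ℂ S).topologicalClosure := by
    rw [(Submodule.topologicalClosure_eq_top_iff (K := Submodule.span ℂ S)).2]
    · trivial
    rw [Submodule.eq_bot_iff]
    intro z hz
    have hz' (φ : ℝ → ℝ) (h1 : ContDiff ℝ ∞ φ) (h2 : HasCompactSupport φ) :
        ∫ x, z x * ((φ x : ℝ) : ℂ) = 0 := by
      have := hz _ (Submodule.subset_span ⟨φ, h1, h2, rfl⟩)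
      rw [inner_toLp_line'] at this
      simpa using this
    have : ∀ᵐ x : ℝ, z x = 0 := by
      refine ae_eq_zero_of_integral_contDiff_smul_eq_zero (Lp.memLp z).locInt fun φ h1 h2 => ?_
      simpa [mul_comm] using hz' φ h1 h2
    exact Lp.ext (Filter.EventuallyEq.trans this (Lp.coeFn_zero ℂ 2 volume).symm)
  refine (tendsto_inner_of_mem_closure hX hS hmem).congr' ?_
  filter_upwards [hG] with i hi
  simp only [X, dif_pos hi, inner_toLp_line]

/-- The pairs `(φ, φ')` need only be shown dense among the pairs `(w, w')`. If `(z₁, z₂)` is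
orthogonal to all `(φ, φ')`, then `z₁` is the weak derivative of `z₂`, and integration by parts
makes it orthogonal to every `(w, w')`. -/
lemma tendsto_form_of_test {ι : Type*} {l : Filter ι} {G K : ι → ℝ → ℂ} {C : ℝ}
    (hG : ∀ᶠ i in l, MemLp (G i) 2) (hK : ∀ᶠ i in l, MemLp (K i) 2)
    (hGC : ∀ᶠ i in l, ∫ x, ‖G i x‖ ^ 2 ≤ C) (hKC : ∀ᶠ i in l, ∫ x, ‖K i x‖ ^ 2 ≤ C)
    (ht : ∀ φ : ℝ → ℝ, ContDiff ℝ ∞ φ → HasCompactSupport φ →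
      Tendsto (fun i => (∫ x, G i x * ((φ x : ℝ) : ℂ)) + ∫ x, K i x * ((deriv φ x : ℝ) : ℂ)) l
        (𝓝 0)) {w w' : ℝ → ℂ} (hw : IsH1Line w w') :
    Tendsto (fun i => (∫ x, G i x * conj (w x)) + ∫ x, K i x * conj (w' x)) l (𝓝 0) := by
  classical
  let X : ι → WithLp 2 (LineL2 × LineL2) := fun i =>
    if h : MemLp (G i) 2 ∧ MemLp (K i) 2 then WithLp.toLp 2 (h.1.toLp (G i), h.2.toLp (K i)) else 0
  let S : Set (WithLp 2 (LineL2 × LineL2)) := {s | ∃ (φ : ℝ → ℝ) (h1 : ContDiff ℝ ∞ φ)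
    (h2 : HasCompactSupport φ), s = WithLp.toLp 2
      ((memLp_line_of_continuous h1.continuous h2).toLp _, (memLp_deriv_line h1 h2).toLp _)}
  have hX : ∀ᶠ i in l, ‖X i‖ ≤ √(C + C) := by
    filter_upwards [hG, hK, hGC, hKC] with i h1 h2 h3 h4
    simp only [X, dif_pos (And.intro h1 h2)]
    refine Real.le_sqrt_of_sq_le ?_
    rw [WithLp.prod_norm_sq_eq_of_L2]
    change ‖h1.toLp (G i)‖ ^ 2 + ‖h2.toLp (K i)‖ ^ 2 ≤ _
    rw [norm_toLp_line, norm_toLp_line]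
    exact add_le_add h3 h4
  have hS : ∀ s ∈ S, Tendsto (fun i => inner ℂ s (X i)) l (𝓝 0) := by
    rintro s ⟨φ, h1, h2, rfl⟩
    refine (ht φ h1 h2).congr' ?_
    filter_upwards [hG, hK] with i hi hi'
    simp only [X, dif_pos (And.intro hi hi'), WithLp.prod_inner_apply, inner_toLp_line,
      Complex.conj_ofReal]
  have hmem : WithLp.toLp 2 (hw.memLp.toLp w, hw.memLp_deriv.toLp w')
      ∈ (Submodule.span ℂ S).topologicalClosure := by
    rw [← Submodule.orthogonal_orthogonal_eq_closure]
    intro z hz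
    have hz' : IsH1Line (z.snd : LineL2) (z.fst : LineL2) := by
      refine ⟨Lp.memLp _, Lp.memLp _, fun φ h1 h2 _ => ?_⟩
      have := hz _ (Submodule.subset_span ⟨φ, h1, h2, rfl⟩)
      simp only [WithLp.prod_inner_apply, inner_toLp_line', Complex.conj_ofReal] at this
      simp only [fderiv_apply_one_eq_deriv, setIntegral_univ]
      rw [add_comm] at this
      exact eq_neg_of_add_eq_zero_left this
    have := hz'.integral_mul_deriv hw.conj
    rw [inner_eq_zero_symm]
    simp only [WithLp.prod_inner_apply, inner_toLp_line']
    exact add_eq_zero_iff_eq_neg.2 this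
  refine (tendsto_inner_of_mem_closure hX hS hmem).congr' ?_
  filter_upwards [hG, hK] with i hi hi'
  simp only [X, dif_pos (And.intro hi hi'), WithLp.prod_inner_apply, inner_toLp_line]

lemma integrable_mul_conj_line {u v : ℝ → ℂ} (hu : MemLp u 2) (hv : MemLp v 2) :
    Integrable fun x => u x * conj (v x) := hu.integrable_mul hv.star

lemma IsH1Line.congr_deriv {u u' v' : ℝ → ℂ} (h : IsH1Line u u') (e : ∀ x, u' x = v' x) :
    IsH1Line u v' := by
  have : u' = v' := funext e
  rwa [← this]

/-- The equation `-u'' + m u = g` in weak form. -/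
lemma exists_weak_solution {m : ℝ} (hm : 0 < m) {g : ℝ → ℂ} (hg : MemLp g 2) :
    ∃ u u' : ℝ → ℂ, IsH1Line u u' ∧ ∀ w w' : ℝ → ℂ, IsH1Line w w' →
      (∫ x, u' x * conj (w' x)) + m * ∫ x, u x * conj (w x) = ∫ x, g x * conj (w x) := by
  obtain ⟨c, hc0, hcm⟩ : ∃ c : ℝ, 0 < c ∧ c * c = m :=
    ⟨√m, Real.sqrt_pos.2 hm, Real.mul_self_sqrt hm.le⟩
  have hc : (c : ℂ) ≠ 0 := by exact_mod_cast hc0.ne'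
  have hcm' : (c : ℂ) * c = m := by exact_mod_cast hcm
  -- Encodes the constraint `a' = c b` for the unknowns `a = c u`, `b = u'`, where `c² = m`; then
  -- the norm of `(a, b)` is the energy norm. The projection of `(c⁻¹ g, 0, 0)` is the Riesz
  -- representative of the right-hand side, and the third slot is not used.
  let S : Set (LineL2 × LineL2 × LineL2) := {s | ∃ (φ : ℝ → ℝ) (h1 : ContDiff ℝ ∞ φ) (h2 : HasCompactSupport φ),
    s = ((memLp_deriv_line h1 h2).toLp _,
      (c : ℂ) • (memLp_line_of_continuous h1.continuous h2).toLp _, 0)}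
  have hS (a b z : LineL2) : (∀ s ∈ S, inner ℂ s.1 a + inner ℂ s.2.1 b + inner ℂ s.2.2 z = 0) ↔
      HasWeakDeriv Set.univ (1 : ℝ) a (fun x => c * b x) := by
    constructor
    · intro H φ h1 h2 _
      have := H _ ⟨φ, h1, h2, rfl⟩
      simp only [inner_zero_left, inner_smul_left, inner_toLp_line', Complex.conj_ofReal,
        add_zero] at this
      simp only [mul_assoc, setIntegral_univ, fderiv_apply_one_eq_deriv]
      rw [integral_const_mul]
      exact eq_neg_of_add_eq_zero_left this
    · rintro H s ⟨φ, h1, h2, rfl⟩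
      have := H φ h1 h2 (Set.subset_univ _)
      simp only [mul_assoc, setIntegral_univ, fderiv_apply_one_eq_deriv] at this
      rw [integral_const_mul] at this
      simp only [inner_zero_left, inner_smul_left, inner_toLp_line', Complex.conj_ofReal,
        add_zero]
      exact add_eq_zero_iff_eq_neg.2 this
  have hgc : MemLp (fun x => (c : ℂ)⁻¹ * g x) 2 := hg.const_mul _
  obtain ⟨a, b, z, habz, horth⟩ := exists_projection S (hgc.toLp _)
  have hab := (hS a b z).1 habz
  have hL (a : LineL2) : MemLp a 2 := Lp.memLp _
  refine ⟨fun x => (c : ℂ)⁻¹ * a x, b, ?_, fun w w' hw => ?_⟩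
  · have : IsH1Line a fun x => c * b x := ⟨hL a, (hL b).const_mul _, hab⟩
    exact (this.const_mul (c : ℂ)⁻¹).congr_deriv fun x => by field_simp
  · have hcw : MemLp (fun x => (c : ℂ) * w x) 2 := hw.memLp.const_mul _
    have key := horth (hcw.toLp _) (hw.memLp_deriv.toLp _) 0 <| by
      refine (hS _ _ _).2 fun φ h1 h2 h3 => ?_
      have e := (hw.const_mul (c : ℂ)).hasWeakDeriv φ h1 h2 h3
      simp only [setIntegral_univ] at e ⊢
      convert e using 1
      · refine integral_congr_ae ?_
        filter_upwards [hcw.coeFn_toLp] with x hx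
        rw [hx]
      · congr 1
        refine integral_congr_ae ?_
        filter_upwards [hw.memLp_deriv.coeFn_toLp] with x hx
        rw [hx]
    simp only [inner_toLp_line', inner_zero_left, add_zero, map_mul, Complex.conj_ofReal] at key
    have e1 : ∫ x, (hgc.toLp _ : LineL2) x * ((c : ℂ) * conj (w x)) = ∫ x, g x * conj (w x) := by
      refine integral_congr_ae ?_
      filter_upwards [hgc.coeFn_toLp] with x hx
      rw [hx]; field_simp
    rw [e1] at key
    rw [← key, ← hcm', add_comm, ← integral_const_mul]
    congr 2
    ext x; field_simp

/-- The weak solution belongs to `H²`. -/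
lemma isH1Line_deriv_of_weak_form {m : ℝ} {g u u' : ℝ → ℂ} (hg : MemLp g 2) (hu : IsH1Line u u')
    (h : ∀ w w' : ℝ → ℂ, IsH1Line w w' →
      (∫ x, u' x * conj (w' x)) + m * ∫ x, u x * conj (w x) = ∫ x, g x * conj (w x)) :
    IsH1Line u' fun x => m * u x - g x := by
  refine ⟨hu.memLp_deriv, (hu.memLp.const_mul _).sub hg, fun φ h1 h2 _ => ?_⟩
  have e := h _ _ (isH1Line_test h1 h2)
  simp only [Complex.conj_ofReal] at e
  simp only [fderiv_apply_one_eq_deriv, setIntegral_univ, sub_mul, mul_assoc]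
  rw [integral_sub ((integrable_line_mul_test hu.memLp h1.continuous h2).const_mul _)
    (integrable_line_mul_test hg h1.continuous h2), integral_const_mul, ← e]
  ring

lemma ae_eq_zero_of_integral_norm_sq {u : ℝ → ℂ} (hu : MemLp u 2) (h : ∫ x, ‖u x‖ ^ 2 ≤ 0) :
    u =ᵐ[volume] 0 := by
  have h0 : ∫ x, ‖u x‖ ^ 2 = 0 := le_antisymm h (integral_nonneg fun x => by positivity)
  rw [integral_eq_zero_iff_of_nonneg (fun x => by positivity) hu.integrable_norm_sq] at h0
  filter_upwards [h0] with x hx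
  simpa using hx

lemma integral_mul_conj_self {α : Type*} [MeasurableSpace α] {ν : Measure α} (u : α → ℂ) :
    ∫ x, u x * conj (u x) ∂ν = ((∫ x, ‖u x‖ ^ 2 ∂ν : ℝ) : ℂ) := by
  rw [← integral_complex_ofReal]
  congr 1; ext x; rw [Complex.mul_conj']; push_cast; rfl

/-- Uniqueness for `-u'' + m u = g` in `H²(ℝ)`. -/
lemma IsH2Line.ae_eq_of_eq {m : ℝ} (hm : 0 < m) {u u' u'' v v' v'' : ℝ → ℂ}
    (hu : IsH2Line u u' u'') (hv : IsH2Line v v' v'')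
    (h : ∀ᵐ x : ℝ, -u'' x + m * u x = -v'' x + m * v x) : u =ᵐ[volume] v := by
  have h1 := hu.1.sub hv.1
  have h2 := hu.2.sub hv.2
  -- The equation for the difference is multiplied by its conjugate; integration by parts turns the
  -- second derivative into a term of the opposite sign.
  have e := h2.integral_mul_deriv h1.conj
  have e2 : ∫ x, (u'' x - v'' x) * conj (u x - v x) = ∫ x, (m : ℂ) * ((u x - v x) * conj (u x - v x)) := by
    refine integral_congr_ae ?_
    filter_upwards [h] with x hx
    linear_combination -hx * conj (u x - v x)
  rw [e2, integral_const_mul, integral_mul_conj_self (fun x => u x - v x),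
    integral_mul_conj_self (fun x => u' x - v' x)] at e
  have e3 : m * ∫ x, ‖u x - v x‖ ^ 2 = -∫ x, ‖u' x - v' x‖ ^ 2 := by exact_mod_cast e
  have h4 : 0 ≤ ∫ x, ‖u' x - v' x‖ ^ 2 := integral_nonneg fun x => by positivity
  have h5 : ∫ x, ‖u x - v x‖ ^ 2 ≤ 0 := by
    by_contra! h6
    have := mul_pos hm h6
    linarith
  filter_upwards [ae_eq_zero_of_integral_norm_sq h1.memLp h5] with x hx
  exact sub_eq_zero.1 hx

lemma integral_norm_sub_sq_le {u v : ℝ → ℂ} (hu : MemLp u 2) (hv : MemLp v 2) :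
    ∫ x, ‖u x - v x‖ ^ 2 ≤ 2 * (∫ x, ‖u x‖ ^ 2) + 2 * ∫ x, ‖v x‖ ^ 2 := by
  rw [← integral_const_mul, ← integral_const_mul,
    ← integral_add (hu.integrable_norm_sq.const_mul _) (hv.integrable_norm_sq.const_mul _)]
  refine integral_mono (hu.sub hv).integrable_norm_sq
    ((hu.integrable_norm_sq.const_mul _).add (hv.integrable_norm_sq.const_mul _)) fun x => ?_
  have h1 := norm_sub_le (u x) (v x)
  have h2 : ‖u x - v x‖ ^ 2 ≤ (‖u x‖ + ‖v x‖) ^ 2 := by gcongr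
  simp only
  nlinarith [sq_nonneg (‖u x‖ - ‖v x‖)]

/-- Passage to the limit in the averaged equations. -/
theorem exists_limit_of_averaged_equations {ι : Type*} {l : Filter ι} {q b μ C : ℝ} (hq : 0 ≤ q)
    (hb : 0 ≤ b) (hμ : 0 < μ) {f₁ f₂ : ℝ → ℂ} (hf₁ : MemLp f₁ 2) (hf₂ : MemLp f₂ 2)
    {a a' c : ι → ℝ → ℂ} (ha : ∀ᶠ i in l, IsH1Line (a i) (a' i)) (hc : ∀ᶠ i in l, MemLp (c i) 2)
    (haC : ∀ᶠ i in l, ∫ x, ‖a i x‖ ^ 2 ≤ C) (haC' : ∀ᶠ i in l, ∫ x, ‖a' i x‖ ^ 2 ≤ C)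
    (hcC : ∀ᶠ i in l, ∫ x, ‖c i x‖ ^ 2 ≤ C)
    (h1 : ∀ φ : ℝ → ℝ, ContDiff ℝ ∞ φ → HasCompactSupport φ →
      Tendsto (fun i => (∫ x, a' i x * ((deriv φ x : ℝ) : ℂ))
        + ((μ + q * b : ℝ) : ℂ) * (∫ x, a i x * ((φ x : ℝ) : ℂ))
        - ((q * √b : ℝ) : ℂ) * ∫ x, c i x * ((φ x : ℝ) : ℂ)) l
        (𝓝 (∫ x, f₁ x * ((φ x : ℝ) : ℂ))))
    (h2 : ∀ φ : ℝ → ℝ, ContDiff ℝ ∞ φ → HasCompactSupport φ →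
      Tendsto (fun i => ((μ + q : ℝ) : ℂ) * (∫ x, c i x * ((φ x : ℝ) : ℂ))
        - ((q * √b : ℝ) : ℂ) * ∫ x, a i x * ((φ x : ℝ) : ℂ)) l
        (𝓝 (∫ x, f₂ x * ((φ x : ℝ) : ℂ)))) :
    ∃ u₁ u₂ : ℝ → ℂ,
      SolvesLimitProblem q b μ f₁ f₂ u₁ ∧
      (∀ v : ℝ → ℂ, SolvesLimitProblem q b μ f₁ f₂ v → v =ᵐ[volume] u₁) ∧
      (u₂ = fun x => ((q * √b / (q + μ) : ℝ) : ℂ) * u₁ x + ((1 / (q + μ) : ℝ) : ℂ) * f₂ x) ∧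
      WeakTendstoH1 l a u₁ ∧ WeakTendstoL2 l c u₂ ∧ IsLimitResolvent q b μ f₁ f₂ u₁ u₂ := by
  have hqμ : 0 < q + μ := by linarith
  -- The multiplier that eliminates `c`: the first identity plus `k` times the second has no `c`
  -- term because `k (q + μ) = q √b`. The coefficient of `a` becomes `m`.
  set k : ℝ := q * √b / (q + μ) with hk
  set m : ℝ := μ * (1 + q * b / (q + μ)) with hm
  have hm0 : 0 < m := by positivity
  have hsb : √b * √b = b := Real.mul_self_sqrt hb
  have hkμ : k * (q + μ) = q * √b := by rw [hk]; field_simp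
  have hkb : k * √b * (q + μ) = q * b := by
    calc k * √b * (q + μ) = k * (q + μ) * √b := by ring
      _ = q * b := by rw [hkμ, mul_assoc, hsb]
  have hmk : m = μ + q * b - k * (q * √b) := by
    have e : (m - (μ + q * b - k * (q * √b))) * (q + μ) = 0 := by
      have : m * (q + μ) = μ * (q + μ + q * b) := by rw [hm]; field_simp
      linear_combination this + q * hkb
    rcases mul_eq_zero.1 e with e | e <;> linarith
  set g : ℝ → ℂ := fun x => f₁ x + (k : ℂ) * f₂ x with hg
  have hgL : MemLp g 2 := hf₁.add (hf₂.const_mul _)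
  obtain ⟨u, u', hu, hug⟩ := exists_weak_solution hm0 hgL
  have hu2 := isH1Line_deriv_of_weak_form hgL hu hug
  have hH2 : IsH2Line u u' fun x => m * u x - g x := ⟨hu, hu2⟩
  set u₂ : ℝ → ℂ := fun x => (k : ℂ) * u x + ((1 / (q + μ) : ℝ) : ℂ) * f₂ x with hu₂
  have hu₂L : MemLp u₂ 2 := (hu.memLp.const_mul _).add (hf₂.const_mul _)
  have hD : ∀ᶠ i in l, IsH1Line (fun x => a i x - u x) (fun x => a' i x - u' x) :=
    ha.mono fun i hi => hi.sub hu
  set K : ℝ := 2 * C + 2 * (∫ x, ‖u x‖ ^ 2) + 2 * ∫ x, ‖u' x‖ ^ 2 with hK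
  have hu0 : 0 ≤ ∫ x, ‖u x‖ ^ 2 := integral_nonneg fun x => by positivity
  have hu'0 : 0 ≤ ∫ x, ‖u' x‖ ^ 2 := integral_nonneg fun x => by positivity
  have hDC : ∀ᶠ i in l, ∫ x, ‖a i x - u x‖ ^ 2 ≤ K := by
    filter_upwards [ha, haC] with i h1 h2
    have := integral_norm_sub_sq_le h1.memLp hu.memLp
    linarith
  have hDC' : ∀ᶠ i in l, ∫ x, ‖a' i x - u' x‖ ^ 2 ≤ K := by
    filter_upwards [ha, haC'] with i h1 h2
    have := integral_norm_sub_sq_le h1.memLp_deriv hu.memLp_deriv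
    linarith
  -- The difference `a - u` satisfies the homogeneous form equation in the limit, first against test
  -- functions and then, by boundedness and density, against all of `H¹(ℝ)`.
  have hform (w w' : ℝ → ℂ) (hw : IsH1Line w w') : Tendsto (fun i =>
      (m : ℂ) * (∫ x, (a i x - u x) * conj (w x)) + ∫ x, (a' i x - u' x) * conj (w' x)) l
      (𝓝 0) := by
    have key := tendsto_form_of_test (l := l) (G := fun i x => (m : ℂ) * (a i x - u x))
      (K := fun i x => a' i x - u' x) (C := m ^ 2 * K + K) (hD.mono fun i hi => hi.memLp.const_mul _)
      (hD.mono fun i hi => hi.memLp_deriv)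
      (by
        filter_upwards [hDC, hDC'] with i hi hi'
        have h0 : 0 ≤ ∫ x, ‖a' i x - u' x‖ ^ 2 := integral_nonneg fun x => by positivity
        simp only [norm_mul, mul_pow, integral_const_mul, Complex.norm_real, Real.norm_eq_abs,
          sq_abs]
        have := mul_le_mul_of_nonneg_left hi (sq_nonneg m)
        linarith)
      (by
        filter_upwards [hDC, hDC'] with i hi hi'
        have h0 : 0 ≤ ∫ x, ‖a i x - u x‖ ^ 2 := integral_nonneg fun x => by positivity
        have := mul_nonneg (sq_nonneg m) (h0.trans hi)
        linarith)
      (by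
        intro φ p1 p2
        -- The elimination of `c`, followed by subtraction of the weak equation of `u`.
        have t1 := (h1 φ p1 p2).add ((h2 φ p1 p2).const_mul (k : ℂ))
        have t2 := t1.sub_const ((∫ x, f₁ x * ((φ x : ℝ) : ℂ)) + k * ∫ x, f₂ x * ((φ x : ℝ) : ℂ))
        rw [sub_self] at t2
        refine t2.congr' ?_
        filter_upwards [ha] with i hi
        have e := hug _ _ (isH1Line_test p1 p2)
        simp only [Complex.conj_ofReal, hg, add_mul, mul_assoc] at e
        rw [integral_add (integrable_line_mul_test hf₁ p1.continuous p2)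
          ((integrable_line_mul_test hf₂ p1.continuous p2).const_mul _), integral_const_mul] at e
        have p3 := p1.continuous_deriv (by simp)
        simp only [mul_assoc, sub_mul]
        rw [integral_const_mul, integral_sub (integrable_line_mul_test hi.memLp p1.continuous p2)
          (integrable_line_mul_test hu.memLp p1.continuous p2),
          integral_sub (integrable_line_mul_test hi.memLp_deriv p3 p2.deriv)
          (integrable_line_mul_test hu.memLp_deriv p3 p2.deriv), ← e]
        have c1 : (k : ℂ) * (q + μ) = ((q * √b : ℝ) : ℂ) := by exact_mod_cast hkμ
        have c2 : (m : ℂ) = ((μ + q * b : ℝ) : ℂ) - k * ((q * √b : ℝ) : ℂ) := by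
          exact_mod_cast hmk
        push_cast at c1 c2 ⊢
        linear_combination (∫ x, c i x * ((φ x : ℝ) : ℂ)) * c1
          - (∫ x, a i x * ((φ x : ℝ) : ℂ)) * c2) hw
    refine key.congr fun i => ?_
    simp only [mul_assoc]
    rw [integral_const_mul]
  -- The form is Hermitian, so the equation solved by `z` may be read as an identity for its
  -- argument `w`.
  have hdual (g' z z' : ℝ → ℂ) (hz : ∀ w w' : ℝ → ℂ, IsH1Line w w' →
      (∫ x, z' x * conj (w' x)) + m * ∫ x, z x * conj (w x) = ∫ x, g' x * conj (w x))
      (w w' : ℝ → ℂ) (hw : IsH1Line w w') :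
      (m : ℂ) * (∫ x, w x * conj (z x)) + ∫ x, w' x * conj (z' x) = ∫ x, w x * conj (g' x) := by
    have e := congrArg conj (hz w w' hw)
    rw [map_add, map_mul, ← integral_conj, ← integral_conj, ← integral_conj,
      Complex.conj_ofReal] at e
    simp only [map_mul, Complex.conj_conj, mul_comm (conj _)] at e
    rw [← e, add_comm]
  have hweak (w : ℝ → ℂ) (hw : MemLp w 2) :
      Tendsto (fun i => ∫ x, (a i x - u x) * conj (w x)) l (𝓝 0) := by
    -- For an arbitrary `w ∈ L₂`, the solution `z` of the same equation with right-hand side `w` is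
    -- an admissible test function, and the form evaluated at it is the scalar product with `w`.
    obtain ⟨z, z', hz, hzw⟩ := exists_weak_solution hm0 hw
    refine (hform z z' hz).congr' ?_
    filter_upwards [hD] with i hi
    exact hdual w z z' hzw _ _ hi
  have hweakH1 : WeakTendstoH1 l a u := by
    refine ⟨a', u', ha, hu, fun v v' hv => ?_⟩
    -- The form and the `H¹` scalar product differ by the factor `m` in the `L₂` part, which
    -- converges separately.
    have t := (hform v v' hv).add ((hweak v hv.memLp).const_mul (1 - m : ℂ))
    rw [mul_zero, add_zero] at t
    refine tendsto_sub_nhds_zero_iff.1 (t.congr' ?_)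
    filter_upwards [ha] with i hi
    simp only [sub_mul]
    rw [integral_add (integrable_mul_conj_line hi.memLp hv.memLp)
      (integrable_mul_conj_line hi.memLp_deriv hv.memLp_deriv),
      integral_add (integrable_mul_conj_line hu.memLp hv.memLp)
      (integrable_mul_conj_line hu.memLp_deriv hv.memLp_deriv),
      integral_sub (integrable_mul_conj_line hi.memLp hv.memLp)
      (integrable_mul_conj_line hu.memLp hv.memLp),
      integral_sub (integrable_mul_conj_line hi.memLp_deriv hv.memLp_deriv)
      (integrable_mul_conj_line hu.memLp_deriv hv.memLp_deriv)]
    ring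
  have hcw : WeakTendstoL2 l c u₂ := by
    refine ⟨hc, hu₂L, fun v hv => ?_⟩
    have key := tendsto_integral_of_test (l := l) (G := fun i x => c i x - u₂ x)
      (C := 2 * C + 2 * ∫ x, ‖u₂ x‖ ^ 2) (hc.mono fun i hi => hi.sub hu₂L)
      (by
        filter_upwards [hc, hcC] with i hi hi'
        have := integral_norm_sub_sq_le hi hu₂L
        linarith)
      (by
        intro φ p1 p2
        have t1 := (hweak _ (memLp_line_of_continuous p1.continuous p2)).const_mul
          ((q * √b : ℝ) : ℂ)
        have t2 := ((h2 φ p1 p2).sub_const (∫ x, f₂ x * ((φ x : ℝ) : ℂ))).add t1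
        -- The second identity is solved for `c`, now that the weak limit of `a` is known.
        have t3 := t2.const_mul (((q + μ)⁻¹ : ℝ) : ℂ)
        simp only [sub_self, mul_zero, add_zero] at t3
        refine t3.congr' ?_
        filter_upwards [ha, hc] with i hi hi'
        have J : Integrable fun x => (k : ℂ) * (u x * ((φ x : ℝ) : ℂ))
            + ((1 / (q + μ) : ℝ) : ℂ) * (f₂ x * ((φ x : ℝ) : ℂ)) :=
          ((integrable_line_mul_test hu.memLp p1.continuous p2).const_mul _).add
            ((integrable_line_mul_test hf₂ p1.continuous p2).const_mul _)
        simp only [sub_mul, Complex.conj_ofReal, hu₂, add_mul, mul_assoc]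
        rw [integral_sub (integrable_line_mul_test hi.memLp p1.continuous p2)
          (integrable_line_mul_test hu.memLp p1.continuous p2),
          integral_sub (integrable_line_mul_test hi' p1.continuous p2) J,
          integral_add ((integrable_line_mul_test hu.memLp p1.continuous p2).const_mul _)
            ((integrable_line_mul_test hf₂ p1.continuous p2).const_mul _),
          integral_const_mul, integral_const_mul]
        have c0 : ((q : ℂ) + μ) ≠ 0 := by exact_mod_cast hqμ.ne'
        rw [hk]
        push_cast
        field_simp
        ring) hv
    refine tendsto_sub_nhds_zero_iff.1 (key.congr' ?_)
    filter_upwards [hc] with i hi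
    simp only [sub_mul]
    rw [integral_sub (integrable_mul_conj_line hi hv) (integrable_mul_conj_line hu₂L hv)]
  refine ⟨u, u₂, ⟨u', _, hH2, ?_⟩, ?_, rfl, hweakH1, hcw, ?_⟩
  · refine Eventually.of_forall fun x => ?_
    simp only [hg]
    ring
  · rintro v ⟨v', v'', hv, hvg⟩
    refine hv.ae_eq_of_eq hm0 hH2 ?_
    filter_upwards [hvg] with x hx
    rw [hx]
    simp only [hg]
    ring
  · refine ⟨fun x => f₁ x - μ * u x, fun x => f₂ x - μ * u₂ x,
      ⟨hu₂L, u', _, hH2, Eventually.of_forall fun x => ?_, Eventually.of_forall fun x => ?_⟩,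
      Eventually.of_forall fun x => by ring, Eventually.of_forall fun x => by ring⟩
    · have c2 : (m : ℂ) = ((μ + q * b : ℝ) : ℂ) - k * ((q * √b : ℝ) : ℂ) := by
        exact_mod_cast hmk
      have c3 : ((q * √b : ℝ) : ℂ) * ((1 / (q + μ) : ℝ) : ℂ) = k := by
        rw [hk, ← Complex.ofReal_mul]; congr 1; ring
      simp only [hg, hu₂]
      push_cast at c2 c3 ⊢
      linear_combination u x * c2 + f₂ x * c3
    · have c1 : (k : ℂ) * (q + μ) = ((q * √b : ℝ) : ℂ) := by exact_mod_cast hkμ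
      have c4 : ((1 / (q + μ) : ℝ) : ℂ) * (q + μ) = 1 := by
        have : 1 / (q + μ) * (q + μ) = 1 := by field_simp
        exact_mod_cast this
      simp only [hu₂]
      linear_combination -u x * c1 - f₂ x * c4

/-! ### The test functions -/

/-- The centre of the period cell of a point of the line. -/
noncomputable def nearestCenter (ε x : ℝ) : ℝ := cellCenter ε ⌊x / ε⌋

/-- The piecewise linear function which is `0` below `0` and `1` above `h`. -/
noncomputable def ramp (h y : ℝ) : ℝ := max 0 (min 1 (y / h))

lemma floor_div_eq {ε x : ℝ} (hε : 0 < ε) {j : ℤ} (hx : |x - cellCenter ε j| < ε / 2) :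
    ⌊x / ε⌋ = j := by
  rw [abs_lt, cellCenter] at hx
  rw [Int.floor_eq_iff, le_div_iff₀ hε, div_lt_iff₀ hε]
  constructor <;> nlinarith

lemma nearestCenter_eq {ε x : ℝ} (hε : 0 < ε) {j : ℤ} (hx : |x - cellCenter ε j| < ε / 2) :
    nearestCenter ε x = cellCenter ε j := by rw [nearestCenter, floor_div_eq hε hx]

lemma abs_nearestCenter_sub_le {ε : ℝ} (hε : 0 < ε) (x : ℝ) :
    |nearestCenter ε x - x| ≤ ε / 2 := by
  have h1 := Int.floor_le (x / ε)
  have h2 := (Int.lt_floor_add_one (x / ε)).le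
  rw [le_div_iff₀ hε] at h1
  rw [div_le_iff₀ hε] at h2
  rw [nearestCenter, cellCenter, abs_le]
  constructor <;> nlinarith

lemma measurable_nearestCenter (ε : ℝ) : Measurable (nearestCenter ε) := by
  have h1 : Measurable fun x : ℝ => ⌊x / ε⌋ := (measurable_id.div_const ε).floor
  exact (measurable_from_top (f := fun j : ℤ => cellCenter ε j)).comp h1

lemma ramp_nonneg (h y : ℝ) : 0 ≤ ramp h y := le_max_left _ _

lemma ramp_le_one (h y : ℝ) : ramp h y ≤ 1 := max_le zero_le_one (min_le_left _ _)

lemma continuous_ramp (h : ℝ) : Continuous (ramp h) := by unfold ramp; fun_prop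

lemma ramp_of_nonpos {h y : ℝ} (hh : 0 < h) (hy : y ≤ 0) : ramp h y = 0 :=
  max_eq_left ((min_le_right _ _).trans (div_nonpos_of_nonpos_of_nonneg hy hh.le))

lemma ramp_of_ge {h y : ℝ} (hh : 0 < h) (hy : h ≤ y) : ramp h y = 1 := by
  rw [ramp, min_eq_left ((one_le_div hh).2 hy), max_eq_right zero_le_one]

lemma ramp_of_mem {h y : ℝ} (hh : 0 < h) (hy : 0 ≤ y) (hy' : y ≤ h) : ramp h y = y / h := by
  rw [ramp, min_eq_right ((div_le_one hh).2 hy'), max_eq_right (by positivity)]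

lemma hasDerivAt_ramp {h y : ℝ} (hh : 0 < h) (h0 : y ≠ 0) (h1 : y ≠ h) :
    HasDerivAt (ramp h) (if 0 ≤ y ∧ y ≤ h then h⁻¹ else 0) y := by
  rcases lt_or_gt_of_ne h0 with hy | hy
  · rw [if_neg (by rintro ⟨h2, -⟩; linarith)]
    refine (hasDerivAt_const y (0 : ℝ)).congr_of_eventuallyEq ?_
    filter_upwards [Iio_mem_nhds hy] with z hz using ramp_of_nonpos hh (le_of_lt hz)
  rcases lt_or_gt_of_ne h1 with hy1 | hy1
  · rw [if_pos ⟨hy.le, hy1.le⟩]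
    have : HasDerivAt (fun z : ℝ => z / h) h⁻¹ y := by
      simpa using (hasDerivAt_id y).div_const h
    refine this.congr_of_eventuallyEq ?_
    filter_upwards [Ioo_mem_nhds hy hy1] with z hz using ramp_of_mem hh hz.1.le hz.2.le
  · rw [if_neg (by rintro ⟨-, h2⟩; linarith)]
    refine (hasDerivAt_const y (1 : ℝ)).congr_of_eventuallyEq ?_
    filter_upwards [Ioi_mem_nhds hy1] with z hz using ramp_of_ge hh (le_of_lt hz)

/-- Equal to `φ₁` in the strip and to the value of `φ₂` at the centre of the cell in the rooms. -/
noncomputable def testFun (ε h : ℝ) (φ₁ φ₂ : ℝ → ℝ) (x : ℝ × ℝ) : ℝ :=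
  φ₁ x.1 * (1 - ramp h x.2) + φ₂ (nearestCenter ε x.1) * ramp h x.2

/-- No derivative of `φ₂` appears: wherever `ramp` is non-zero in the waveguide, `nearestCenter` is
locally constant. -/
noncomputable def testFunFst (h : ℝ) (φ₁ : ℝ → ℝ) (x : ℝ × ℝ) : ℝ :=
  deriv φ₁ x.1 * (1 - ramp h x.2)

/-- The slope is supported on the closed range of heights of a passage, which matches `passage`
exactly and misses strip and rooms. -/
noncomputable def testFunSnd (ε h : ℝ) (φ₁ φ₂ : ℝ → ℝ) (x : ℝ × ℝ) : ℝ :=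
  (φ₂ (nearestCenter ε x.1) - φ₁ x.1) * (if 0 ≤ x.2 ∧ x.2 ≤ h then h⁻¹ else 0)

section TestFun

variable {B : Set (ℝ × ℝ)} {ε d h M A : ℝ} {φ₁ φ₂ : ℝ → ℝ}

lemma measurable_testFun (h1 : Continuous φ₁) (h2 : Continuous φ₂) :
    Measurable (testFun ε h φ₁ φ₂) := by
  unfold testFun
  have e1 := h1.measurable
  have e2 := h2.measurable.comp ((measurable_nearestCenter ε).comp
    (measurable_fst : Measurable (Prod.fst : ℝ × ℝ → ℝ)))
  have e3 : Measurable fun x : ℝ × ℝ => ramp h x.2 := (continuous_ramp h).measurable.comp measurable_snd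
  exact ((e1.comp measurable_fst).mul (measurable_const.sub e3)).add (e2.mul e3)

lemma measurable_testFunFst (h1 : Continuous (deriv φ₁)) : Measurable (testFunFst h φ₁) := by
  unfold testFunFst
  have e3 : Measurable fun x : ℝ × ℝ => ramp h x.2 := (continuous_ramp h).measurable.comp measurable_snd
  exact (h1.measurable.comp measurable_fst).mul (measurable_const.sub e3)

lemma measurable_testFunSnd (h1 : Continuous φ₁) (h2 : Continuous φ₂) :
    Measurable (testFunSnd ε h φ₁ φ₂) := by
  unfold testFunSnd
  have e2 := h2.measurable.comp ((measurable_nearestCenter ε).comp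
    (measurable_fst : Measurable (Prod.fst : ℝ × ℝ → ℝ)))
  refine (e2.sub (h1.measurable.comp measurable_fst)).mul (Measurable.ite ?_ measurable_const
    measurable_const)
  exact (measurableSet_le measurable_const measurable_snd).inter
    (measurableSet_le measurable_snd measurable_const)

lemma abs_testFun_le (h1 : ∀ x, |φ₁ x| ≤ M) (h2 : ∀ x, |φ₂ x| ≤ M) (x : ℝ × ℝ) :
    |testFun ε h φ₁ φ₂ x| ≤ M := by
  have r0 := ramp_nonneg h x.2
  have r1 := ramp_le_one h x.2
  rw [testFun]
  refine (abs_add_le _ _).trans ?_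
  rw [abs_mul, abs_mul, abs_of_nonneg r0, abs_of_nonneg (sub_nonneg.2 r1)]
  nlinarith [h1 x.1, h2 (nearestCenter ε x.1)]

lemma abs_testFunFst_le (h1 : ∀ x, |deriv φ₁ x| ≤ M) (x : ℝ × ℝ) : |testFunFst h φ₁ x| ≤ M := by
  have r0 := ramp_nonneg h x.2
  have r1 := ramp_le_one h x.2
  rw [testFunFst, abs_mul, abs_of_nonneg (sub_nonneg.2 r1)]
  nlinarith [h1 x.1, abs_nonneg (deriv φ₁ x.1)]

lemma abs_testFunSnd_le (hh : 0 < h) (h1 : ∀ x, |φ₁ x| ≤ M) (h2 : ∀ x, |φ₂ x| ≤ M) (x : ℝ × ℝ) :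
    |testFunSnd ε h φ₁ φ₂ x| ≤ 2 * M * h⁻¹ := by
  have hM := (abs_nonneg _).trans (h1 0)
  have e : |φ₂ (nearestCenter ε x.1) - φ₁ x.1| ≤ 2 * M := by
    refine (abs_sub _ _).trans ?_
    linarith [h1 x.1, h2 (nearestCenter ε x.1)]
  rw [testFunSnd, abs_mul]
  split_ifs
  · rw [abs_of_pos (inv_pos.2 hh)]; gcongr
  · simp only [abs_zero, mul_zero]; positivity

/-- A point of the waveguide is in the strip or in the interior of a period cell. -/
lemma IsRoom.waveguide_cases (hB : IsRoom B) (hε : 0 < ε) (hdε : d ≤ ε) {x : ℝ × ℝ}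
    (hx : x ∈ waveguide B ε d h) : x.2 < 0 ∨ ∃ j : ℤ, |x.1 - cellCenter ε j| < ε / 2 := by
  rcases hx with hx | hx
  · exact Or.inl hx.2
  · obtain ⟨j, hx | hx⟩ := Set.mem_iUnion.1 hx
    · exact Or.inr ⟨j, (hB.mem_room hε hx).1⟩
    · exact Or.inr ⟨j, hx.1.trans_le (by linarith)⟩

/-- The exceptional set accommodates the kinks of `ramp` at heights `0` and `h`. -/
lemma integral_eq_zero_of_hasDerivAt_off_countable {F F' : ℝ → ℝ} {S : Set ℝ} (hS : S.Countable)
    (hF : Continuous F) (hd : ∀ x, x ∉ S → HasDerivAt F (F' x) x) (hi : Integrable F') {R : ℝ}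
    (hR : ∀ x, R ≤ |x| → F x = 0 ∧ F' x = 0) : ∫ x, F' x = 0 := by
  have key := integral_eq_of_hasDerivAt_off_countable F F' (a := -|R|) (b := |R|) hS
    hF.continuousOn (fun x hx => hd x hx.2) hi.intervalIntegrable
  rw [(hR |R| (by rw [abs_abs]; exact le_abs_self R)).1,
    (hR (-|R|) (by rw [abs_neg, abs_abs]; exact le_abs_self R)).1, sub_zero,
    intervalIntegral.integral_eq_integral_of_support_subset] at key
  · exact key
  · intro x hx
    by_contra hc
    refine hx (hR x ?_).2
    rw [Set.mem_Ioc, not_and_or, not_lt, not_le] at hc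
    rcases hc with hc | hc
    · exact (le_abs_self R).trans ((by linarith : |R| ≤ -x).trans (neg_le_abs x))
    · exact (le_abs_self R).trans (hc.le.trans (le_abs_self x))

lemma integrable_mul_test_of_bounded {f : ℝ × ℝ → ℝ} (hf : Measurable f) (hM : ∀ x, |f x| ≤ M)
    {ψ : ℝ × ℝ → ℝ} (hc : Continuous ψ) (hs : HasCompactSupport ψ) :
    Integrable fun x => f x * ψ x :=
  (hc.integrable_of_hasCompactSupport hs).bdd_mul hf.aestronglyMeasurable
    (Eventually.of_forall hM)

/-- Reduces a weak derivative to one real integral, whose integrand will be the classical derivative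
of the product `v φ` along lines. -/
lemma hasWeakDeriv_ofReal {Ω : Set (ℝ × ℝ)} {e : ℝ × ℝ} {v g : ℝ × ℝ → ℝ} {Mv Mg : ℝ}
    (hv : Measurable v) (hg : Measurable g) (hMv : ∀ x, |v x| ≤ Mv) (hMg : ∀ x, |g x| ≤ Mg)
    (H : ∀ φ : ℝ × ℝ → ℝ, ContDiff ℝ ∞ φ → HasCompactSupport φ → tsupport φ ⊆ Ω →
      Integrable (fun x => v x * fderiv ℝ φ x e + g x * φ x) →
      ∫ x, (v x * fderiv ℝ φ x e + g x * φ x) = 0) :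
    HasWeakDeriv Ω e (fun x => ((v x : ℝ) : ℂ)) (fun x => ((g x : ℝ) : ℂ)) := by
  rw [hasWeakDeriv_iff]
  intro φ h1 h2 h3
  have hc : Continuous fun x => fderiv ℝ φ x e :=
    (h1.continuous_fderiv (by simp)).clm_apply continuous_const
  have hs : HasCompactSupport fun x => fderiv ℝ φ x e := h2.fderiv_apply ℝ e
  have i1 := integrable_mul_test_of_bounded hv hMv hc hs
  have i2 := integrable_mul_test_of_bounded hg hMg h1.continuous h2
  have key := H φ h1 h2 h3 (i1.add i2)
  rw [integral_add i1 i2] at key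
  simp only [← Complex.ofReal_mul, integral_complex_ofReal]
  rw [← Complex.ofReal_neg]
  congr 1
  linarith

lemma exists_bound_of_test {φ : ℝ × ℝ → ℝ} (h2 : HasCompactSupport φ) :
    ∃ R : ℝ, ∀ x y : ℝ, (R ≤ |x| ∨ R ≤ |y|) → (x, y) ∉ tsupport φ := by
  obtain ⟨R, hR⟩ := h2.isCompact.isBounded.subset_closedBall (0 : ℝ × ℝ)
  refine ⟨R + 1, fun x y hxy hm => ?_⟩
  have := mem_closedBall_zero_iff.1 (hR hm)
  rw [Prod.norm_def, max_le_iff, Real.norm_eq_abs, Real.norm_eq_abs] at this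
  rcases hxy with h | h <;> simp at this <;> linarith

lemma zero_of_notMem_tsupport {φ : ℝ × ℝ → ℝ} {x : ℝ × ℝ} (hx : x ∉ tsupport φ) :
    φ x = 0 ∧ fderiv ℝ φ x = 0 := by
  refine ⟨image_eq_zero_of_notMem_tsupport hx, ?_⟩
  by_contra h0
  exact hx (support_fderiv_subset ℝ h0)

/-- The jumps of `nearestCenter` lie on the lines between cells, where the waveguide consists of the
strip only and `ramp` vanishes. So along horizontal lines the product with a test function is
differentiable everywhere. -/
lemma IsRoom.hasWeakDeriv_testFun_fst (hB : IsRoom B) (hε : 0 < ε) (hh : 0 < h) (hdε : d ≤ ε)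
    (h1 : ContDiff ℝ ∞ φ₁) (h2 : Continuous φ₂) (hM1 : ∀ x, |φ₁ x| ≤ M)
    (hM1' : ∀ x, |deriv φ₁ x| ≤ M) (hM2 : ∀ x, |φ₂ x| ≤ M) :
    HasWeakDeriv (waveguide B ε d h) ((1, 0) : ℝ × ℝ)
      (fun x => ((testFun ε h φ₁ φ₂ x : ℝ) : ℂ)) (fun x => ((testFunFst h φ₁ x : ℝ) : ℂ)) := by
  refine hasWeakDeriv_ofReal (measurable_testFun h1.continuous h2)
    (measurable_testFunFst (h1.continuous_deriv (by simp))) (abs_testFun_le hM1 hM2)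
    (abs_testFunFst_le hM1') fun φ p1 p2 p3 hi => ?_
  rw [Measure.volume_eq_prod] at hi ⊢
  rw [integral_prod_symm _ hi]
  obtain ⟨R, hR⟩ := exists_bound_of_test p2
  refine integral_eq_zero_of_ae ?_
  filter_upwards [hi.prod_left_ae] with y hy
  simp only [Pi.zero_apply]
  have hder (x : ℝ) : HasDerivAt (fun x => testFun ε h φ₁ φ₂ (x, y) * φ (x, y))
      (testFun ε h φ₁ φ₂ (x, y) * fderiv ℝ φ (x, y) (1, 0) + testFunFst h φ₁ (x, y) * φ (x, y))
      x := by
    by_cases hx : (x, y) ∈ tsupport φ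
    · have d1 : HasDerivAt (fun x => φ (x, y)) (fderiv ℝ φ (x, y) (1, 0)) x :=
        ((p1.differentiable (by simp)).differentiableAt.hasFDerivAt).comp_hasDerivAt x
          ((hasDerivAt_id x).prodMk (hasDerivAt_const x y))
      have d2 : HasDerivAt (fun x => testFun ε h φ₁ φ₂ (x, y)) (testFunFst h φ₁ (x, y)) x := by
        have d3 : HasDerivAt (fun x => φ₁ x * (1 - ramp h y)) (testFunFst h φ₁ (x, y)) x :=
          ((h1.differentiable (by simp)) x).hasDerivAt.mul_const _
        rcases hB.waveguide_cases hε hdε (p3 hx) with h0 | ⟨j, hj⟩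
        · refine d3.congr_of_eventuallyEq (Eventually.of_forall fun z => ?_)
          simp [testFun, ramp_of_nonpos hh (le_of_lt h0)]
        · refine (d3.add_const (φ₂ (cellCenter ε j) * ramp h y)).congr_of_eventuallyEq ?_
          have : ∀ᶠ z in 𝓝 x, |z - cellCenter ε j| < ε / 2 :=
            (isOpen_lt (continuous_id.sub continuous_const).abs continuous_const).mem_nhds hj
          filter_upwards [this] with z hz
          simp [testFun, nearestCenter_eq hε hz]
      refine (d2.mul d1).congr_deriv ?_
      ring
    · obtain ⟨e1, e2⟩ := zero_of_notMem_tsupport hx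
      rw [e1, e2]
      simp only [zero_apply, mul_zero, add_zero]
      refine (hasDerivAt_const x (0 : ℝ)).congr_of_eventuallyEq ?_
      have : ∀ᶠ z in 𝓝 x, (z, y) ∉ tsupport φ :=
        (Continuous.prodMk_left y).continuousAt.eventually
          ((isClosed_tsupport φ).isOpen_compl.mem_nhds hx)
      filter_upwards [this] with z hz
      simp [(zero_of_notMem_tsupport hz).1]
  refine integral_eq_zero_of_hasDerivAt_off_countable Set.countable_empty
    (continuous_iff_continuousAt.2 fun x => (hder x).continuousAt) (fun x _ => hder x) hy (R := R)
    fun x hx => ?_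
  obtain ⟨e1, e2⟩ := zero_of_notMem_tsupport (hR x y (Or.inl hx))
  simp [e1, e2]

/-- On vertical lines the function is continuous and piecewise linear, so no condition on the set is
needed. -/
lemma hasWeakDeriv_testFun_snd (Ω : Set (ℝ × ℝ)) (hh : 0 < h)
    (h1 : Continuous φ₁) (h2 : Continuous φ₂) (hM1 : ∀ x, |φ₁ x| ≤ M) (hM2 : ∀ x, |φ₂ x| ≤ M) :
    HasWeakDeriv Ω ((0, 1) : ℝ × ℝ)
      (fun x => ((testFun ε h φ₁ φ₂ x : ℝ) : ℂ)) (fun x => ((testFunSnd ε h φ₁ φ₂ x : ℝ) : ℂ)) := by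
  refine hasWeakDeriv_ofReal (measurable_testFun h1 h2)
    (measurable_testFunSnd h1 h2) (abs_testFun_le hM1 hM2)
    (abs_testFunSnd_le hh hM1 hM2) fun φ p1 p2 p3 hi => ?_
  rw [Measure.volume_eq_prod] at hi ⊢
  rw [integral_prod _ hi]
  obtain ⟨R, hR⟩ := exists_bound_of_test p2
  refine integral_eq_zero_of_ae ?_
  filter_upwards [hi.prod_right_ae] with x hx
  simp only [Pi.zero_apply]
  have hcs : Continuous fun y => φ (x, y) := p1.continuous.comp (by fun_prop)
  have hct : Continuous fun y => testFun ε h φ₁ φ₂ (x, y) := by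
    have := continuous_ramp h
    simp only [testFun]
    fun_prop
  refine integral_eq_zero_of_hasDerivAt_off_countable (S := {0, h})
    (F := fun y => testFun ε h φ₁ φ₂ (x, y) * φ (x, y)) (Set.toFinite _).countable
    (hct.mul hcs) (fun y hy => ?_) hx (R := R) fun y hy => ?_
  · rw [Set.mem_insert_iff, Set.mem_singleton_iff, not_or] at hy
    have d1 : HasDerivAt (fun y => φ (x, y)) (fderiv ℝ φ (x, y) (0, 1)) y :=
      ((p1.differentiable (by simp)).differentiableAt.hasFDerivAt).comp_hasDerivAt y
        ((hasDerivAt_const y x).prodMk (hasDerivAt_id y))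
    have d2 := hasDerivAt_ramp hh hy.1 hy.2
    have d3 : HasDerivAt (fun y => testFun ε h φ₁ φ₂ (x, y)) (testFunSnd ε h φ₁ φ₂ (x, y)) y := by
      refine (((d2.const_sub 1).const_mul (φ₁ x)).add
        (d2.const_mul (φ₂ (nearestCenter ε x)))).congr_deriv ?_
      simp only [testFunSnd]
      ring
    refine (d3.mul d1).congr_deriv ?_
    ring
  · obtain ⟨e1, e2⟩ := zero_of_notMem_tsupport (hR x y (Or.inr hy))
    simp [e1, e2]

lemma memLp_of_bounded_of_support {Ω K : Set (ℝ × ℝ)} (hK : MeasurableSet K)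
    (hf : volume (K ∩ Ω) ≠ ⊤) {v : ℝ × ℝ → ℝ} (hv : Measurable v) (hM : ∀ x, |v x| ≤ M)
    (hs : ∀ x, x ∉ K → v x = 0) : MemLp (fun x => ((v x : ℝ) : ℂ)) 2 (volume.restrict Ω) := by
  have e : (fun x => ((v x : ℝ) : ℂ)) = K.indicator fun x => ((v x : ℝ) : ℂ) := by
    ext x
    by_cases hx : x ∈ K
    · rw [Set.indicator_of_mem hx]
    · rw [Set.indicator_of_notMem hx, hs x hx, Complex.ofReal_zero]
  rw [e, memLp_indicator_iff_restrict hK, Measure.restrict_restrict hK]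
  have : IsFiniteMeasure (volume.restrict (K ∩ Ω)) := ⟨by simpa using hf.lt_top⟩
  exact MemLp.of_bound (Complex.measurable_ofReal.comp hv).aestronglyMeasurable M
    (Eventually.of_forall fun x => by simpa using hM x)

/-- Bounds the waveguide vertically, so that bounded functions with bounded support in `x₁` are
square integrable on it. -/
lemma IsRoom.exists_height (hB : IsRoom B) : ∃ D : ℝ, 0 < D ∧ ∀ (ε d h : ℝ), 0 < ε → 0 < h →
    ∀ x ∈ waveguide B ε d h, -ε < x.2 ∧ x.2 ≤ h + ε * D := by
  obtain ⟨D, hD⟩ := hB.isBounded.subset_closedBall (0 : ℝ × ℝ)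
  refine ⟨max D 1, lt_max_of_lt_right one_pos, fun ε d h hε hh x hx => ?_⟩
  have hp : 0 < ε * max D 1 := mul_pos hε (lt_max_of_lt_right one_pos)
  rcases hx with hx | hx
  · exact ⟨hx.1, by linarith [hx.2]⟩
  · obtain ⟨j, hx | hx⟩ := Set.mem_iUnion.1 hx
    · refine ⟨by linarith [(hB.mem_room hε hx).2], ?_⟩
      have := mem_closedBall_zero_iff.1 (hD ((mem_room_iff hε).1 hx))
      rw [Prod.norm_def, max_le_iff, Real.norm_eq_abs, Real.norm_eq_abs] at this
      have h2 := (le_abs_self _).trans this.2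
      simp only [Prod.smul_snd, Prod.snd_sub, smul_eq_mul] at h2
      rw [inv_mul_le_iff₀ hε] at h2
      have : ε * D ≤ ε * max D 1 := by gcongr; exact le_max_left _ _
      linarith
    · exact ⟨by linarith [hx.2.1], by linarith [hx.2.2]⟩

lemma IsRoom.isH1_testFun (hB : IsRoom B) (hε : 0 < ε) (hh : 0 < h) (hdε : d ≤ ε)
    (h1 : ContDiff ℝ ∞ φ₁) (h2 : Continuous φ₂) (hM1 : ∀ x, |φ₁ x| ≤ M)
    (hM1' : ∀ x, |deriv φ₁ x| ≤ M) (hM2 : ∀ x, |φ₂ x| ≤ M) (hA1 : ∀ x, A ≤ |x| → φ₁ x = 0)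
    (hA1' : ∀ x, A ≤ |x| → deriv φ₁ x = 0) (hA2 : ∀ x, A ≤ |x| → φ₂ x = 0) :
    IsH1 (waveguide B ε d h) (fun x => ((testFun ε h φ₁ φ₂ x : ℝ) : ℂ))
      (fun x => ((testFunFst h φ₁ x : ℝ) : ℂ)) (fun x => ((testFunSnd ε h φ₁ φ₂ x : ℝ) : ℂ)) := by
  obtain ⟨D, hD0, hD⟩ := hB.exists_height
  have hK : MeasurableSet {x : ℝ × ℝ | |x.1| < A + ε} :=
    (isOpen_lt continuous_fst.abs continuous_const).measurableSet
  have hfin : volume ({x : ℝ × ℝ | |x.1| < A + ε} ∩ waveguide B ε d h) ≠ ⊤ := by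
    have : {x : ℝ × ℝ | |x.1| < A + ε} ∩ waveguide B ε d h
        ⊆ Set.Icc (-(A + ε)) (A + ε) ×ˢ Set.Icc (-ε) (h + ε * D) := by
      rintro x ⟨hx, hx'⟩
      have := hD ε d h hε hh x hx'
      rw [Set.mem_ofPred_eq, abs_lt] at hx
      exact ⟨⟨hx.1.le, hx.2.le⟩, ⟨this.1.le, this.2⟩⟩
    exact ne_top_of_le_ne_top (isCompact_Icc.prod isCompact_Icc).measure_lt_top.ne
      (measure_mono this)
  have hout (x : ℝ) (hx : ¬ |x| < A + ε) : A ≤ |x| ∧ A ≤ |nearestCenter ε x| := by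
    rw [not_lt] at hx
    have := abs_nearestCenter_sub_le hε x
    have h3 := abs_sub_abs_le_abs_sub x (nearestCenter ε x)
    rw [abs_sub_comm] at h3
    constructor <;> linarith
  refine ⟨memLp_of_bounded_of_support hK hfin (measurable_testFun h1.continuous h2)
      (abs_testFun_le hM1 hM2) fun x hx => ?_,
    memLp_of_bounded_of_support hK hfin
      (measurable_testFunFst (h1.continuous_deriv (by simp))) (abs_testFunFst_le hM1') fun x hx => ?_,
    memLp_of_bounded_of_support hK hfin (measurable_testFunSnd h1.continuous h2)
      (abs_testFunSnd_le hh hM1 hM2) fun x hx => ?_,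
    hB.hasWeakDeriv_testFun_fst hε hh hdε h1 h2 hM1 hM1' hM2,
    hasWeakDeriv_testFun_snd _ hh h1.continuous h2 hM1 hM2⟩
  · simp [testFun, hA1 _ (hout _ hx).1, hA2 _ (hout _ hx).2]
  · simp [testFunFst, hA1' _ (hout _ hx).1]
  · simp [testFunSnd, hA1 _ (hout _ hx).1, hA2 _ (hout _ hx).2]

end TestFun

/-! ### The averaging operators -/

lemma enorm_setIntegral_sq_le {α : Type*} [MeasurableSpace α] {ν : Measure α} {f : α → ℂ}
    {A : Set α} (hf : AEStronglyMeasurable f (ν.restrict A)) :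
    ‖∫ x in A, f x ∂ν‖ₑ ^ 2 ≤ ν A * ∫⁻ x in A, ‖f x‖ₑ ^ 2 ∂ν := by
  have h := ENNReal.lintegral_mul_le_Lp_mul_Lq (ν.restrict A) Real.HolderConjugate.two_two
    hf.enorm (aemeasurable_const (b := (1 : ℝ≥0∞)))
  simp only [Pi.mul_apply, mul_one, ENNReal.one_rpow, lintegral_const, one_mul,
    Measure.restrict_apply_univ] at h
  calc ‖∫ x in A, f x ∂ν‖ₑ ^ 2 ≤ (∫⁻ x in A, ‖f x‖ₑ ∂ν) ^ 2 := by
        gcongr; exact enorm_integral_le_lintegral_enorm _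
    _ ≤ ((∫⁻ x in A, ‖f x‖ₑ ^ (2 : ℝ) ∂ν) ^ (1 / 2 : ℝ) * (ν A) ^ (1 / 2 : ℝ)) ^ 2 := by gcongr
    _ = ν A * ∫⁻ x in A, ‖f x‖ₑ ^ 2 ∂ν := by
        rw [mul_pow, ← ENNReal.rpow_natCast, ← ENNReal.rpow_natCast, ← ENNReal.rpow_mul,
          ← ENNReal.rpow_mul, mul_comm]
        norm_num

lemma memLp_of_lintegral_enorm_sq_le {α β : Type*} [MeasurableSpace α] [MeasurableSpace β]
    {ν : Measure α} {ρ : Measure β} {f : α → ℂ} {g : β → ℂ} (hf : AEStronglyMeasurable f ν)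
    (hg : MemLp g 2 ρ) (h : ∫⁻ x, ‖f x‖ₑ ^ 2 ∂ν ≤ ∫⁻ x, ‖g x‖ₑ ^ 2 ∂ρ) :
    MemLp f 2 ν ∧ ∫ x, ‖f x‖ ^ 2 ∂ν ≤ ∫ x, ‖g x‖ ^ 2 ∂ρ := by
  have hL : MemLp f 2 ν := by
    refine ⟨hf, ?_⟩
    rw [eLpNorm_lt_top_iff_lintegral_rpow_enorm_lt_top (by norm_num) (by norm_num)]
    rw [hg.lintegral_enorm_sq] at h
    simpa using h.trans_lt ENNReal.ofReal_lt_top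
  refine ⟨hL, ?_⟩
  rw [hL.lintegral_enorm_sq, hg.lintegral_enorm_sq] at h
  exact (ENNReal.ofReal_le_ofReal_iff (integral_nonneg fun x => by positivity)).1 h

lemma strip_eq_prod (ε : ℝ) : strip ε = Set.univ ×ˢ Set.Ioo (-ε) 0 := by
  ext x; simp [strip]

section Averages

variable {ε : ℝ} {u : ℝ × ℝ → ℂ}

/-- Cauchy-Schwarz on each vertical fibre of length `ε`; the factor `1 / √ε` makes `J₁` a
contraction. -/
lemma memLp_J₁ (hε : 0 < ε) (hu : MemLp u 2) :
    MemLp (J₁ ε u) 2 ∧ ∫ x, ‖J₁ ε u x‖ ^ 2 ≤ ∫ x, ‖u x‖ ^ 2 := by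
  have hum : AEStronglyMeasurable u (volume.prod (volume.restrict (Set.Ioo (-ε) 0))) := by
    have := hu.aestronglyMeasurable
    rw [Measure.volume_eq_prod] at this
    exact this.mono_ac ((Measure.AbsolutelyContinuous.refl _).prod Measure.restrict_le_self.absolutelyContinuous)
  have hm : AEStronglyMeasurable (J₁ ε u) volume := hum.integral_prod_right'.const_mul _
  refine memLp_of_lintegral_enorm_sq_le hm hu ?_
  have hpt : ∀ᵐ x : ℝ, ‖J₁ ε u x‖ₑ ^ 2 ≤ ∫⁻ y in Set.Ioo (-ε) 0, ‖u (x, y)‖ₑ ^ 2 := by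
    filter_upwards [hum.prodMk_left] with x hx
    have h1 := enorm_setIntegral_sq_le (ν := volume) (A := Set.Ioo (-ε) 0) hx
    rw [J₁, enorm_mul, mul_pow]
    have h2 : ‖((1 / √ε : ℝ) : ℂ)‖ₑ ^ 2 * volume (Set.Ioo (-ε) 0) = 1 := by
      rw [enorm_sq_eq_ofReal, Real.volume_Ioo, ← ENNReal.ofReal_mul (by positivity),
        Complex.norm_real, Real.norm_eq_abs, sq_abs, div_pow, Real.sq_sqrt hε.le]
      simp [hε.ne']
    calc _ ≤ ‖((1 / √ε : ℝ) : ℂ)‖ₑ ^ 2 * (volume (Set.Ioo (-ε) 0)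
          * ∫⁻ y in Set.Ioo (-ε) 0, ‖u (x, y)‖ₑ ^ 2) := by gcongr
      _ = _ := by rw [← mul_assoc, h2, one_mul]
  calc ∫⁻ x, ‖J₁ ε u x‖ₑ ^ 2 ≤ ∫⁻ x, ∫⁻ y in Set.Ioo (-ε) 0, ‖u (x, y)‖ₑ ^ 2 :=
        lintegral_mono_ae hpt
    _ = ∫⁻ z, ‖u z‖ₑ ^ 2 ∂(volume.prod (volume.restrict (Set.Ioo (-ε) 0))) :=
        (lintegral_prod (fun z => ‖u z‖ₑ ^ 2) (hum.enorm.pow_const 2)).symm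
    _ ≤ ∫⁻ z, ‖u z‖ₑ ^ 2 := by
        rw [Measure.volume_eq_prod]
        have : (volume : Measure ℝ).prod (volume.restrict (Set.Ioo (-ε) 0))
            = (volume.prod volume).restrict (Set.univ ×ˢ Set.Ioo (-ε) 0) := by
          rw [← Measure.prod_restrict, Measure.restrict_univ]
        rw [this]
        exact setLIntegral_le_lintegral _ _

lemma integral_J₁_mul (φ : ℝ → ℝ) (hi : IntegrableOn (fun x => u x * ((φ x.1 : ℝ) : ℂ)) (strip ε)) :
    ∫ x, J₁ ε u x * ((φ x : ℝ) : ℂ)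
      = ((1 / √ε : ℝ) : ℂ) * ∫ x in strip ε, u x * ((φ x.1 : ℝ) : ℂ) := by
  rw [strip_eq_prod, Measure.volume_eq_prod] at hi ⊢
  rw [setIntegral_prod _ hi, Measure.restrict_univ, ← integral_const_mul]
  congr 1; ext x
  change J₁ ε u x * _ = _ * ∫ y in Set.Ioo (-ε) 0, u (x, y) * ((φ x : ℝ) : ℂ)
  rw [integral_mul_const, J₁]
  ring

lemma volume_strip_inter_ne_top (ε A : ℝ) :
    volume ({x : ℝ × ℝ | |x.1| < A} ∩ strip ε) ≠ ⊤ := by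
  have : {x : ℝ × ℝ | |x.1| < A} ∩ strip ε ⊆ Set.Icc (-A) A ×ˢ Set.Icc (-ε) 0 := by
    rintro x ⟨hx, hx'⟩
    rw [Set.mem_ofPred_eq, abs_lt] at hx
    exact ⟨⟨hx.1.le, hx.2.le⟩, hx'.1.le, hx'.2.le⟩
  exact ne_top_of_le_ne_top (isCompact_Icc.prod isCompact_Icc).measure_lt_top.ne
    (measure_mono this)

lemma integrableOn_strip_mul {M A : ℝ} (hu : MemLp u 2) {φ : ℝ → ℝ} (hm : Measurable φ)
    (hM : ∀ x, |φ x| ≤ M) (hA : ∀ x, A ≤ |x| → φ x = 0) :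
    IntegrableOn (fun x => u x * ((φ x.1 : ℝ) : ℂ)) (strip ε) := by
  have h1 : MemLp (fun x : ℝ × ℝ => ((φ x.1 : ℝ) : ℂ)) 2 (volume.restrict (strip ε)) :=
    memLp_of_bounded_of_support (K := {x : ℝ × ℝ | |x.1| < A}) (v := fun x : ℝ × ℝ => φ x.1)
      (isOpen_lt continuous_fst.abs continuous_const).measurableSet
      (volume_strip_inter_ne_top ε A) (hm.comp measurable_fst) (fun x => hM x.1)
      fun x hx => hA x.1 (not_lt.1 hx)
  exact (hu.restrict _).integrable_mul h1

/-- `J₁ u ∈ H¹(ℝ)`, with derivative `J₁ (∂₁ u)`. -/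
lemma HasGrad.isH1Line_J₁ {Ω : Set (ℝ × ℝ)} {u₁ u₂ : ℝ × ℝ → ℂ} (hε : 0 < ε)
    (h : HasGrad Ω u u₁ u₂) (hΩ : strip ε ⊆ Ω) : IsH1Line (J₁ ε u) (J₁ ε u₁) := by
  refine ⟨(memLp_J₁ hε h.memLp).1, (memLp_J₁ hε h.memLp_fst).1, fun φ p1 p2 _ => ?_⟩
  simp only [setIntegral_univ, fderiv_apply_one_eq_deriv]
  have hc' := p1.continuous_deriv (by simp)
  have hbd {ψ : ℝ → ℝ} (hc : Continuous ψ) (hs : HasCompactSupport ψ) {w : ℝ × ℝ → ℂ}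
      (hw : MemLp w 2) : IntegrableOn (fun x => w x * ((ψ x.1 : ℝ) : ℂ)) (strip ε) := by
    obtain ⟨M, hM⟩ := hs.exists_bound_of_continuous hc
    obtain ⟨R, hR⟩ := hs.isCompact.isBounded.subset_closedBall (0 : ℝ)
    refine integrableOn_strip_mul hw hc.measurable (M := M) (A := R + 1) (by simpa using hM)
      fun x hx => image_eq_zero_of_notMem_tsupport fun hm => ?_
    have := mem_closedBall_zero_iff.1 (hR hm)
    rw [Real.norm_eq_abs] at this
    linarith
  have i1 := hbd hc' p2.deriv h.memLp
  have i2 := hbd p1.continuous p2 h.memLp_fst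
  rw [integral_J₁_mul _ i1, integral_J₁_mul _ i2, ← mul_neg]
  congr 1
  rw [eq_neg_iff_add_eq_zero, ← integral_add i1 i2]
  set G : ℝ × ℝ → ℂ := fun x => u x * ((deriv φ x.1 : ℝ) : ℂ) + u₁ x * ((φ x.1 : ℝ) : ℂ) with hG
  have iG : IntegrableOn G (strip ε) := i1.add i2
  have iG' := iG
  rw [strip_eq_prod, Measure.volume_eq_prod] at iG' ⊢
  rw [IntegrableOn, ← Measure.prod_restrict, Measure.restrict_univ] at iG'
  rw [← Measure.prod_restrict, Measure.restrict_univ, integral_prod_symm _ iG']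
  refine integral_eq_zero_of_ae ?_
  have hloc : IntegrableOn (fun y => ∫ x, G (x, y)) (Set.Ioo (-ε) 0) := iG'.integral_prod_right
  -- The function `φ x₁` alone is not compactly supported in the strip. It is multiplied by an
  -- arbitrary `η x₂` supported in `(-ε, 0)`, and the du Bois-Reymond lemma in `x₂` removes `η`.
  have key := isOpen_Ioo.ae_eq_zero_of_integral_contDiff_smul_eq_zero (μ := volume)
    hloc.locallyIntegrableOn fun η q1 q2 q3 => ?_
  · filter_upwards [ae_restrict_mem measurableSet_Ioo, ae_restrict_of_ae key] with y hy hy'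
    exact hy' hy
  set Φ : ℝ × ℝ → ℝ := fun x => φ x.1 * η x.2 with hΦ
  have c1 : ContDiff ℝ ∞ Φ := (p1.comp contDiff_fst).mul (q1.comp contDiff_snd)
  have hsub : tsupport Φ ⊆ tsupport φ ×ˢ tsupport η := by
    refine closure_minimal ?_ ((isClosed_tsupport φ).prod (isClosed_tsupport η))
    intro x hx
    rw [Function.mem_support, hΦ] at hx
    exact ⟨subset_tsupport _ (left_ne_zero_of_mul hx), subset_tsupport _ (right_ne_zero_of_mul hx)⟩
  have c2 : HasCompactSupport Φ :=
    (p2.isCompact.prod q2.isCompact).of_isClosed_subset (isClosed_tsupport _) hsub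
  have c3 : tsupport Φ ⊆ Ω := hsub.trans fun x hx => hΩ (q3 hx.2)
  have hfd (x : ℝ × ℝ) : fderiv ℝ Φ x (1, 0) = deriv φ x.1 * η x.2 := by
    have d0 : HasDerivAt (fun t => Φ (t, x.2)) (fderiv ℝ Φ x (1, 0)) x.1 :=
      HasFDerivAt.comp_hasDerivAt (f := fun t : ℝ => (t, x.2)) x.1
        ((c1.differentiable (by simp)).differentiableAt (x := x)).hasFDerivAt
        ((hasDerivAt_id x.1).prodMk (hasDerivAt_const x.1 x.2))
    have d1 : HasDerivAt (fun t => Φ (t, x.2)) (deriv φ x.1 * η x.2) x.1 :=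
      ((p1.differentiable (by simp)) x.1).hasDerivAt.mul_const (η x.2)
    exact d0.unique d1
  have e := hasWeakDeriv_iff.1 h.deriv_fst Φ c1 c2 c3
  simp only [hfd] at e
  have j1 : Integrable fun x : ℝ × ℝ => u x * ((deriv φ x.1 * η x.2 : ℝ) : ℂ) := by
    have := locallyIntegrable_mul_test h.memLp.locInt
      ((c1.continuous_fderiv (by simp)).clm_apply continuous_const) (c2.fderiv_apply ℝ (1, 0))
    simpa only [hfd] using this
  have j2 : Integrable fun x : ℝ × ℝ => u₁ x * ((Φ x : ℝ) : ℂ) :=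
    locallyIntegrable_mul_test h.memLp_fst.locInt c1.continuous c2
  have e2 := add_eq_zero_iff_eq_neg.2 e
  rw [← integral_add j1 j2] at e2
  have j3 : Integrable fun x : ℝ × ℝ => u x * ((deriv φ x.1 * η x.2 : ℝ) : ℂ)
      + u₁ x * ((Φ x : ℝ) : ℂ) := j1.add j2
  rw [Measure.volume_eq_prod] at e2 j3
  rw [integral_prod_symm _ j3] at e2
  rw [← e2]
  congr 1; ext y
  simp only [Complex.real_smul]
  rw [← integral_const_mul]
  congr 1; ext x
  simp only [hG, hΦ, Complex.ofReal_mul]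
  ring

/-! ### Step functions -/

lemma floor_preimage (hε : 0 < ε) (j : ℤ) :
    (fun x : ℝ => ⌊x / ε⌋) ⁻¹' {j} = Set.Ico (ε * j) (ε * (j + 1)) := by
  ext x
  rw [Set.mem_preimage, Set.mem_singleton_iff, Int.floor_eq_iff, Set.mem_Ico, le_div_iff₀ hε,
    div_lt_iff₀ hε, mul_comm, mul_comm _ ε]

lemma lintegral_comp_floor (hε : 0 < ε) (s : ℤ → ℝ≥0∞) :
    ∫⁻ x : ℝ, s ⌊x / ε⌋ = ∑' j, s j * ENNReal.ofReal ε := by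
  have hm : Measurable fun x : ℝ => ⌊x / ε⌋ := (measurable_id.div_const ε).floor
  rw [← lintegral_map (g := fun x : ℝ => ⌊x / ε⌋) (f := s) (measurable_from_top) hm, lintegral_countable']
  congr 1; ext j
  rw [Measure.map_apply hm (measurableSet_singleton j), floor_preimage hε, Real.volume_Ico]
  congr 2; ring

lemma integral_mul_comp_floor (hε : 0 < ε) {F : ℝ → ℂ} (hF : LocallyIntegrable F) (s : ℤ → ℂ)
    (J : Finset ℤ) (hs : ∀ j ∉ J, s j = 0) :
    ∫ x, F x * s ⌊x / ε⌋
      = ∑ j ∈ J, s j * ∫ x in Set.Ioo (cellCenter ε j - ε / 2) (cellCenter ε j + ε / 2), F x := by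
  have hpt (x : ℝ) : F x * s ⌊x / ε⌋
      = ∑ j ∈ J, (Set.Ico (ε * j) (ε * (j + 1))).indicator (fun x => s j * F x) x := by
    have hind (j : ℤ) : (Set.Ico (ε * j) (ε * (j + 1))).indicator (fun x => s j * F x) x
        = if ⌊x / ε⌋ = j then s j * F x else 0 := by
      classical
      rw [← floor_preimage hε j, Set.indicator_apply]
      congr 1
    simp only [hind, Finset.sum_ite_eq]
    split_ifs with h
    · ring
    · rw [hs _ h, mul_zero]
  have hii (j : ℤ) : IntegrableOn F (Set.Ico (ε * j) (ε * (j + 1))) :=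
    (hF.integrableOn_isCompact isCompact_Icc).mono_set Set.Ico_subset_Icc_self
  simp only [hpt]
  rw [integral_finsetSum]
  · refine Finset.sum_congr rfl fun j _ => ?_
    rw [integral_indicator measurableSet_Ico, integral_const_mul,
      integral_Ico_eq_integral_Ioo]
    congr 4 <;> simp only [cellCenter] <;> ring_nf
  · intro j _
    exact (IntegrableOn.integrable_indicator ((hii j).const_mul _) measurableSet_Ico)

end Averages

/-! ### Averages over the rooms -/

section Rooms

variable {B : Set (ℝ × ℝ)} {ε h : ℝ} {u : ℝ × ℝ → ℂ}

/-- The value of `J₂ u` in the `j`-th period cell. -/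
noncomputable def roomCoeff (B : Set (ℝ × ℝ)) (ε h : ℝ) (u : ℝ × ℝ → ℂ) (j : ℤ) : ℂ :=
  ((1 / √(ε * volume.real (room B ε h j)) : ℝ) : ℂ) * ∫ y in room B ε h j, u y

/-- Off the countable set `ε ℤ` of cell boundaries, the series has exactly one non-zero indicator,
with index `⌊x / ε⌋`. -/
lemma J₂_ae_eq (hε : 0 < ε) : J₂ B ε h u =ᵐ[volume] fun x => roomCoeff B ε h u ⌊x / ε⌋ := by
  have hnull : volume (Set.range fun k : ℤ => ε * (k : ℝ)) = 0 :=
    (Set.countable_range _).measure_zero _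
  filter_upwards [measure_eq_zero_iff_ae_notMem.1 hnull] with x hx
  have hx' : |x - cellCenter ε ⌊x / ε⌋| < ε / 2 := by
    have h1 := Int.floor_le (x / ε)
    have h2 := Int.lt_floor_add_one (x / ε)
    rw [le_div_iff₀ hε] at h1
    rw [div_lt_iff₀ hε] at h2
    have h3 : (⌊x / ε⌋ : ℝ) * ε ≠ x := fun he => hx ⟨⌊x / ε⌋, by
      change ε * (⌊x / ε⌋ : ℝ) = x
      linarith⟩
    have h4 := lt_of_le_of_ne h1 h3
    rw [cellCenter, abs_lt]
    constructor <;> nlinarith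
  have hmem (j : ℤ) : x ∈ Set.Ioo (cellCenter ε j - ε / 2) (cellCenter ε j + ε / 2) ↔
      |x - cellCenter ε j| < ε / 2 := by
    rw [abs_lt, Set.mem_Ioo]
    constructor <;> rintro ⟨_, _⟩ <;> constructor <;> linarith
  rw [J₂, tsum_eq_single ⌊x / ε⌋]
  · rw [Set.indicator_of_mem ((hmem _).2 hx')]
    rfl
  · intro j hj
    refine Set.indicator_of_notMem (fun hc => hj ?_) _
    exact cell_disjoint hε ((hmem j).1 hc) hx'

lemma volume_room (hε : 0 < ε) (j : ℤ) :
    volume (room B ε h j) = ENNReal.ofReal (ε ^ 2) * volume B := by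
  have e := volume_homothety_preimage (cellCenter ε j, h) hε (room B ε h j)
  rw [homothety_preimage_room hε] at e
  rw [e, ← mul_assoc, ← ENNReal.ofReal_mul (by positivity),
    mul_inv_cancel₀ (by positivity), ENNReal.ofReal_one, one_mul]

lemma volume_real_room (hε : 0 < ε) (j : ℤ) :
    volume.real (room B ε h j) = ε ^ 2 * volume.real B := by
  rw [measureReal_def, volume_room hε, ENNReal.toReal_mul, ENNReal.toReal_ofReal (by positivity),
    measureReal_def]

lemma IsRoom.volume_ne_top (hB : IsRoom B) : volume B ≠ ⊤ := hB.isBounded.measure_lt_top.ne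

lemma IsRoom.volume_real_pos (hB : IsRoom B) : 0 < volume.real B :=
  ENNReal.toReal_pos (hB.isOpen.measure_pos volume hB.isConnected.nonempty).ne' hB.volume_ne_top

lemma IsRoom.volume_room_ne_top (hB : IsRoom B) (hε : 0 < ε) (j : ℤ) :
    volume (room B ε h j) ≠ ⊤ := by
  rw [volume_room hε]
  exact ENNReal.mul_ne_top ENNReal.ofReal_ne_top hB.volume_ne_top

lemma IsRoom.disjoint_room (hB : IsRoom B) (hε : 0 < ε) :
    Pairwise (Function.onFun Disjoint fun j => room B ε h j) := by
  intro i j hij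
  refine Set.disjoint_left.2 fun x hi hj => hij ?_
  exact cell_disjoint hε (hB.mem_room hε hi).1 (hB.mem_room hε hj).1

lemma IsRoom.memLp_J₂ (hB : IsRoom B) (hε : 0 < ε) (hu : MemLp u 2) :
    MemLp (J₂ B ε h u) 2 ∧ ∫ x, ‖J₂ B ε h u x‖ ^ 2 ≤ ∫ x, ‖u x‖ ^ 2 := by
  have hb := hB.volume_real_pos
  have hm0 : Measurable fun x : ℝ => ⌊x / ε⌋ := (measurable_id.div_const ε).floor
  have hm : AEStronglyMeasurable (J₂ B ε h u) volume :=
    ((measurable_from_top (f := roomCoeff B ε h u)).comp hm0).aestronglyMeasurable.congr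
      (J₂_ae_eq hε).symm
  refine memLp_of_lintegral_enorm_sq_le hm hu ?_
  have hterm (j : ℤ) : ‖roomCoeff B ε h u j‖ₑ ^ 2 * ENNReal.ofReal ε
      ≤ ∫⁻ x in room B ε h j, ‖u x‖ₑ ^ 2 := by
    have h1 := enorm_setIntegral_sq_le (ν := volume) (A := room B ε h j) (f := u)
      hu.aestronglyMeasurable.restrict
    have hv : 0 < volume.real (room B ε h j) := by rw [volume_real_room hε]; positivity
    -- The normalisation of `J₂` makes the length `ε` of the cell and the area in the Cauchy-Schwarz
    -- inequality cancel exactly, so `J₂` is a contraction.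
    have h2 : ‖((1 / √(ε * volume.real (room B ε h j)) : ℝ) : ℂ)‖ₑ ^ 2 * ENNReal.ofReal ε
        * volume (room B ε h j) = 1 := by
      rw [enorm_sq_eq_ofReal, Complex.norm_real, Real.norm_eq_abs, sq_abs, div_pow,
        Real.sq_sqrt (by positivity), ← ENNReal.ofReal_mul (by positivity),
        ← ENNReal.ofReal_toReal (hB.volume_room_ne_top hε j), ← ENNReal.ofReal_mul (by positivity),
        ← measureReal_def]
      rw [show 1 ^ 2 / (ε * volume.real (room B ε h j)) * ε * volume.real (room B ε h j) = 1 by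
        field_simp, ENNReal.ofReal_one]
    rw [roomCoeff, enorm_mul, mul_pow]
    calc _ ≤ ‖((1 / √(ε * volume.real (room B ε h j)) : ℝ) : ℂ)‖ₑ ^ 2
          * (volume (room B ε h j) * ∫⁻ x in room B ε h j, ‖u x‖ₑ ^ 2) * ENNReal.ofReal ε := by
          gcongr
      _ = (‖((1 / √(ε * volume.real (room B ε h j)) : ℝ) : ℂ)‖ₑ ^ 2 * ENNReal.ofReal ε
          * volume (room B ε h j)) * ∫⁻ x in room B ε h j, ‖u x‖ₑ ^ 2 := by ring
      _ = _ := by rw [h2, one_mul]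
  calc ∫⁻ x, ‖J₂ B ε h u x‖ₑ ^ 2 = ∫⁻ x : ℝ, ‖roomCoeff B ε h u ⌊x / ε⌋‖ₑ ^ 2 := by
        refine lintegral_congr_ae ?_
        filter_upwards [J₂_ae_eq (B := B) (h := h) (u := u) hε] with x hx
        rw [hx]
    _ = ∑' j, ‖roomCoeff B ε h u j‖ₑ ^ 2 * ENNReal.ofReal ε :=
        lintegral_comp_floor hε fun j => ‖roomCoeff B ε h u j‖ₑ ^ 2
    _ ≤ ∑' j, ∫⁻ x in room B ε h j, ‖u x‖ₑ ^ 2 := ENNReal.tsum_le_tsum hterm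
    _ = ∫⁻ x in ⋃ j, room B ε h j, ‖u x‖ₑ ^ 2 :=
        (lintegral_iUnion (fun j => (isOpen_room hB.isOpen hε).measurableSet)
          (hB.disjoint_room hε) _).symm
    _ ≤ ∫⁻ x, ‖u x‖ₑ ^ 2 := setLIntegral_le_lintegral _ _

lemma IsRoom.integral_J₂_mul_step (hB : IsRoom B) (hε : 0 < ε) (ψ : ℝ → ℝ) (J : Finset ℤ)
    (hJ : ∀ j ∉ J, ψ (cellCenter ε j) = 0) :
    ((√(volume.real B) : ℝ) : ℂ) * ∫ x, J₂ B ε h u x * ((ψ (nearestCenter ε x) : ℝ) : ℂ)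
      = ((1 / √ε : ℝ) : ℂ)
        * ∑ j ∈ J, ((ψ (cellCenter ε j) : ℝ) : ℂ) * ∫ x in room B ε h j, u x := by
  have hb := hB.volume_real_pos
  have e1 : ∫ x, J₂ B ε h u x * ((ψ (nearestCenter ε x) : ℝ) : ℂ)
      = ∫ x, (1 : ℂ) * (fun j => roomCoeff B ε h u j * ((ψ (cellCenter ε j) : ℝ) : ℂ)) ⌊x / ε⌋ := by
    refine integral_congr_ae ?_
    filter_upwards [J₂_ae_eq (B := B) (h := h) (u := u) hε] with x hx
    rw [hx, one_mul, nearestCenter]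
  rw [e1, integral_mul_comp_floor hε (F := fun _ => (1 : ℂ)) (locallyIntegrable_const 1)
    (fun j => roomCoeff B ε h u j * ((ψ (cellCenter ε j) : ℝ) : ℂ)) J
    (fun j hj => by simp [hJ j hj]), Finset.mul_sum, Finset.mul_sum]
  refine Finset.sum_congr rfl fun j _ => ?_
  have e2 : ∫ x in Set.Ioo (cellCenter ε j - ε / 2) (cellCenter ε j + ε / 2), (1 : ℂ) = (ε : ℂ) := by
    rw [integral_const, measureReal_restrict_apply_univ, measureReal_def, Real.volume_Ioo,
      ENNReal.toReal_ofReal (by linarith)]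
    simp
  -- As a room has area `ε² |B|`, multiplication of `J₂` by `√|B|` gives the same prefactor `1 / √ε`
  -- as for `J₁`. This is the origin of the `√|B|` in the limit operator.
  have e3 : √(volume.real B) * (1 / √(ε * volume.real (room B ε h j))) * ε = 1 / √ε := by
    have hs : 0 < √ε := Real.sqrt_pos.2 hε
    have hsb : 0 < √(volume.real B) := Real.sqrt_pos.2 hb
    have hss : √ε * √ε = ε := Real.mul_self_sqrt hε.le
    rw [volume_real_room hε, Real.sqrt_mul hε.le, Real.sqrt_mul (by positivity),
      Real.sqrt_sq hε.le]
    field_simp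
  rw [e2, roomCoeff, ← e3]
  push_cast
  ring

lemma integral_J₁_mul_step (hε : 0 < ε) (hu : MemLp u 2) (ψ : ℝ → ℝ) (J : Finset ℤ)
    (hJ : ∀ j ∉ J, ψ (cellCenter ε j) = 0) :
    ∫ x, J₁ ε u x * ((ψ (nearestCenter ε x) : ℝ) : ℂ)
      = ((1 / √ε : ℝ) : ℂ) * ∑ j ∈ J, ((ψ (cellCenter ε j) : ℝ) : ℂ)
          * ∫ x in rect (cellCenter ε j) (-(ε / 2)) (ε / 2) (ε / 2), u x := by
  have e1 := integral_mul_comp_floor hε (memLp_J₁ hε hu).1.locInt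
    (fun j => ((ψ (cellCenter ε j) : ℝ) : ℂ)) J (fun j hj => by simp [hJ j hj])
  simp only [nearestCenter]
  rw [e1, Finset.mul_sum]
  refine Finset.sum_congr rfl fun j _ => ?_
  have hi : IntegrableOn u (rect (cellCenter ε j) (-(ε / 2)) (ε / 2) (ε / 2)) := by
    have : IsFiniteMeasure (volume.restrict (rect (cellCenter ε j) (-(ε / 2)) (ε / 2) (ε / 2))) :=
      ⟨by simpa using (volume_rect_ne_top _ _ _ _).lt_top⟩
    exact (hu.restrict _).integrable (by norm_num)
  have hr : rect (cellCenter ε j) (-(ε / 2)) (ε / 2) (ε / 2)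
      = Set.Ioo (cellCenter ε j - ε / 2) (cellCenter ε j + ε / 2) ×ˢ Set.Ioo (-ε) 0 := by
    rw [rect]; congr 2 <;> ring
  rw [hr, Measure.volume_eq_prod] at hi ⊢
  rw [setIntegral_prod _ hi]
  simp only [J₁]
  rw [integral_const_mul]
  ring

end Rooms

/-! ### Approximation by step functions -/

section Step

variable {ε A L M : ℝ} {ψ : ℝ → ℝ}

lemma nearestCenter_support (hε : 0 < ε) (hA : ∀ x, A ≤ |x| → ψ x = 0) (x : ℝ)
    (hx : A + ε ≤ |x|) : ψ (nearestCenter ε x) = 0 := by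
  refine hA _ ?_
  have := abs_nearestCenter_sub_le hε x
  have h3 := abs_sub_abs_le_abs_sub x (nearestCenter ε x)
  rw [abs_sub_comm] at h3
  linarith

lemma memLp_line_of_bounded {f : ℝ → ℝ} (hf : Measurable f) (hM : ∀ x, |f x| ≤ M)
    (hA : ∀ x, A ≤ |x| → f x = 0) : MemLp (fun x => ((f x : ℝ) : ℂ)) 2 := by
  have e : (fun x => ((f x : ℝ) : ℂ)) = (Set.Icc (-A) A).indicator fun x => ((f x : ℝ) : ℂ) := by
    ext x
    by_cases hx : x ∈ Set.Icc (-A) A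
    · rw [Set.indicator_of_mem hx]
    · rw [Set.indicator_of_notMem hx, hA x, Complex.ofReal_zero]
      by_contra! hc
      exact hx (abs_le.1 hc.le)
  rw [e, memLp_indicator_iff_restrict measurableSet_Icc]
  exact MemLp.of_bound (Complex.measurable_ofReal.comp hf).aestronglyMeasurable M
    (Eventually.of_forall fun x => by simpa using hM x)

lemma memLp_step (hε : 0 < ε) (hψ : Measurable ψ) (hM : ∀ x, |ψ x| ≤ M)
    (hA : ∀ x, A ≤ |x| → ψ x = 0) :
    MemLp (fun x => ((ψ (nearestCenter ε x) : ℝ) : ℂ)) 2 :=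
  memLp_line_of_bounded (f := fun x => ψ (nearestCenter ε x)) (A := A + ε)
    (hψ.comp (measurable_nearestCenter ε)) (fun _ => hM _) (nearestCenter_support hε hA)

/-- The centre of the cell is within `ε / 2`, so the error is at most `L ε` pointwise, on an
interval of length `2 (A + ε)`. -/
lemma integral_step_sub_sq_le (hε : 0 < ε) (hA0 : 0 ≤ A) (hL : ∀ x y, |ψ x - ψ y| ≤ L * |x - y|)
    (hA : ∀ x, A ≤ |x| → ψ x = 0) :
    ∫ x, ‖((ψ (nearestCenter ε x) : ℝ) : ℂ) - ((ψ x : ℝ) : ℂ)‖ ^ 2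
      ≤ (L * ε) ^ 2 * (2 * (A + ε)) := by
  have hL0 : 0 ≤ L := by simpa using (abs_nonneg _).trans (hL 1 0)
  have hb (x : ℝ) : ‖((ψ (nearestCenter ε x) : ℝ) : ℂ) - ((ψ x : ℝ) : ℂ)‖ ^ 2
      ≤ (Set.Icc (-(A + ε)) (A + ε)).indicator (fun _ => (L * ε) ^ 2) x := by
    rw [← Complex.ofReal_sub, Complex.norm_real, Real.norm_eq_abs]
    by_cases hx : x ∈ Set.Icc (-(A + ε)) (A + ε)
    · rw [Set.indicator_of_mem hx]
      have h1 := abs_nearestCenter_sub_le hε x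
      have : |ψ (nearestCenter ε x) - ψ x| ≤ L * ε :=
        (hL _ _).trans (mul_le_mul_of_nonneg_left (by linarith) hL0)
      gcongr
    · rw [Set.indicator_of_notMem hx]
      have hx' : A + ε ≤ |x| := by
        by_contra! hc
        exact hx (abs_le.1 hc.le)
      rw [nearestCenter_support hε hA x hx', hA x (by linarith)]
      simp
  calc _ ≤ ∫ x, (Set.Icc (-(A + ε)) (A + ε)).indicator (fun _ => (L * ε) ^ 2) x := by
        refine integral_mono_of_nonneg (Eventually.of_forall fun x => by positivity) ?_
          (Eventually.of_forall hb)
        exact (integrable_indicator_iff measurableSet_Icc).2 (integrableOn_const (by simp))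
    _ = _ := by
        rw [integral_indicator measurableSet_Icc, integral_const, measureReal_restrict_apply_univ,
          measureReal_def, Real.volume_Icc, ENNReal.toReal_ofReal (by linarith), smul_eq_mul]
        ring

end Step

/-! ### A priori estimates -/

lemma HasWeakDeriv.congr_on {Ω : Set (ℝ × ℝ)} (hΩ : MeasurableSet Ω) {e : ℝ × ℝ}
    {u g u' g' : ℝ × ℝ → ℂ} (h : HasWeakDeriv Ω e u g) (hu : Set.EqOn u u' Ω)
    (hg : Set.EqOn g g' Ω) : HasWeakDeriv Ω e u' g' :=
  h.congr ((ae_restrict_mem hΩ).mono fun _ hx => hu hx)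
    ((ae_restrict_mem hΩ).mono fun _ hx => hg hx)

/-- Extension by zero puts all functions in `L₂(ℝ²)`. It creates no derivative on the boundary
because weak derivatives are only tested inside `Ω`. -/
lemma IsH1.hasGrad_indicator {Ω : Set (ℝ × ℝ)} (hΩ : MeasurableSet Ω) {u u₁ u₂ : ℝ × ℝ → ℂ}
    (h : IsH1 Ω u u₁ u₂) :
    HasGrad Ω (Ω.indicator u) (Ω.indicator u₁) (Ω.indicator u₂) where
  memLp := (memLp_indicator_iff_restrict hΩ).2 h.memLp
  memLp_fst := (memLp_indicator_iff_restrict hΩ).2 h.memLp_fst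
  memLp_snd := (memLp_indicator_iff_restrict hΩ).2 h.memLp_snd
  deriv_fst := h.deriv_fst.congr_on hΩ (Set.eqOn_indicator).symm (Set.eqOn_indicator).symm
  deriv_snd := h.deriv_snd.congr_on hΩ (Set.eqOn_indicator).symm (Set.eqOn_indicator).symm

/-- The weak formulation of the resolvent equation, with the energy estimates. -/
lemma IsNeumannResolvent.exists_weak_form {Ω : Set (ℝ × ℝ)} {μ : ℝ} (hμ : 0 < μ)
    {f u : ℝ × ℝ → ℂ} (hf : MemLp f 2 (volume.restrict Ω)) (hu : IsNeumannResolvent Ω μ f u) :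
    ∃ u₁ u₂ : ℝ × ℝ → ℂ, IsH1 Ω u u₁ u₂ ∧
      (∀ v v₁ v₂ : ℝ × ℝ → ℂ, IsH1 Ω v v₁ v₂ →
        (∫ x in Ω, (u₁ x * conj (v₁ x) + u₂ x * conj (v₂ x))) + μ * ∫ x in Ω, u x * conj (v x)
          = ∫ x in Ω, f x * conj (v x)) ∧
      μ ^ 2 * ∫ x in Ω, ‖u x‖ ^ 2 ≤ ∫ x in Ω, ‖f x‖ ^ 2 ∧
      μ * ∫ x in Ω, (‖u₁ x‖ ^ 2 + ‖u₂ x‖ ^ 2) ≤ ∫ x in Ω, ‖f x‖ ^ 2 := by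
  obtain ⟨g, ⟨hg, u₁, u₂, hu, hug⟩, hgf⟩ := hu
  have hweak (v v₁ v₂ : ℝ × ℝ → ℂ) (hv : IsH1 Ω v v₁ v₂) :
      (∫ x in Ω, (u₁ x * conj (v₁ x) + u₂ x * conj (v₂ x))) + μ * ∫ x in Ω, u x * conj (v x)
          = ∫ x in Ω, f x * conj (v x) := by
    have i1 : Integrable (fun x => g x * conj (v x)) (volume.restrict Ω) :=
      hg.integrable_mul hv.memLp.star
    have i2 : Integrable (fun x => (μ : ℂ) * (u x * conj (v x))) (volume.restrict Ω) :=
      (hu.memLp.integrable_mul hv.memLp.star).const_mul _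
    rw [hug v v₁ v₂ hv, ← integral_const_mul, ← integral_add i1 i2]
    refine integral_congr_ae ?_
    filter_upwards [hgf] with x hx
    rw [← hx]; ring
  refine ⟨u₁, u₂, hu, hweak, ?_⟩
  set E := ∫ x in Ω, (‖u₁ x‖ ^ 2 + ‖u₂ x‖ ^ 2) with hE
  set U := ∫ x in Ω, ‖u x‖ ^ 2 with hU
  set F := ∫ x in Ω, ‖f x‖ ^ 2 with hF
  have hE0 : 0 ≤ E := energy_nonneg _ _ _
  have hU0 : 0 ≤ U := integral_nonneg fun x => by positivity
  have hF0 : 0 ≤ F := integral_nonneg fun x => by positivity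
  have e := hweak u u₁ u₂ hu
  have e1 : ∫ x in Ω, (u₁ x * conj (u₁ x) + u₂ x * conj (u₂ x)) = (E : ℂ) := by
    rw [hE, ← integral_complex_ofReal]
    congr 1; ext x; rw [Complex.mul_conj', Complex.mul_conj']; push_cast; rfl
  rw [e1, integral_mul_conj_self, ← hU] at e
  have hcs := norm_integral_mul_sq_le hf hu.memLp.star
  simp only [Pi.star_apply, RCLike.star_def, RCLike.norm_conj, ← hF, ← hU] at hcs
  -- The equation tested with its own solution, and Cauchy-Schwarz on the right. Both bounds follow
  -- from this single inequality.
  have e2 : (E + μ * U) ^ 2 ≤ F * U := by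
    rw [← e] at hcs
    have : ‖(E : ℂ) + μ * U‖ = E + μ * U := by
      rw [← Complex.ofReal_mul, ← Complex.ofReal_add, Complex.norm_real, Real.norm_eq_abs,
        abs_of_nonneg (by positivity)]
    rwa [this] at hcs
  have hE1 : 0 ≤ μ * U := by positivity
  have h1 : μ ^ 2 * U ≤ F := by
    rcases hU0.eq_or_lt with h0 | h0
    · rw [← h0]; simpa using hF0
    · have : μ ^ 2 * U * U ≤ F * U := by nlinarith
      exact le_of_mul_le_mul_right this h0
  refine ⟨h1, ?_⟩
  have h2 : (μ * E) ^ 2 ≤ F ^ 2 := by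
    have : (μ * E) ^ 2 ≤ F * (μ ^ 2 * U) := by
      have h3 : E ^ 2 ≤ F * U := by nlinarith
      calc (μ * E) ^ 2 = μ ^ 2 * E ^ 2 := by ring
        _ ≤ μ ^ 2 * (F * U) := by gcongr
        _ = _ := by ring
    nlinarith
  exact abs_le_of_sq_le_sq' h2 hF0 |>.2

lemma J₁_indicator {Ω : Set (ℝ × ℝ)} {ε : ℝ} (hΩ : strip ε ⊆ Ω) (u : ℝ × ℝ → ℂ) :
    J₁ ε (Ω.indicator u) = J₁ ε u := by
  ext x
  rw [J₁, J₁]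
  congr 1
  refine setIntegral_congr_fun measurableSet_Ioo fun y hy => ?_
  exact Set.indicator_of_mem (hΩ ⟨hy.1, hy.2⟩) u

lemma IsRoom.J₂_indicator {B Ω : Set (ℝ × ℝ)} (hB : IsRoom B) {ε h : ℝ} (hε : 0 < ε)
    (hΩ : ∀ j, room B ε h j ⊆ Ω) (u : ℝ × ℝ → ℂ) :
    J₂ B ε h (Ω.indicator u) = J₂ B ε h u := by
  ext x
  rw [J₂, J₂]
  congr 1; ext j
  rw [setIntegral_congr_fun (isOpen_room hB.isOpen hε).measurableSet
    (fun y hy => Set.indicator_of_mem (hΩ j hy) u)]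

/-! ### The averaged equation in a period of the waveguide -/

section Decomposition

variable {B : Set (ℝ × ℝ)} {ε d h : ℝ}

lemma passage_disjoint (hε : 0 < ε) (hdε : d ≤ ε) :
    Pairwise (Function.onFun Disjoint fun j => passage ε d h j) := by
  intro i j hij
  refine Set.disjoint_left.2 fun x hi hj => hij ?_
  exact cell_disjoint hε (hi.1.trans_le (by linarith)) (hj.1.trans_le (by linarith))

/-- Decomposition of an integral over the waveguide. -/
lemma IsRoom.setIntegral_waveguide (hB : IsRoom B) (hε : 0 < ε) (hdε : d ≤ ε) (hh : 0 < h)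
    {F : ℝ × ℝ → ℂ} (hF : IntegrableOn F (waveguide B ε d h)) (J : Finset ℤ)
    (hr : ∀ j ∉ J, ∀ x ∈ room B ε h j, F x = 0) (hp : ∀ j ∉ J, ∀ x ∈ passage ε d h j, F x = 0) :
    ∫ x in waveguide B ε d h, F x = (∫ x in strip ε, F x)
      + ((∑ j ∈ J, ∫ x in room B ε h j, F x) + ∑ j ∈ J, ∫ x in passage ε d h j, F x) := by
  set R : Set (ℝ × ℝ) := ⋃ j ∈ J, room B ε h j with hR
  set T : Set (ℝ × ℝ) := ⋃ j ∈ J, passage ε d h j with hT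
  have hRm : MeasurableSet R :=
    Finset.measurableSet_biUnion _ fun j _ => (isOpen_room hB.isOpen hε).measurableSet
  have hTm : MeasurableSet T := Finset.measurableSet_biUnion _ fun j _ => measurableSet_passage
  have hRΩ : R ⊆ waveguide B ε d h := Set.iUnion₂_subset fun j _ => room_subset_waveguide
  have hTΩ : T ⊆ waveguide B ε d h := Set.iUnion₂_subset fun j _ => passage_subset_waveguide
  have hRT : Disjoint R T := by
    refine Set.disjoint_left.2 fun x hx hx' => ?_
    obtain ⟨i, _, hi⟩ := Set.mem_iUnion₂.1 hx
    obtain ⟨j, _, hj⟩ := Set.mem_iUnion₂.1 hx'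
    exact absurd (hB.mem_room hε hi).2 (not_lt.2 hj.2.2)
  have hS : Disjoint (strip ε) (R ∪ T) := by
    refine Set.disjoint_left.2 fun x hx hx' => ?_
    rcases hx' with hx' | hx'
    · obtain ⟨i, _, hi⟩ := Set.mem_iUnion₂.1 hx'
      have h1 := (hB.mem_room hε hi).2
      have h2 := hx.2
      linarith
    · obtain ⟨i, _, hi⟩ := Set.mem_iUnion₂.1 hx'
      exact absurd hx.2 (not_lt.2 hi.2.1)
  have hsub : strip ε ∪ (R ∪ T) ⊆ waveguide B ε d h :=
    Set.union_subset strip_subset_waveguide (Set.union_subset hRΩ hTΩ)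
  -- The rooms and passages with index outside `J` contribute nothing, which leaves a finite
  -- disjoint union.
  have e : ∫ x in waveguide B ε d h, F x = ∫ x in strip ε ∪ (R ∪ T), F x := by
    refine setIntegral_eq_of_subset_of_forall_sdiff_eq_zero (measurableSet_waveguide hB.isOpen hε)
      hsub fun x hx => ?_
    rcases hx.1 with h1 | h1
    · exact absurd (Or.inl h1) hx.2
    · obtain ⟨j, hj | hj⟩ := Set.mem_iUnion.1 h1
      · refine hr j (fun hJ => hx.2 (Or.inr (Or.inl ?_))) x hj
        exact Set.mem_iUnion₂.2 ⟨j, hJ, hj⟩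
      · refine hp j (fun hJ => hx.2 (Or.inr (Or.inr ?_))) x hj
        exact Set.mem_iUnion₂.2 ⟨j, hJ, hj⟩
  rw [e, setIntegral_union hS (hRm.union hTm) (hF.mono_set strip_subset_waveguide)
    (hF.mono_set (Set.union_subset hRΩ hTΩ)), setIntegral_union hRT hTm (hF.mono_set hRΩ)
    (hF.mono_set hTΩ), integral_biUnion_finset J
      (fun j _ => (isOpen_room hB.isOpen hε).measurableSet)
      (fun i _ j _ hij => hB.disjoint_room hε hij)
      (fun j _ => hF.mono_set room_subset_waveguide), integral_biUnion_finset J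
      (fun j _ => measurableSet_passage) (fun i _ j _ hij => passage_disjoint hε hdε hij)
      (fun j _ => hF.mono_set passage_subset_waveguide)]

lemma volume_passage (hd : 0 < d) (hh : 0 < h) (j : ℤ) :
    volume.real (passage ε d h j) = d * h ∧ volume (passage ε d h j) ≠ ⊤ := by
  rw [passage_eq_prod, Measure.volume_eq_prod, measureReal_def, Measure.prod_prod,
    Real.volume_Ioo, Real.volume_Icc]
  refine ⟨?_, ENNReal.mul_ne_top ENNReal.ofReal_ne_top ENNReal.ofReal_ne_top⟩
  rw [ENNReal.toReal_mul, ENNReal.toReal_ofReal (by linarith), ENNReal.toReal_ofReal (by linarith)]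
  ring

/-- The integrals over finitely many passages. -/
lemma sum_passage_sq_le (hε : 0 < ε) (hdε : d ≤ ε) (hd : 0 < d) (hh : 0 < h) {g : ℝ × ℝ → ℂ}
    (hg : MemLp g 2) (J : Finset ℤ) {E : ℝ} (hE : ∫ x, ‖g x‖ ^ 2 ≤ E) :
    ∑ j ∈ J, ∫ x in passage ε d h j, ‖g x‖ ≤ √(J.card * (d * h) * E) := by
  set T : Set (ℝ × ℝ) := ⋃ j ∈ J, passage ε d h j with hT
  have hf (j : ℤ) : IntegrableOn (fun x => ‖g x‖) (passage ε d h j) := by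
    have : IsFiniteMeasure (volume.restrict (passage ε d h j)) :=
      ⟨by simpa using (volume_passage hd hh j).2.lt_top⟩
    exact ((hg.restrict _).integrable (by norm_num)).norm
  have e1 : ∑ j ∈ J, ∫ x in passage ε d h j, ‖g x‖ = ∫ x in T, ‖g x‖ :=
    (integral_biUnion_finset J (fun j _ => measurableSet_passage)
      (fun i _ j _ hij => passage_disjoint hε hdε hij) (fun j _ => hf j)).symm
  have e2 : volume.real T = J.card * (d * h) := by
    rw [hT, measureReal_biUnion_finset (fun i _ j _ hij => passage_disjoint hε hdε hij)
      (fun j _ => measurableSet_passage) (fun j _ => (volume_passage hd hh j).2)]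
    simp only [(volume_passage hd hh _).1, Finset.sum_const, nsmul_eq_mul]
  have e3 : volume T ≠ ⊤ :=
    (measure_biUnion_lt_top J.finite_toSet fun j _ => (volume_passage hd hh j).2.lt_top).ne
  rw [e1]
  refine Real.le_sqrt_of_sq_le ((norm_setIntegral_sq_le e3 (hg.restrict T)).trans ?_)
  rw [e2]
  gcongr
  exact (setIntegral_le_integral hg.integrable_norm_sq
    (Eventually.of_forall fun x => by positivity)).trans hE

end Decomposition

/-- Pairs of smooth functions on the line with given bounds and supports. -/
structure IsTestPair (φ₁ φ₂ : ℝ → ℝ) (M A : ℝ) : Prop where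
  contDiff_fst : ContDiff ℝ ∞ φ₁
  contDiff_snd : ContDiff ℝ ∞ φ₂
  bound_fst : ∀ x, |φ₁ x| ≤ M
  bound_deriv : ∀ x, |deriv φ₁ x| ≤ M
  bound_snd : ∀ x, |φ₂ x| ≤ M
  supp_fst : ∀ x, A ≤ |x| → φ₁ x = 0
  supp_deriv : ∀ x, A ≤ |x| → deriv φ₁ x = 0
  supp_snd : ∀ x, A ≤ |x| → φ₂ x = 0

lemma abs_sub_le_of_abs_deriv_le {φ : ℝ → ℝ} {M : ℝ} (h : Differentiable ℝ φ)
    (hM : ∀ x, |deriv φ x| ≤ M) (x y : ℝ) : |φ x - φ y| ≤ M * |x - y| := by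
  have := convex_univ.norm_image_sub_le_of_norm_deriv_le (f := φ) (C := M)
    (fun x _ => h x) (fun x _ => hM x) (Set.mem_univ y) (Set.mem_univ x)
  simpa using this

/-- Cauchy-Schwarz over the cells of `J`; the energies add up to at most `E` because the cells are
disjoint. -/
lemma sum_flux_error_le {B : Set (ℝ × ℝ)} (hB : IsOpen B) {ε d h : ℝ} (hε : 0 < ε)
    {G : ℝ × ℝ → ℝ} (hG : Integrable G) (hG0 : ∀ x, 0 ≤ G x) {K E M : ℝ} (hK : 0 ≤ K)
    (hM : 0 ≤ M) (hE : ∫ x, G x ≤ E) {e : ℤ → ℂ} {ψ : ℤ → ℝ} (hψ : ∀ j, |ψ j| ≤ M)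
    (he : ∀ j, ‖e j‖ ^ 2 ≤ K * ∫ x in cell B ε d h j, G x) (J : Finset ℤ) :
    ‖∑ j ∈ J, ((ψ j : ℝ) : ℂ) * e j‖ ≤ M * √(J.card * K * E) := by
  have h1 : ‖∑ j ∈ J, ((ψ j : ℝ) : ℂ) * e j‖ ≤ M * ∑ j ∈ J, ‖e j‖ := by
    rw [Finset.mul_sum]
    refine (norm_sum_le _ _).trans (Finset.sum_le_sum fun j _ => ?_)
    rw [norm_mul, Complex.norm_real]
    exact mul_le_mul_of_nonneg_right (hψ j) (norm_nonneg _)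
  refine h1.trans (mul_le_mul_of_nonneg_left (Real.le_sqrt_of_sq_le ?_) hM)
  have hd : Pairwise (Function.onFun Disjoint fun j => cell B ε d h j) := by
    intro i j hij
    exact Set.disjoint_left.2 fun x hi hj => hij (cell_disjoint hε hi.2 hj.2)
  have h2 : ∑ j ∈ J, ∫ x in cell B ε d h j, G x ≤ E := by
    rw [← integral_biUnion_finset J (fun j _ => measurableSet_cell hB hε)
      (fun i _ j _ hij => hd hij) (fun j _ => hG.integrableOn)]
    exact (setIntegral_le_integral hG (Eventually.of_forall hG0)).trans hE
  calc (∑ j ∈ J, ‖e j‖) ^ 2 ≤ J.card * ∑ j ∈ J, ‖e j‖ ^ 2 := sq_sum_le_card_mul_sum_sq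
    _ ≤ J.card * ∑ j ∈ J, K * ∫ x in cell B ε d h j, G x := by
        gcongr with j _
        exact he j
    _ = J.card * K * ∑ j ∈ J, ∫ x in cell B ε d h j, G x := by
        rw [← Finset.mul_sum]; ring
    _ ≤ J.card * K * E := by gcongr

section Equation

variable {B : Set (ℝ × ℝ)} {ε d h M A μ : ℝ} {φ₁ φ₂ : ℝ → ℝ} {u u₁ u₂ f : ℝ × ℝ → ℂ}

/-- The integrand of the weak formulation. -/
noncomputable def weakIntegrand (ε h μ : ℝ) (φ₁ φ₂ : ℝ → ℝ) (u u₁ u₂ f : ℝ × ℝ → ℂ)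
    (x : ℝ × ℝ) : ℂ :=
  u₁ x * ((testFunFst h φ₁ x : ℝ) : ℂ) + u₂ x * ((testFunSnd ε h φ₁ φ₂ x : ℝ) : ℂ)
    + μ * (u x * ((testFun ε h φ₁ φ₂ x : ℝ) : ℂ)) - f x * ((testFun ε h φ₁ φ₂ x : ℝ) : ℂ)

lemma weakIntegrand_of_strip (hh : 0 < h) {x : ℝ × ℝ} (hx : x ∈ strip ε) :
    weakIntegrand ε h μ φ₁ φ₂ u u₁ u₂ f x = u₁ x * ((deriv φ₁ x.1 : ℝ) : ℂ)
      + μ * (u x * ((φ₁ x.1 : ℝ) : ℂ)) - f x * ((φ₁ x.1 : ℝ) : ℂ) := by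
  have h2 : ¬ (0 ≤ x.2 ∧ x.2 ≤ h) := fun hc => absurd hx.2 (not_lt.2 hc.1)
  simp [weakIntegrand, testFun, testFunFst, testFunSnd, ramp_of_nonpos hh hx.2.le, h2]

lemma IsRoom.weakIntegrand_of_room (hB : IsRoom B) (hε : 0 < ε) (hh : 0 < h) {j : ℤ} {x : ℝ × ℝ}
    (hx : x ∈ room B ε h j) : weakIntegrand ε h μ φ₁ φ₂ u u₁ u₂ f x
      = ((φ₂ (cellCenter ε j) : ℝ) : ℂ) * (μ * u x - f x) := by
  obtain ⟨h1, h2⟩ := hB.mem_room hε hx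
  have h3 : ¬ (0 ≤ x.2 ∧ x.2 ≤ h) := fun hc => absurd h2 (not_lt.2 hc.2)
  simp only [weakIntegrand, testFun, testFunFst, testFunSnd, ramp_of_ge hh h2.le, if_neg h3,
    nearestCenter_eq hε h1]
  push_cast
  ring

/-- The only term of order `h⁻¹` is the vertical one. Freezing `φ₁` at the centre of the cell costs
`M ε h⁻¹ |u₂|`; the other terms are bounded by `M` times the data. -/
lemma norm_weakIntegrand_sub_le (hφ : IsTestPair φ₁ φ₂ M A) (hε : 0 < ε) (hdε : d ≤ ε)
    (hh : 0 < h) (hμ : 0 < μ) {j : ℤ} {x : ℝ × ℝ} (hx : x ∈ passage ε d h j) :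
    ‖weakIntegrand ε h μ φ₁ φ₂ u u₁ u₂ f x
        - ((h⁻¹ * (φ₂ (cellCenter ε j) - φ₁ (cellCenter ε j)) : ℝ) : ℂ) * u₂ x‖
      ≤ M * (‖u₁ x‖ + μ * ‖u x‖ + ‖f x‖ + ε * h⁻¹ * ‖u₂ x‖) := by
  have hxc : |x.1 - cellCenter ε j| < ε / 2 := hx.1.trans_le (by linarith)
  have hM0 : 0 ≤ M := (abs_nonneg _).trans (hφ.bound_fst 0)
  have e : weakIntegrand ε h μ φ₁ φ₂ u u₁ u₂ f x
        - ((h⁻¹ * (φ₂ (cellCenter ε j) - φ₁ (cellCenter ε j)) : ℝ) : ℂ) * u₂ x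
      = u₁ x * ((testFunFst h φ₁ x : ℝ) : ℂ) + μ * (u x * ((testFun ε h φ₁ φ₂ x : ℝ) : ℂ))
        - f x * ((testFun ε h φ₁ φ₂ x : ℝ) : ℂ)
        + ((h⁻¹ * (φ₁ (cellCenter ε j) - φ₁ x.1) : ℝ) : ℂ) * u₂ x := by
    simp only [weakIntegrand, testFunSnd, if_pos hx.2, nearestCenter_eq hε hxc]
    push_cast
    ring
  have b1 := abs_testFunFst_le (h := h) hφ.bound_deriv x
  have b2 := abs_testFun_le (ε := ε) (h := h) hφ.bound_fst hφ.bound_snd x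
  have b3 : |φ₁ (cellCenter ε j) - φ₁ x.1| ≤ M * ε := by
    refine (abs_sub_le_of_abs_deriv_le (hφ.contDiff_fst.differentiable (by simp))
      hφ.bound_deriv _ _).trans ?_
    rw [abs_sub_comm]
    gcongr
    linarith
  rw [e]
  refine (norm_add_le _ _).trans ?_
  refine (add_le_add_left ((norm_sub_le _ _).trans (add_le_add_left (norm_add_le _ _) _)) _).trans ?_
  simp only [norm_mul, Complex.norm_real, Real.norm_eq_abs, abs_of_pos hμ, abs_of_pos (inv_pos.2 hh)]
  have t1 : ‖u₁ x‖ * |testFunFst h φ₁ x| ≤ ‖u₁ x‖ * M := by gcongr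
  have t2 : μ * (‖u x‖ * |testFun ε h φ₁ φ₂ x|) ≤ μ * (‖u x‖ * M) := by gcongr
  have t3 : ‖f x‖ * |testFun ε h φ₁ φ₂ x| ≤ ‖f x‖ * M := by gcongr
  have t4 : h⁻¹ * |φ₁ (cellCenter ε j) - φ₁ x.1| * ‖u₂ x‖ ≤ h⁻¹ * (M * ε) * ‖u₂ x‖ := by gcongr
  linarith

lemma IsTestPair.isH1_testFun (hφ : IsTestPair φ₁ φ₂ M A) (hB : IsRoom B) (hε : 0 < ε)
    (hh : 0 < h) (hdε : d ≤ ε) :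
    IsH1 (waveguide B ε d h) (fun x => ((testFun ε h φ₁ φ₂ x : ℝ) : ℂ))
      (fun x => ((testFunFst h φ₁ x : ℝ) : ℂ)) (fun x => ((testFunSnd ε h φ₁ φ₂ x : ℝ) : ℂ)) :=
  hB.isH1_testFun hε hh hdε hφ.contDiff_fst hφ.contDiff_snd.continuous hφ.bound_fst
    hφ.bound_deriv hφ.bound_snd hφ.supp_fst hφ.supp_deriv hφ.supp_snd

/-- The averaged equation with its remainder in explicit form. -/
lemma IsRoom.averaged_identity (hB : IsRoom B) (hφ : IsTestPair φ₁ φ₂ M A) (hε : 0 < ε)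
    (hdε : d ≤ ε) (hh : 0 < h) (hg : HasGrad (waveguide B ε d h) u u₁ u₂)
    (hf : MemLp f 2) (J : Finset ℤ) (hJ : ∀ j ∉ J, A + ε ≤ |cellCenter ε j|)
    (hweak : (∫ x in waveguide B ε d h, (u₁ x * ((testFunFst h φ₁ x : ℝ) : ℂ)
        + u₂ x * ((testFunSnd ε h φ₁ φ₂ x : ℝ) : ℂ)))
      + μ * ∫ x in waveguide B ε d h, u x * ((testFun ε h φ₁ φ₂ x : ℝ) : ℂ)
      = ∫ x in waveguide B ε d h, f x * ((testFun ε h φ₁ φ₂ x : ℝ) : ℂ)) :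
    (∫ x, J₁ ε u₁ x * ((deriv φ₁ x : ℝ) : ℂ)) + μ * (∫ x, J₁ ε u x * ((φ₁ x : ℝ) : ℂ))
      + μ * (((√(volume.real B) : ℝ) : ℂ)
        * ∫ x, J₂ B ε h u x * ((φ₂ (nearestCenter ε x) : ℝ) : ℂ))
      - (∫ x, J₁ ε f x * ((φ₁ x : ℝ) : ℂ))
      - ((√(volume.real B) : ℝ) : ℂ)
        * (∫ x, J₂ B ε h f x * ((φ₂ (nearestCenter ε x) : ℝ) : ℂ))
      + ((1 / √ε : ℝ) : ℂ) * ∑ j ∈ J, ∫ x in passage ε d h j,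
          weakIntegrand ε h μ φ₁ φ₂ u u₁ u₂ f x = 0 := by
  set Ω := waveguide B ε d h with hΩ
  have hv := hφ.isH1_testFun hB hε hh hdε
  have i1 : IntegrableOn (fun x => u₁ x * ((testFunFst h φ₁ x : ℝ) : ℂ)) Ω :=
    (hg.memLp_fst.restrict Ω).integrable_mul hv.memLp_fst
  have i2 : IntegrableOn (fun x => u₂ x * ((testFunSnd ε h φ₁ φ₂ x : ℝ) : ℂ)) Ω :=
    (hg.memLp_snd.restrict Ω).integrable_mul hv.memLp_snd
  have i3 : IntegrableOn (fun x => u x * ((testFun ε h φ₁ φ₂ x : ℝ) : ℂ)) Ω :=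
    (hg.memLp.restrict Ω).integrable_mul hv.memLp
  have i4 : IntegrableOn (fun x => f x * ((testFun ε h φ₁ φ₂ x : ℝ) : ℂ)) Ω :=
    (hf.restrict Ω).integrable_mul hv.memLp
  have i12 : IntegrableOn (fun x => u₁ x * ((testFunFst h φ₁ x : ℝ) : ℂ)
    + u₂ x * ((testFunSnd ε h φ₁ φ₂ x : ℝ) : ℂ)) Ω := i1.add i2
  have i123 : IntegrableOn (fun x => u₁ x * ((testFunFst h φ₁ x : ℝ) : ℂ)
    + u₂ x * ((testFunSnd ε h φ₁ φ₂ x : ℝ) : ℂ)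
    + μ * (u x * ((testFun ε h φ₁ φ₂ x : ℝ) : ℂ))) Ω := i12.add (i3.const_mul _)
  have iF : IntegrableOn (weakIntegrand ε h μ φ₁ φ₂ u u₁ u₂ f) Ω := i123.sub i4
  have h0 : ∫ x in Ω, weakIntegrand ε h μ φ₁ φ₂ u u₁ u₂ f x = 0 := by
    simp only [weakIntegrand]
    rw [integral_sub i123 i4, integral_add i12 (i3.const_mul _), integral_const_mul, hweak,
      sub_self]
  -- The margin `ε` in `hJ` ensures that both test functions vanish on the whole of a discarded
  -- cell, not only at its centre.
  have hfar (j : ℤ) (hj : j ∉ J) (x : ℝ) (hx : |x - cellCenter ε j| < ε / 2) : A ≤ |x| := by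
    have h1 := hJ j hj
    have h2 := abs_sub_abs_le_abs_sub (cellCenter ε j) x
    rw [abs_sub_comm] at h2
    linarith
  have hfar' (j : ℤ) (hj : j ∉ J) : A ≤ |cellCenter ε j| := by linarith [hJ j hj]
  have hdec := hB.setIntegral_waveguide hε hdε hh iF J
    (fun j hj x hx => by
      rw [hB.weakIntegrand_of_room hε hh hx, hφ.supp_snd _ (hfar' j hj)]; simp)
    (fun j hj x hx => by
      have hxc : |x.1 - cellCenter ε j| < ε / 2 := hx.1.trans_le (by linarith)
      have hx1 := hfar j hj x.1 hxc
      simp [weakIntegrand, testFun, testFunFst, testFunSnd, nearestCenter_eq hε hxc,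
        hφ.supp_snd _ (hfar' j hj), hφ.supp_fst _ hx1, hφ.supp_deriv _ hx1])
  rw [h0] at hdec
  have c1 := hφ.contDiff_fst.continuous.measurable
  have c1' := (hφ.contDiff_fst.continuous_deriv (by simp)).measurable
  have s1 := integrableOn_strip_mul (ε := ε) hg.memLp_fst c1' hφ.bound_deriv hφ.supp_deriv
  have s2 := integrableOn_strip_mul (ε := ε) hg.memLp c1 hφ.bound_fst hφ.supp_fst
  have s3 := integrableOn_strip_mul (ε := ε) hf c1 hφ.bound_fst hφ.supp_fst
  have s12 : IntegrableOn (fun x => u₁ x * ((deriv φ₁ x.1 : ℝ) : ℂ)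
      + μ * (u x * ((φ₁ x.1 : ℝ) : ℂ))) (strip ε) := s1.add (s2.const_mul _)
  have eS : ∫ x in strip ε, weakIntegrand ε h μ φ₁ φ₂ u u₁ u₂ f x
      = (∫ x in strip ε, u₁ x * ((deriv φ₁ x.1 : ℝ) : ℂ))
        + μ * (∫ x in strip ε, u x * ((φ₁ x.1 : ℝ) : ℂ))
        - ∫ x in strip ε, f x * ((φ₁ x.1 : ℝ) : ℂ) := by
    rw [setIntegral_congr_fun isOpen_strip.measurableSet fun x hx => weakIntegrand_of_strip hh hx,
      integral_sub s12 s3, integral_add s1 (s2.const_mul _), integral_const_mul]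
  have iu {g : ℝ × ℝ → ℂ} (hg : MemLp g 2) (j : ℤ) : IntegrableOn g (room B ε h j) := by
    have : IsFiniteMeasure (volume.restrict (room B ε h j)) :=
      ⟨by simpa using (hB.volume_room_ne_top hε j).lt_top⟩
    exact (hg.restrict _).integrable (by norm_num)
  have eR (j : ℤ) : ∫ x in room B ε h j, weakIntegrand ε h μ φ₁ φ₂ u u₁ u₂ f x
      = μ * (((φ₂ (cellCenter ε j) : ℝ) : ℂ) * ∫ x in room B ε h j, u x)
        - ((φ₂ (cellCenter ε j) : ℝ) : ℂ) * ∫ x in room B ε h j, f x := by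
    rw [setIntegral_congr_fun (isOpen_room hB.isOpen hε).measurableSet
      fun x hx => hB.weakIntegrand_of_room hε hh hx, integral_const_mul,
      integral_sub ((iu hg.memLp j).const_mul _) (iu hf j), integral_const_mul]
    ring
  simp only [eR, Finset.sum_sub_distrib, ← Finset.mul_sum] at hdec
  rw [eS] at hdec
  have hJ2 : ∀ j ∉ J, φ₂ (cellCenter ε j) = 0 := fun j hj => hφ.supp_snd _ (hfar' j hj)
  rw [integral_J₁_mul _ s1, integral_J₁_mul _ s2, integral_J₁_mul _ s3,
    hB.integral_J₂_mul_step hε φ₂ J hJ2, hB.integral_J₂_mul_step hε φ₂ J hJ2]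
  linear_combination -((1 / √ε : ℝ) : ℂ) * hdec

end Equation

/-- The averaged equation: the flux through the passages is expressed by the averages over the
rooms and the strip, up to a controlled error. -/
theorem IsRoom.exists_averaged_equation {B : Set (ℝ × ℝ)} (hB : IsRoom B) :
    ∃ δ C : ℝ, 0 < δ ∧ 0 ≤ C ∧ ∀ (ε d h M A μ E : ℝ) (N : ℕ) (φ₁ φ₂ : ℝ → ℝ)
      (u u₁ u₂ f : ℝ × ℝ → ℂ) (J : Finset ℤ), IsTestPair φ₁ φ₂ M A → 0 < ε → 0 < d → d ≤ ε →
      0 < h → 0 < μ → 2 ^ (N + 1) * d ≤ ε * δ → ε * δ < 2 ^ (N + 2) * d →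
      HasGrad (waveguide B ε d h) u u₁ u₂ → MemLp f 2 → ∫ x, ‖u x‖ ^ 2 ≤ E →
      ∫ x, (‖u₁ x‖ ^ 2 + ‖u₂ x‖ ^ 2) ≤ E → ∫ x, ‖f x‖ ^ 2 ≤ E →
      (∀ j ∉ J, A + ε ≤ |cellCenter ε j|) →
      (∫ x in waveguide B ε d h, (u₁ x * ((testFunFst h φ₁ x : ℝ) : ℂ)
          + u₂ x * ((testFunSnd ε h φ₁ φ₂ x : ℝ) : ℂ)))
        + μ * ∫ x in waveguide B ε d h, u x * ((testFun ε h φ₁ φ₂ x : ℝ) : ℂ)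
        = ∫ x in waveguide B ε d h, f x * ((testFun ε h φ₁ φ₂ x : ℝ) : ℂ) →
      ‖(∫ x, J₁ ε u₁ x * ((deriv φ₁ x : ℝ) : ℂ)) + μ * (∫ x, J₁ ε u x * ((φ₁ x : ℝ) : ℂ))
        + μ * (((√(volume.real B) : ℝ) : ℂ)
          * ∫ x, J₂ B ε h u x * ((φ₂ (nearestCenter ε x) : ℝ) : ℂ))
        + ((d / (h * ε ^ 2 * volume.real B) : ℝ) : ℂ) * (((√(volume.real B) : ℝ) : ℂ)
            * (∫ x, J₂ B ε h u x *
              ((φ₂ (nearestCenter ε x) - φ₁ (nearestCenter ε x) : ℝ) : ℂ))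
          - ((volume.real B : ℝ) : ℂ) * ∫ x, J₁ ε u x *
              ((φ₂ (nearestCenter ε x) - φ₁ (nearestCenter ε x) : ℝ) : ℂ))
        - (∫ x, J₁ ε f x * ((φ₁ x : ℝ) : ℂ))
        - ((√(volume.real B) : ℝ) : ℂ)
          * (∫ x, J₂ B ε h f x * ((φ₂ (nearestCenter ε x) : ℝ) : ℂ))‖
      ≤ 1 / √ε * (d / h * (2 * M * √(J.card * (C * (N + 1)) * E))
          + M * ((2 + μ + ε * h⁻¹) * √(J.card * (d * h) * E))) := by
  obtain ⟨δ, C, hδ, -, hC, hflux⟩ := hB.exists_flux_estimate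
  refine ⟨δ, C, hδ, hC, ?_⟩
  intro ε d h M A μ E N φ₁ φ₂ u u₁ u₂ f J hφ hε hd hdε hh hμ hN1 hN2 hg hf hEu hEg hEf hJ hweak
  have hb := hB.volume_real_pos
  have hM0 : 0 ≤ M := (abs_nonneg _).trans (hφ.bound_fst 0)
  set b := volume.real B with hbdef
  have hid := hB.averaged_identity hφ hε hdε hh hg hf J hJ hweak
  set ψ : ℝ → ℝ := fun x => φ₂ x - φ₁ x with hψ
  have hfar (j : ℤ) (hj : j ∉ J) : A ≤ |cellCenter ε j| := by linarith [hJ j hj]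
  have hψJ : ∀ j ∉ J, ψ (cellCenter ε j) = 0 := fun j hj => by
    simp [hψ, hφ.supp_snd _ (hfar j hj), hφ.supp_fst _ (hfar j hj)]
  have hψM (j : ℤ) : |ψ (cellCenter ε j)| ≤ 2 * M := by
    refine (abs_sub _ _).trans ?_
    linarith [hφ.bound_fst (cellCenter ε j), hφ.bound_snd (cellCenter ε j)]
  set W := weakIntegrand ε h μ φ₁ φ₂ u u₁ u₂ f with hW
  set e : ℤ → ℂ := fun j => (⨍ x in room B ε h j, u x)
    - (⨍ x in rect (cellCenter ε j) (-(ε / 2)) (ε / 2) (ε / 2), u x)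
    - (d : ℂ)⁻¹ * ∫ x in passage ε d h j, u₂ x with he
  have hsum1 := sum_flux_error_le hB.isOpen (d := d) (h := h) hε hg.integrable_energy
    (fun x => by positivity)
    (K := C * (N + 1)) (E := E) (M := 2 * M) (by positivity) (by positivity) hEg (e := e)
    (ψ := fun j => ψ (cellCenter ε j)) hψM
    (fun j => hflux ε d h N j u u₁ u₂ hε hd hh hN1 hN2 hg) J
  -- What remains of a passage after its flux term is removed; it is small because the passages have
  -- small total area.
  set R : ℤ → ℂ := fun j => ∫ x in passage ε d h j,
    (W x - ((h⁻¹ * ψ (cellCenter ε j) : ℝ) : ℂ) * u₂ x) with hR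
  have hL2 {g : ℝ × ℝ → ℂ} (hg : MemLp g 2) (j : ℤ) : IntegrableOn g (passage ε d h j) := by
    have : IsFiniteMeasure (volume.restrict (passage ε d h j)) :=
      ⟨by simpa using (volume_passage hd hh j).2.lt_top⟩
    exact (hg.restrict _).integrable (by norm_num)
  have hWi : IntegrableOn W (waveguide B ε d h) := by
    have hv := hφ.isH1_testFun hB hε hh hdε
    exact ((((hg.memLp_fst.restrict _).integrable_mul hv.memLp_fst).add
      ((hg.memLp_snd.restrict _).integrable_mul hv.memLp_snd)).add
      (((hg.memLp.restrict _).integrable_mul hv.memLp).const_mul _)).sub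
      ((hf.restrict _).integrable_mul hv.memLp)
  have hRW (j : ℤ) : ∫ x in passage ε d h j, W x
      = R j + ((h⁻¹ * ψ (cellCenter ε j) : ℝ) : ℂ) * ∫ x in passage ε d h j, u₂ x := by
    rw [hR]
    simp only
    rw [integral_sub (hWi.mono_set passage_subset_waveguide)
      ((hL2 hg.memLp_snd j).const_mul _), integral_const_mul]
    ring
  have hsum2 : ‖∑ j ∈ J, R j‖ ≤ M * ((2 + μ + ε * h⁻¹) * √(J.card * (d * h) * E)) := by
    have hRj (j : ℤ) : ‖R j‖ ≤ M * ((∫ x in passage ε d h j, ‖u₁ x‖)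
        + μ * (∫ x in passage ε d h j, ‖u x‖) + (∫ x in passage ε d h j, ‖f x‖)
        + ε * h⁻¹ * ∫ x in passage ε d h j, ‖u₂ x‖) := by
      have i1 := (hL2 hg.memLp_fst j).norm
      have i2 := (hL2 hg.memLp j).norm.const_mul μ
      have i3 := (hL2 hf j).norm
      have i4 := (hL2 hg.memLp_snd j).norm.const_mul (ε * h⁻¹)
      have i12 : IntegrableOn (fun x => ‖u₁ x‖ + μ * ‖u x‖) (passage ε d h j) := i1.add i2
      have i123 : IntegrableOn (fun x => ‖u₁ x‖ + μ * ‖u x‖ + ‖f x‖) (passage ε d h j) :=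
        i12.add i3
      have i1234 : IntegrableOn (fun x => ‖u₁ x‖ + μ * ‖u x‖ + ‖f x‖ + ε * h⁻¹ * ‖u₂ x‖)
        (passage ε d h j) := i123.add i4
      have : ‖R j‖ ≤ ∫ x in passage ε d h j,
          M * (‖u₁ x‖ + μ * ‖u x‖ + ‖f x‖ + ε * h⁻¹ * ‖u₂ x‖) := by
        refine norm_integral_le_of_norm_le (i1234.const_mul M) ?_
        filter_upwards [ae_restrict_mem measurableSet_passage] with x hx
        exact norm_weakIntegrand_sub_le hφ hε hdε hh hμ hx
      rwa [integral_const_mul, integral_add i123 i4, integral_add i12 i3, integral_add i1 i2,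
        integral_const_mul, integral_const_mul] at this
    have iE1 : ∫ x, ‖u₁ x‖ ^ 2 ≤ E := by
      refine (integral_mono hg.memLp_fst.integrable_norm_sq hg.integrable_energy fun x => ?_).trans hEg
      simp
    have iE2 : ∫ x, ‖u₂ x‖ ^ 2 ≤ E := by
      refine (integral_mono hg.memLp_snd.integrable_norm_sq hg.integrable_energy fun x => ?_).trans hEg
      simp
    have t1 := sum_passage_sq_le hε hdε hd hh hg.memLp_fst J iE1
    have t2 := sum_passage_sq_le hε hdε hd hh hg.memLp J hEu
    have t3 := sum_passage_sq_le hε hdε hd hh hf J hEf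
    have t4 := sum_passage_sq_le hε hdε hd hh hg.memLp_snd J iE2
    have hεh : 0 ≤ ε * h⁻¹ := by positivity
    refine (norm_sum_le _ _).trans ((Finset.sum_le_sum fun j _ => hRj j).trans ?_)
    rw [← Finset.mul_sum]
    refine mul_le_mul_of_nonneg_left ?_ hM0
    simp only [Finset.sum_add_distrib, ← Finset.mul_sum]
    have t2' := mul_le_mul_of_nonneg_left t2 hμ.le
    have t4' := mul_le_mul_of_nonneg_left t4 hεh
    linarith
  have hvr (j : ℤ) : volume.real (room B ε h j) = ε ^ 2 * b := volume_real_room hε j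
  have hvq (j : ℤ) : volume.real (rect (cellCenter ε j) (-(ε / 2)) (ε / 2) (ε / 2)) = ε ^ 2 := by
    rw [volume_real_rect _ _ (by positivity) (by positivity)]; ring
  -- The flux is replaced by `d` times the difference of averages minus `e j`. The areas `ε² b` and
  -- `ε²` turn averages into integrals and give the coefficients `d / (h ε² b)` and `d / (h ε²)`.
  have hterm (j : ℤ) : ∫ x in passage ε d h j, W x = R j
      + ((d / (h * ε ^ 2 * b) : ℝ) : ℂ) * (((ψ (cellCenter ε j) : ℝ) : ℂ)
          * ∫ x in room B ε h j, u x)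
      - ((d / (h * ε ^ 2 * b) : ℝ) : ℂ) * (b : ℂ) * (((ψ (cellCenter ε j) : ℝ) : ℂ)
          * ∫ x in rect (cellCenter ε j) (-(ε / 2)) (ε / 2) (ε / 2), u x)
      - ((d / h : ℝ) : ℂ) * (((ψ (cellCenter ε j) : ℝ) : ℂ) * e j) := by
    have n1 : (d : ℂ) ≠ 0 := by exact_mod_cast hd.ne'
    have n2 : (h : ℂ) ≠ 0 := by exact_mod_cast hh.ne'
    have n3 : (ε : ℂ) ≠ 0 := by exact_mod_cast hε.ne'
    have n4 : (b : ℂ) ≠ 0 := by exact_mod_cast hb.ne'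
    rw [hRW j, he]
    simp only [setAverage_eq, hvr, hvq, Complex.real_smul]
    push_cast
    field_simp
    ring
  have hJ2 := hB.integral_J₂_mul_step (h := h) (u := u) hε ψ J hψJ
  have hJ1 := integral_J₁_mul_step hε hg.memLp ψ J hψJ
  simp only [hterm, Finset.sum_sub_distrib, Finset.sum_add_distrib, ← Finset.mul_sum] at hid
  have hX : ‖((1 / √ε : ℝ) : ℂ) * (((d / h : ℝ) : ℂ)
        * (∑ j ∈ J, ((ψ (cellCenter ε j) : ℝ) : ℂ) * e j) - ∑ j ∈ J, R j)‖
      ≤ 1 / √ε * (d / h * (2 * M * √(J.card * (C * (N + 1)) * E))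
          + M * ((2 + μ + ε * h⁻¹) * √(J.card * (d * h) * E))) := by
    rw [norm_mul, Complex.norm_real, Real.norm_of_nonneg (by positivity)]
    refine mul_le_mul_of_nonneg_left ((norm_sub_le _ _).trans (add_le_add ?_ hsum2)) (by positivity)
    rw [norm_mul, Complex.norm_real, Real.norm_of_nonneg (by positivity)]
    exact mul_le_mul_of_nonneg_left hsum1 (by positivity)
  refine le_of_eq_of_le (congrArg norm ?_) hX
  rw [hJ2, hJ1]
  linear_combination hid

/-! ### Passage to the limit -/

lemma integral_norm_sq_le_of_eLpNorm_le {α : Type*} [MeasurableSpace α] {ν : Measure α}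
    {f : α → ℂ} (hf : MemLp f 2 ν) {C : ℝ≥0} (hC : eLpNorm f 2 ν ≤ C) :
    ∫ x, ‖f x‖ ^ 2 ∂ν ≤ (C : ℝ) ^ 2 := by
  have h : ∫⁻ x, ‖f x‖ₑ ^ 2 ∂ν ≤ (C : ℝ≥0∞) ^ 2 := by
    rw [eLpNorm_eq_lintegral_rpow_enorm_toReal (by norm_num) (by norm_num)] at hC
    simp only [ENNReal.toReal_ofNat, ENNReal.rpow_ofNat] at hC
    calc ∫⁻ x, ‖f x‖ₑ ^ 2 ∂ν = ((∫⁻ x, ‖f x‖ₑ ^ 2 ∂ν) ^ (1 / 2 : ℝ)) ^ 2 := by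
          rw [← ENNReal.rpow_natCast, ← ENNReal.rpow_mul]; norm_num
      _ ≤ _ := by gcongr
  rw [hf.lintegral_enorm_sq, ← ENNReal.coe_pow] at h
  have := ENNReal.toReal_mono ENNReal.coe_ne_top h
  rwa [ENNReal.toReal_ofReal (integral_nonneg fun x => by positivity), ENNReal.coe_toReal,
    NNReal.coe_pow] at this

/-- Packages the weak form for the extensions by zero, with one common bound for `u`, its gradient
and `f`. -/
lemma IsNeumannResolvent.exists_hasGrad {Ω : Set (ℝ × ℝ)} (hΩ : MeasurableSet Ω) {μ F : ℝ}
    (hμ : 0 < μ) {f u : ℝ × ℝ → ℂ} (hf : MemLp f 2 (volume.restrict Ω))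
    (hF : ∫ x in Ω, ‖f x‖ ^ 2 ≤ F) (hu : IsNeumannResolvent Ω μ f u) :
    ∃ w : (ℝ × ℝ → ℂ) × (ℝ × ℝ → ℂ), HasGrad Ω (Ω.indicator u) w.1 w.2 ∧
      ∫ x, ‖Ω.indicator u x‖ ^ 2 ≤ F + F / μ + F / μ ^ 2 ∧
      ∫ x, (‖w.1 x‖ ^ 2 + ‖w.2 x‖ ^ 2) ≤ F + F / μ + F / μ ^ 2 ∧
      ∫ x, ‖Ω.indicator f x‖ ^ 2 ≤ F + F / μ + F / μ ^ 2 ∧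
      ∀ v v₁ v₂ : ℝ × ℝ → ℝ, IsH1 Ω (fun x => ((v x : ℝ) : ℂ)) (fun x => ((v₁ x : ℝ) : ℂ))
          (fun x => ((v₂ x : ℝ) : ℂ)) →
        (∫ x in Ω, (w.1 x * ((v₁ x : ℝ) : ℂ) + w.2 x * ((v₂ x : ℝ) : ℂ)))
          + μ * ∫ x in Ω, Ω.indicator u x * ((v x : ℝ) : ℂ)
          = ∫ x in Ω, Ω.indicator f x * ((v x : ℝ) : ℂ) := by
  obtain ⟨u₁, u₂, hH1, hweak, hU, hE⟩ := hu.exists_weak_form hμ hf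
  have hF0 : 0 ≤ F := (integral_nonneg fun x => by positivity).trans hF
  have hFμ : 0 ≤ F / μ := by positivity
  have hFμ2 : 0 ≤ F / μ ^ 2 := by positivity
  have hsq (g : ℝ × ℝ → ℂ) (x : ℝ × ℝ) :
      ‖Ω.indicator g x‖ ^ 2 = Ω.indicator (fun x => ‖g x‖ ^ 2) x := by
    by_cases hx : x ∈ Ω <;> simp [hx]
  have hind (g : ℝ × ℝ → ℂ) : ∫ x, ‖Ω.indicator g x‖ ^ 2 = ∫ x in Ω, ‖g x‖ ^ 2 := by
    simp only [hsq]
    exact integral_indicator hΩ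
  refine ⟨(Ω.indicator u₁, Ω.indicator u₂), hH1.hasGrad_indicator hΩ, ?_, ?_, ?_, ?_⟩
  · rw [hind]
    have : ∫ x in Ω, ‖u x‖ ^ 2 ≤ F / μ ^ 2 := by
      rw [le_div_iff₀' (by positivity)]; exact hU.trans hF
    linarith
  · have e : ∫ x, (‖Ω.indicator u₁ x‖ ^ 2 + ‖Ω.indicator u₂ x‖ ^ 2)
        = ∫ x in Ω, (‖u₁ x‖ ^ 2 + ‖u₂ x‖ ^ 2) := by
      rw [← integral_indicator hΩ]
      congr 1; ext x
      by_cases hx : x ∈ Ω <;> simp [hx]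
    simp only [e]
    have : ∫ x in Ω, (‖u₁ x‖ ^ 2 + ‖u₂ x‖ ^ 2) ≤ F / μ := by
      rw [le_div_iff₀' hμ]; exact hE.trans hF
    linarith
  · rw [hind]; linarith
  · intro v v₁ v₂ hv
    have e := hweak _ _ _ hv
    simp only [Complex.conj_ofReal] at e
    have e1 : ∫ x in Ω, (Ω.indicator u₁ x * ((v₁ x : ℝ) : ℂ) + Ω.indicator u₂ x * ((v₂ x : ℝ) : ℂ))
        = ∫ x in Ω, (u₁ x * ((v₁ x : ℝ) : ℂ) + u₂ x * ((v₂ x : ℝ) : ℂ)) :=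
      setIntegral_congr_fun hΩ fun x hx => by simp [hx]
    have e2 (g : ℝ × ℝ → ℂ) : ∫ x in Ω, Ω.indicator g x * ((v x : ℝ) : ℂ)
        = ∫ x in Ω, g x * ((v x : ℝ) : ℂ) :=
      setIntegral_congr_fun hΩ fun x hx => by simp [hx]
    simp only [e1, e2, e]

/-- The two pairs decouple the averaged equation into one identity for the strip and one for the
rooms. -/
lemma exists_isTestPair {φ : ℝ → ℝ} (h1 : ContDiff ℝ ∞ φ) (h2 : HasCompactSupport φ) :
    ∃ M A : ℝ, 0 ≤ A ∧ IsTestPair φ (fun _ => 0) M A ∧ IsTestPair (fun _ => 0) φ M A := by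
  obtain ⟨M₁, hM₁⟩ := h2.exists_bound_of_continuous h1.continuous
  obtain ⟨M₂, hM₂⟩ := h2.deriv.exists_bound_of_continuous (h1.continuous_deriv (by simp))
  obtain ⟨R, hR⟩ := h2.isCompact.isBounded.subset_closedBall (0 : ℝ)
  have hout (x : ℝ) (hx : |R| + 1 ≤ |x|) : x ∉ tsupport φ := fun hm => by
    have := mem_closedBall_zero_iff.1 (hR hm)
    rw [Real.norm_eq_abs] at this
    linarith [le_abs_self R]
  have hs (x : ℝ) (hx : |R| + 1 ≤ |x|) : φ x = 0 := image_eq_zero_of_notMem_tsupport (hout x hx)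
  have hs' (x : ℝ) (hx : |R| + 1 ≤ |x|) : deriv φ x = 0 := by
    by_contra hc
    exact hout x hx (support_deriv_subset hc)
  have b1 (x : ℝ) : |φ x| ≤ max M₁ M₂ := (hM₁ x).trans (le_max_left _ _)
  have b2 (x : ℝ) : |deriv φ x| ≤ max M₁ M₂ := (hM₂ x).trans (le_max_right _ _)
  have b0 : 0 ≤ max M₁ M₂ := (abs_nonneg _).trans (b1 0)
  refine ⟨max M₁ M₂, |R| + 1, by positivity, ⟨h1, contDiff_const, b1, b2, fun x => ?_, hs, hs',
    fun x _ => rfl⟩, ⟨contDiff_const, h1, fun x => ?_, fun x => ?_, b1, fun x _ => rfl,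
    fun x _ => ?_, hs⟩⟩ <;> simp [b0]

lemma exists_cells {ε A : ℝ} (hε : 0 < ε) (hε1 : ε ≤ 1) (hA : 0 ≤ A) :
    ∃ J : Finset ℤ, (∀ j ∉ J, A + ε ≤ |cellCenter ε j|) ∧ J.card * ε ≤ 2 * A + 7 := by
  set n : ℕ := ⌈(A + 1) / ε⌉₊ + 1 with hn
  have h1 : (A + 1) / ε ≤ ⌈(A + 1) / ε⌉₊ := Nat.le_ceil _
  have h2 : (⌈(A + 1) / ε⌉₊ : ℝ) < (A + 1) / ε + 1 := Nat.ceil_lt_add_one (by positivity)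
  have hn1 : (A + 1) ≤ (n - 1 : ℝ) * ε := by
    rw [hn]; push_cast
    rw [div_le_iff₀ hε] at h1
    linarith
  have hn2 : (n : ℝ) * ε ≤ A + 1 + 2 * ε := by
    rw [hn]; push_cast
    have := mul_le_mul_of_nonneg_right h2.le hε.le
    rw [add_mul, div_mul_cancel₀ _ hε.ne'] at this
    linarith
  -- Since `n ε ≤ A + 1 + 2 ε`, the `2 n + 1` cells satisfy `(2 n + 1) ε ≤ 2 A + 2 + 5 ε ≤ 2 A + 7`.
  refine ⟨Finset.Icc (-(n : ℤ)) n, fun j hj => ?_, ?_⟩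
  · rw [Finset.mem_Icc, not_and_or, not_le, not_le] at hj
    rw [cellCenter]
    rcases hj with hj | hj
    · have : (j : ℝ) + 1 ≤ -(n : ℝ) := by exact_mod_cast hj
      refine le_trans ?_ (neg_le_abs _)
      nlinarith
    · have : (n : ℝ) + 1 ≤ j := by exact_mod_cast hj
      refine le_trans ?_ (le_abs_self _)
      nlinarith
  · rw [Int.card_Icc]
    have : (((n : ℤ) + 1 - -(n : ℤ)).toNat : ℝ) = 2 * n + 1 := by
      have e : ((n : ℤ) + 1 - -(n : ℤ)).toNat = 2 * n + 1 := by omega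
      rw [e]; push_cast; ring
    rw [this]
    nlinarith

/-- The number of doublings from `d` to the scale `ε δ`. From `2 ^ (N + 1) d ≤ ε δ ≤ 1` one gets `(N
+ 1) ln 2 ≤ -ln d`, which is where the hypothesis on `ε² ln d` becomes useful. -/
lemma exists_scale {ε d δ : ℝ} (hd : 0 < d) (hδ : 2 * d ≤ ε * δ) (h1 : ε * δ ≤ 1) :
    ∃ N : ℕ, 2 ^ (N + 1) * d ≤ ε * δ ∧ ε * δ < 2 ^ (N + 2) * d ∧
      ε ^ 2 * ((N : ℝ) + 1) ≤ -(ε ^ 2 * Real.log d) / Real.log 2 := by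
  have hx : 2 ≤ ε * δ / d := by rwa [le_div_iff₀ hd]
  obtain ⟨n, hn1, hn2⟩ := exists_nat_pow_near (by linarith : 1 ≤ ε * δ / d) (one_lt_two : (1 : ℝ) < 2)
  obtain ⟨N, rfl⟩ : ∃ N, n = N + 1 := by
    cases n with
    | zero => norm_num at hn2; linarith
    | succ N => exact ⟨N, rfl⟩
  have h2 : 2 ^ (N + 1) * d ≤ ε * δ := by rwa [le_div_iff₀ hd] at hn1
  refine ⟨N, h2, by rwa [div_lt_iff₀ hd] at hn2, ?_⟩
  have hlog2 : 0 < Real.log 2 := Real.log_pos one_lt_two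
  have h3 : ((N : ℝ) + 1) * Real.log 2 + Real.log d ≤ 0 := by
    have := Real.log_nonpos (by positivity) (h2.trans h1)
    rw [Real.log_mul (by positivity) hd.ne', Real.log_pow] at this
    push_cast at this
    exact this
  rw [le_div_iff₀ hlog2]
  nlinarith [sq_nonneg ε]

/-- With `k ≤ K / ε` cells, every error is rewritten through the convergent quantity `d / (h ε² b)`,
multiplied by one of the vanishing quantities `ρ`, `h²`, `ε²` under a root. -/
lemma error_term_le {ε d h b M μ K C E ρ n k : ℝ} (hε : 0 < ε) (hd : 0 < d) (hh : 0 < h)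
    (hb : 0 < b) (hM : 0 ≤ M) (hμ : 0 < μ) (hC : 0 ≤ C) (hE : 0 ≤ E) (hn : 0 ≤ n)
    (hK : k * ε ≤ K) (hk : 0 ≤ k) (hρ : ε ^ 2 * n ≤ ρ) :
    1 / √ε * (d / h * (2 * M * √(k * (C * n) * E)) + M * ((2 + μ + ε * h⁻¹) * √(k * (d * h) * E)))
      ≤ 2 * M * (d / (h * ε ^ 2 * b) * b) * √(K * C * E * ρ)
        + M * (2 + μ) * √(K * E * (d / (h * ε ^ 2 * b) * b * h ^ 2))
        + M * √(K * E * (d / (h * ε ^ 2 * b) * b * ε ^ 2)) := by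
  have hK0 : 0 ≤ K := (by positivity : 0 ≤ k * ε).trans hK
  have key (y : ℝ) (hy : 0 ≤ y) : 1 / √ε * √(k * y) ≤ √(K * y) / ε := by
    have h1 : 1 / √ε * √(k * y) = √(k * ε * y) / ε := by
      rw [mul_right_comm k, Real.sqrt_mul (by positivity) ε, div_mul_eq_mul_div, one_mul]
      have hs : 0 < √ε := Real.sqrt_pos.2 hε
      have hss : √ε * √ε = ε := Real.mul_self_sqrt hε.le
      rw [div_eq_div_iff hs.ne' hε.ne', mul_assoc, hss]
    rw [h1]
    gcongr
  have e0 : d / (h * ε ^ 2 * b) * b = d / (h * ε ^ 2) := by field_simp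
  rw [e0]
  have p1 := key (C * n * E) (by positivity)
  have p2 := key (d * h * E) (by positivity)
  have q1 : √(K * (C * n * E)) / ε * (d / h) ≤ d / (h * ε ^ 2) * √(K * C * E * ρ) := by
    have : √(K * (C * n * E)) * ε ≤ √(K * C * E * ρ) := by
      rw [show √(K * (C * n * E)) * ε = √(K * C * E * (ε ^ 2 * n)) by
        rw [show K * C * E * (ε ^ 2 * n) = K * (C * n * E) * ε ^ 2 by ring,
          Real.sqrt_mul (by positivity) (ε ^ 2), Real.sqrt_sq hε.le]]
      gcongr
    calc √(K * (C * n * E)) / ε * (d / h) = d / (h * ε ^ 2) * (√(K * (C * n * E)) * ε) := by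
          field_simp
      _ ≤ _ := by gcongr
  have q2 : √(K * (d * h * E)) / ε = √(K * E * (d / (h * ε ^ 2) * h ^ 2)) := by
    rw [show K * E * (d / (h * ε ^ 2) * h ^ 2) = K * (d * h * E) / ε ^ 2 by field_simp,
      Real.sqrt_div (by positivity), Real.sqrt_sq hε.le]
  have q3 : √(K * (d * h * E)) / ε * (ε * h⁻¹) = √(K * E * (d / (h * ε ^ 2) * ε ^ 2)) := by
    rw [show K * E * (d / (h * ε ^ 2) * ε ^ 2) = K * (d * h * E) / h ^ 2 by field_simp,
      Real.sqrt_div (by positivity), Real.sqrt_sq hh.le]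
    field_simp
  calc _ = 2 * M * ((1 / √ε * √(k * (C * n * E))) * (d / h))
        + M * ((2 + μ) * (1 / √ε * √(k * (d * h * E)))
          + (1 / √ε * √(k * (d * h * E))) * (ε * h⁻¹)) := by
        rw [show k * (C * n) * E = k * (C * n * E) by ring,
          show k * (d * h) * E = k * (d * h * E) by ring]
        ring
    _ ≤ 2 * M * (d / (h * ε ^ 2) * √(K * C * E * ρ))
        + M * ((2 + μ) * (√(K * (d * h * E)) / ε) + √(K * (d * h * E)) / ε * (ε * h⁻¹)) := by
        have r1 : (1 / √ε * √(k * (C * n * E))) * (d / h) ≤ d / (h * ε ^ 2) * √(K * C * E * ρ) :=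
          (mul_le_mul_of_nonneg_right p1 (by positivity)).trans q1
        gcongr
    _ = _ := by rw [q3, q2]; ring

/-- Integrals against step functions and against the approximated function. -/
lemma tendsto_mul_integral_step {c : ℝ → ℝ → ℂ} {E q : ℝ} {Q : ℝ → ℝ}
    (hQ : Tendsto Q (𝓝[>] 0) (𝓝 q))
    (hc : ∀ᶠ ε in 𝓝[>] (0 : ℝ), MemLp (c ε) 2 ∧ ∫ x, ‖c ε x‖ ^ 2 ≤ E) {φ : ℝ → ℝ}
    (h1 : ContDiff ℝ ∞ φ) (h2 : HasCompactSupport φ) :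
    Tendsto (fun ε => (Q ε : ℂ) * (∫ x, c ε x * ((φ (nearestCenter ε x) : ℝ) : ℂ))
      - q * ∫ x, c ε x * ((φ x : ℝ) : ℂ)) (𝓝[>] 0) (𝓝 0) := by
  obtain ⟨M, A, hA, hφ, -⟩ := exists_isTestPair h1 h2
  have hL : MemLp (fun x => ((φ x : ℝ) : ℂ)) 2 := memLp_line_of_continuous h1.continuous h2
  set P := ∫ x, ‖((φ x : ℝ) : ℂ)‖ ^ 2 with hP
  have hbound : ∀ᶠ ε in 𝓝[>] (0 : ℝ),
      ‖(Q ε : ℂ) * (∫ x, c ε x * ((φ (nearestCenter ε x) : ℝ) : ℂ))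
        - q * ∫ x, c ε x * ((φ x : ℝ) : ℂ)‖
      ≤ |Q ε - q| * √(E * P) + |Q ε| * √(E * ((M * ε) ^ 2 * (2 * (A + ε)))) := by
    filter_upwards [hc, self_mem_nhdsWithin] with ε hcε hε
    have hε : 0 < ε := hε
    have hE0 : 0 ≤ E := (integral_nonneg fun x => by positivity).trans hcε.2
    have hS := memLp_step hε h1.continuous.measurable hφ.bound_fst hφ.supp_fst
    have i1 : Integrable fun x => c ε x * ((φ (nearestCenter ε x) : ℝ) : ℂ) :=
      hcε.1.integrable_mul hS
    have i2 : Integrable fun x => c ε x * ((φ x : ℝ) : ℂ) := hcε.1.integrable_mul hL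
    have b1 : ‖∫ x, c ε x * ((φ x : ℝ) : ℂ)‖ ≤ √(E * P) := by
      refine Real.le_sqrt_of_sq_le ((norm_integral_mul_sq_le hcε.1 hL).trans ?_)
      exact mul_le_mul_of_nonneg_right hcε.2 (integral_nonneg fun x => by positivity)
    have b2 : ‖∫ x, c ε x * (((φ (nearestCenter ε x) : ℝ) : ℂ) - ((φ x : ℝ) : ℂ))‖
        ≤ √(E * ((M * ε) ^ 2 * (2 * (A + ε)))) := by
      refine Real.le_sqrt_of_sq_le ((norm_integral_mul_sq_le hcε.1 (hS.sub hL)).trans ?_)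
      refine mul_le_mul hcε.2 ?_ (integral_nonneg fun x => by positivity) hE0
      exact integral_step_sub_sq_le hε hA
        (abs_sub_le_of_abs_deriv_le (h1.differentiable (by simp)) hφ.bound_deriv) hφ.supp_fst
    -- The change of the coefficient and the change of the test function are separated.
    have e : (Q ε : ℂ) * (∫ x, c ε x * ((φ (nearestCenter ε x) : ℝ) : ℂ))
        - q * ∫ x, c ε x * ((φ x : ℝ) : ℂ)
        = ((Q ε - q : ℝ) : ℂ) * (∫ x, c ε x * ((φ x : ℝ) : ℂ))
          + (Q ε : ℂ) * ∫ x, c ε x * (((φ (nearestCenter ε x) : ℝ) : ℂ) - ((φ x : ℝ) : ℂ)) := by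
      simp only [mul_sub]
      rw [integral_sub i1 i2]
      push_cast
      ring
    rw [e]
    refine (norm_add_le _ _).trans ?_
    rw [norm_mul, norm_mul, Complex.norm_real, Complex.norm_real, Real.norm_eq_abs,
      Real.norm_eq_abs]
    gcongr
  refine squeeze_zero_norm' hbound ?_
  have hid : Tendsto (fun ε : ℝ => ε) (𝓝[>] 0) (𝓝 0) := tendsto_nhdsWithin_of_tendsto_nhds tendsto_id
  have t1 : Tendsto (fun ε => |Q ε - q| * √(E * P)) (𝓝[>] 0) (𝓝 0) := by
    have := (hQ.sub_const q).abs.mul_const √(E * P)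
    simpa using this
  have t2 : Tendsto (fun ε => √(E * ((M * ε) ^ 2 * (2 * (A + ε))))) (𝓝[>] 0) (𝓝 0) := by
    have hc : Continuous fun ε : ℝ => √(E * ((M * ε) ^ 2 * (2 * (A + ε)))) := by fun_prop
    have := (hc.tendsto 0).comp hid
    simpa [Function.comp_def] using this
  have t3 := t1.add (hQ.abs.mul t2)
  simpa using t3

/-- The averaged equation in the limit. -/
lemma IsRoom.tendsto_averaged_equation {B : Set (ℝ × ℝ)} (hB : IsRoom B) {d h : ℝ → ℝ}
    (hd_pos : ∀ᶠ ε in 𝓝[>] (0 : ℝ), 0 < d ε) (hh_pos : ∀ᶠ ε in 𝓝[>] (0 : ℝ), 0 < h ε)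
    (hd : Tendsto (fun ε => d ε / ε) (𝓝[>] 0) (𝓝 0)) (hh : Tendsto h (𝓝[>] 0) (𝓝 0))
    (hlog : Tendsto (fun ε => ε ^ 2 * Real.log (d ε)) (𝓝[>] 0) (𝓝 0)) {q : ℝ}
    (hlim : Tendsto (fun ε => d ε / (h ε * ε ^ 2 * volume.real B)) (𝓝[>] 0) (𝓝 q))
    {μ E : ℝ} (hμ : 0 < μ) {f u u₁ u₂ : ℝ → ℝ × ℝ → ℂ}
    (hf : ∀ᶠ ε in 𝓝[>] (0 : ℝ), MemLp (f ε) 2 ∧ ∫ x, ‖f ε x‖ ^ 2 ≤ E)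
    (hu : ∀ᶠ ε in 𝓝[>] (0 : ℝ), HasGrad (waveguide B ε (d ε) (h ε)) (u ε) (u₁ ε) (u₂ ε) ∧
      ∫ x, ‖u ε x‖ ^ 2 ≤ E ∧ ∫ x, (‖u₁ ε x‖ ^ 2 + ‖u₂ ε x‖ ^ 2) ≤ E)
    (hweak : ∀ᶠ ε in 𝓝[>] (0 : ℝ), ∀ v v₁ v₂ : ℝ × ℝ → ℝ, IsH1 (waveguide B ε (d ε) (h ε))
        (fun x => ((v x : ℝ) : ℂ)) (fun x => ((v₁ x : ℝ) : ℂ)) (fun x => ((v₂ x : ℝ) : ℂ)) →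
      (∫ x in waveguide B ε (d ε) (h ε),
          (u₁ ε x * ((v₁ x : ℝ) : ℂ) + u₂ ε x * ((v₂ x : ℝ) : ℂ)))
        + μ * ∫ x in waveguide B ε (d ε) (h ε), u ε x * ((v x : ℝ) : ℂ)
        = ∫ x in waveguide B ε (d ε) (h ε), f ε x * ((v x : ℝ) : ℂ))
    {φ₁ φ₂ : ℝ → ℝ} {M A : ℝ} (hA : 0 ≤ A) (hφ : IsTestPair φ₁ φ₂ M A) :
    Tendsto (fun ε => (∫ x, J₁ ε (u₁ ε) x * ((deriv φ₁ x : ℝ) : ℂ))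
        + μ * (∫ x, J₁ ε (u ε) x * ((φ₁ x : ℝ) : ℂ))
        + μ * (((√(volume.real B) : ℝ) : ℂ)
          * ∫ x, J₂ B ε (h ε) (u ε) x * ((φ₂ (nearestCenter ε x) : ℝ) : ℂ))
        + ((d ε / (h ε * ε ^ 2 * volume.real B) : ℝ) : ℂ) * (((√(volume.real B) : ℝ) : ℂ)
            * (∫ x, J₂ B ε (h ε) (u ε) x *
              ((φ₂ (nearestCenter ε x) - φ₁ (nearestCenter ε x) : ℝ) : ℂ))
          - ((volume.real B : ℝ) : ℂ) * ∫ x, J₁ ε (u ε) x *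
              ((φ₂ (nearestCenter ε x) - φ₁ (nearestCenter ε x) : ℝ) : ℂ))
        - (∫ x, J₁ ε (f ε) x * ((φ₁ x : ℝ) : ℂ))
        - ((√(volume.real B) : ℝ) : ℂ)
          * (∫ x, J₂ B ε (h ε) (f ε) x * ((φ₂ (nearestCenter ε x) : ℝ) : ℂ)))
      (𝓝[>] 0) (𝓝 0) := by
  obtain ⟨δ, C, hδ, hC, havg⟩ := hB.exists_averaged_equation
  have hb := hB.volume_real_pos
  set b := volume.real B with hbdef
  have hM0 : 0 ≤ M := (abs_nonneg _).trans (hφ.bound_fst 0)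
  have hid : Tendsto (fun ε : ℝ => ε) (𝓝[>] 0) (𝓝 0) := tendsto_nhdsWithin_of_tendsto_nhds tendsto_id
  set K := 2 * A + 7 with hK
  refine squeeze_zero_norm' (a := fun ε => 2 * M * (d ε / (h ε * ε ^ 2 * b) * b)
      * √(K * C * E * (-(ε ^ 2 * Real.log (d ε)) / Real.log 2))
    + M * (2 + μ) * √(K * E * (d ε / (h ε * ε ^ 2 * b) * b * h ε ^ 2))
    + M * √(K * E * (d ε / (h ε * ε ^ 2 * b) * b * ε ^ 2))) ?_ ?_
  -- The smallness conditions give `ε δ ≤ 1`, `d ≤ ε` and `2 d ≤ ε δ`, as required for the choice of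
  -- the cells and of the dyadic scale.
  · filter_upwards [self_mem_nhdsWithin, hd_pos, hh_pos, hf, hu, hweak,
      hid.eventually_le_const (zero_lt_one : (0 : ℝ) < 1),
      hid.eventually_le_const (show 0 < 1 / δ by positivity),
      hd.eventually_le_const (zero_lt_one : (0 : ℝ) < 1),
      hd.eventually_le_const (show 0 < δ / 2 by positivity)] with
      ε hε hdε hhε hfε huε hwε hε1 hεδ hd1 hd2
    have hε : 0 < ε := hε
    rw [div_le_iff₀ hε] at hd1 hd2
    rw [le_div_iff₀ hδ] at hεδ
    obtain ⟨J, hJ, hJK⟩ := exists_cells hε hε1 hA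
    obtain ⟨N, hN1, hN2, hN3⟩ := exists_scale (ε := ε) (δ := δ) hdε (by linarith) hεδ
    have hE0 : 0 ≤ E := (integral_nonneg fun x => by positivity).trans hfε.2
    have hdε1 : d ε ≤ ε := by linarith
    exact (havg ε (d ε) (h ε) M A μ E N φ₁ φ₂ (u ε) (u₁ ε) (u₂ ε) (f ε) J hφ hε hdε
      hdε1 hhε hμ hN1 hN2 huε.1 hfε.1 huε.2.1 huε.2.2 hfε.2 hJ
      (hwε _ _ _ (hφ.isH1_testFun hB hε hhε hdε1))).trans
      (error_term_le hε hdε hhε hb hM0 hμ hC hE0 (by positivity) hJK (by positivity) hN3)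
  · have tQ := hlim.mul_const b
    have t1 : Tendsto (fun ε => √(K * C * E * (-(ε ^ 2 * Real.log (d ε)) / Real.log 2)))
        (𝓝[>] 0) (𝓝 0) := by
      have := ((hlog.neg.div_const (Real.log 2)).const_mul (K * C * E)).sqrt
      simpa using this
    have t2 : Tendsto (fun ε => √(K * E * (d ε / (h ε * ε ^ 2 * b) * b * h ε ^ 2)))
        (𝓝[>] 0) (𝓝 0) := by
      have := ((tQ.mul (hh.pow 2)).const_mul (K * E)).sqrt
      simpa using this
    have t3 : Tendsto (fun ε => √(K * E * (d ε / (h ε * ε ^ 2 * b) * b * ε ^ 2)))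
        (𝓝[>] 0) (𝓝 0) := by
      have := ((tQ.mul (hid.pow 2)).const_mul (K * E)).sqrt
      simpa using this
    have := (((tQ.const_mul (2 * M)).mul t1).add (t2.const_mul (M * (2 + μ)))).add (t3.const_mul M)
    simpa using this

end ThinWaveguide

/-! ### Conclusion -/

theorem theorem2p1
    -- the geometry: the shape of the rooms and the sizes of the passages
    (B : Set (ℝ × ℝ)) (hB : IsRoom B) (d h : ℝ → ℝ)
    (hd_pos : ∀ᶠ ε in 𝓝[>] (0 : ℝ), 0 < d ε)
    (hh_pos : ∀ᶠ ε in 𝓝[>] (0 : ℝ), 0 < h ε)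
    (hd : Tendsto (fun ε => d ε / ε) (𝓝[>] 0) (𝓝 0))
    (hh : Tendsto h (𝓝[>] 0) (𝓝 0))
    (hlog : Tendsto (fun ε => ε ^ 2 * Real.log (d ε)) (𝓝[>] 0) (𝓝 0))
    (q : ℝ) (hq : 0 ≤ q)
    (hlim : Tendsto (fun ε => d ε / (h ε * ε ^ 2 * volume.real B)) (𝓝[>] 0) (𝓝 q))
    -- the right-hand sides
    (f : ℝ → ℝ × ℝ → ℂ)
    (hf : ∀ᶠ ε in 𝓝[>] (0 : ℝ), MemLp (f ε) 2 (volume.restrict (waveguide B ε (d ε) (h ε))))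
    (hf_bdd : ∃ C : ℝ≥0, ∀ᶠ ε in 𝓝[>] (0 : ℝ),
      eLpNorm (f ε) 2 (volume.restrict (waveguide B ε (d ε) (h ε))) ≤ C)
    (f₁ f₂ : ℝ → ℂ)
    (hf₁ : WeakTendstoL2 (𝓝[>] (0 : ℝ)) (fun ε => J₁ ε (f ε)) f₁)
    (hf₂ : WeakTendstoL2 (𝓝[>] (0 : ℝ)) (fun ε => J₂ B ε (h ε) (f ε)) f₂)
    -- the resolvent equation
    (μ : ℝ) (hμ : 0 < μ) (u : ℝ → ℝ × ℝ → ℂ)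
    (hu : ∀ᶠ ε in 𝓝[>] (0 : ℝ),
      IsNeumannResolvent (waveguide B ε (d ε) (h ε)) μ (f ε) (u ε)) :
    ∃ u₁ u₂ : ℝ → ℂ,
      SolvesLimitProblem q (volume.real B) μ f₁ f₂ u₁ ∧
      (∀ v : ℝ → ℂ, SolvesLimitProblem q (volume.real B) μ f₁ f₂ v → v =ᵐ[volume] u₁) ∧
      (u₂ = fun x => ((q * √(volume.real B) / (q + μ) : ℝ) : ℂ) * u₁ x
        + ((1 / (q + μ) : ℝ) : ℂ) * f₂ x) ∧
      WeakTendstoH1 (𝓝[>] (0 : ℝ)) (fun ε => J₁ ε (u ε)) u₁ ∧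
      WeakTendstoL2 (𝓝[>] (0 : ℝ)) (fun ε => J₂ B ε (h ε) (u ε)) u₂ ∧
      IsLimitResolvent q (volume.real B) μ f₁ f₂ u₁ u₂ := by
  have hb := hB.volume_real_pos
  set b := volume.real B with hbdef
  have hsb : 0 < √b := Real.sqrt_pos.2 hb
  have hε0 : ∀ᶠ ε in 𝓝[>] (0 : ℝ), 0 < ε := self_mem_nhdsWithin
  obtain ⟨C, hC⟩ := hf_bdd
  set F : ℝ := (C : ℝ) ^ 2 with hF
  set E : ℝ := F + F / μ + F / μ ^ 2 with hE
  set Ω : ℝ → Set (ℝ × ℝ) := fun ε => waveguide B ε (d ε) (h ε) with hΩ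
  have hpk : ∀ᶠ ε in 𝓝[>] (0 : ℝ), ∃ w : (ℝ × ℝ → ℂ) × (ℝ × ℝ → ℂ),
      HasGrad (Ω ε) ((Ω ε).indicator (u ε)) w.1 w.2 ∧
      ∫ x, ‖(Ω ε).indicator (u ε) x‖ ^ 2 ≤ E ∧ ∫ x, (‖w.1 x‖ ^ 2 + ‖w.2 x‖ ^ 2) ≤ E ∧
      ∫ x, ‖(Ω ε).indicator (f ε) x‖ ^ 2 ≤ E ∧
      ∀ v v₁ v₂ : ℝ × ℝ → ℝ, IsH1 (Ω ε) (fun x => ((v x : ℝ) : ℂ)) (fun x => ((v₁ x : ℝ) : ℂ))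
          (fun x => ((v₂ x : ℝ) : ℂ)) →
        (∫ x in Ω ε, (w.1 x * ((v₁ x : ℝ) : ℂ) + w.2 x * ((v₂ x : ℝ) : ℂ)))
          + μ * ∫ x in Ω ε, (Ω ε).indicator (u ε) x * ((v x : ℝ) : ℂ)
          = ∫ x in Ω ε, (Ω ε).indicator (f ε) x * ((v x : ℝ) : ℂ) := by
    filter_upwards [hε0, hf, hC, hu] with ε hε hfε hCε huε
    exact huε.exists_hasGrad (measurableSet_waveguide hB.isOpen hε) hμ hfε
      (integral_norm_sq_le_of_eLpNorm_le hfε hCε)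
  obtain ⟨w, hw⟩ := hpk.choice
  -- The averaging operators only see values inside the waveguide, so extension by zero does not
  -- change them.
  have hJ₁ (g : ℝ → ℝ × ℝ → ℂ) (ε : ℝ) : J₁ ε ((Ω ε).indicator (g ε)) = J₁ ε (g ε) :=
    J₁_indicator strip_subset_waveguide (g ε)
  have hJ₂ (g : ℝ → ℝ × ℝ → ℂ) (ε : ℝ) (hε : 0 < ε) :
      J₂ B ε (h ε) ((Ω ε).indicator (g ε)) = J₂ B ε (h ε) (g ε) :=
    hB.J₂_indicator hε (fun j => room_subset_waveguide) (g ε)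
  have hfL : ∀ᶠ ε in 𝓝[>] (0 : ℝ), MemLp ((Ω ε).indicator (f ε)) 2 ∧
      ∫ x, ‖(Ω ε).indicator (f ε) x‖ ^ 2 ≤ E := by
    filter_upwards [hε0, hf, hw] with ε hε hfε hwε
    exact ⟨(memLp_indicator_iff_restrict (measurableSet_waveguide hB.isOpen hε)).2 hfε,
      hwε.2.2.2.1⟩
  have ha : ∀ᶠ ε in 𝓝[>] (0 : ℝ), IsH1Line (J₁ ε (u ε)) (J₁ ε (w ε).1) := by
    filter_upwards [hε0, hw] with ε hε hwε
    have := hwε.1.isH1Line_J₁ hε strip_subset_waveguide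
    rwa [hJ₁ u] at this
  have haE : ∀ᶠ ε in 𝓝[>] (0 : ℝ), MemLp (J₁ ε (u ε)) 2 ∧ ∫ x, ‖J₁ ε (u ε) x‖ ^ 2 ≤ E := by
    filter_upwards [hε0, hw] with ε hε hwε
    have := memLp_J₁ hε hwε.1.memLp
    rw [hJ₁ u] at this
    exact ⟨this.1, this.2.trans hwε.2.1⟩
  have haE' : ∀ᶠ ε in 𝓝[>] (0 : ℝ), ∫ x, ‖J₁ ε (w ε).1 x‖ ^ 2 ≤ E := by
    filter_upwards [hε0, hw] with ε hε hwε
    refine (memLp_J₁ hε hwε.1.memLp_fst).2.trans (le_trans ?_ hwε.2.2.1)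
    refine integral_mono hwε.1.memLp_fst.integrable_norm_sq hwε.1.integrable_energy fun x => ?_
    simp
  have hcE : ∀ᶠ ε in 𝓝[>] (0 : ℝ), MemLp (J₂ B ε (h ε) (u ε)) 2 ∧
      ∫ x, ‖J₂ B ε (h ε) (u ε) x‖ ^ 2 ≤ E := by
    filter_upwards [hε0, hw] with ε hε hwε
    have := hB.memLp_J₂ (h := h ε) hε hwε.1.memLp
    rw [hJ₂ u ε hε] at this
    exact ⟨this.1, this.2.trans hwε.2.1⟩
  have hgE : ∀ᶠ ε in 𝓝[>] (0 : ℝ), MemLp (J₂ B ε (h ε) (f ε)) 2 ∧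
      ∫ x, ‖J₂ B ε (h ε) (f ε) x‖ ^ 2 ≤ E := by
    filter_upwards [hε0, hfL] with ε hε hfε
    have := hB.memLp_J₂ (h := h ε) hε hfε.1
    rw [hJ₂ f ε hε] at this
    exact ⟨this.1, this.2.trans hfε.2⟩
  have hlimit {φ₁ φ₂ : ℝ → ℝ} {M A : ℝ} (hA : 0 ≤ A) (hφ : IsTestPair φ₁ φ₂ M A) :=
    hB.tendsto_averaged_equation hd_pos hh_pos hd hh hlog hlim hμ hfL
      (hw.mono fun ε hε => ⟨hε.1, hε.2.1, hε.2.2.1⟩) (hw.mono fun ε hε => hε.2.2.2.2) hA hφ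
  have hbs : (b : ℂ) = ((√b : ℝ) : ℂ) * ((√b : ℝ) : ℂ) := by
    rw [← Complex.ofReal_mul, Real.mul_self_sqrt hb.le]
  refine exists_limit_of_averaged_equations hq hb.le hμ hf₁.2.1 hf₂.2.1 ha
    (hcE.mono fun ε hε => hε.1) (haE.mono fun ε hε => hε.2) haE' (hcE.mono fun ε hε => hε.2) ?_ ?_
  · intro φ p1 p2
    obtain ⟨M, A, hA, hφ, -⟩ := exists_isTestPair p1 p2
    have tX := hlimit hA hφ
    have tc := (tendsto_mul_integral_step hlim hcE p1 p2).const_mul ((√b : ℝ) : ℂ)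
    have ta := (tendsto_mul_integral_step hlim haE p1 p2).const_mul (b : ℂ)
    have tf := hf₁.2.2 _ (memLp_line_of_continuous p1.continuous p2)
    -- With the pair `(φ, 0)`, the corrections replace step functions by `φ` and the coefficient by
    -- `q`; adding the limit of `J₁ f` leaves the first identity.
    have t := ((tX.add tc).sub ta).add tf
    simp only [mul_zero, add_zero, sub_zero, zero_add, Complex.conj_ofReal] at t
    refine t.congr' ?_
    filter_upwards [hε0] with ε hε
    rw [hJ₁ u, hJ₁ f, hJ₂ u ε hε]
    simp only [zero_sub, Complex.ofReal_neg, mul_neg, integral_neg, Complex.ofReal_zero, mul_zero,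
      integral_zero]
    push_cast
    ring
  · intro φ p1 p2
    obtain ⟨M, A, hA, -, hφ⟩ := exists_isTestPair p1 p2
    -- With the pair `(0, φ)` every term carries a factor `√b`, which is divided out.
    have tX := (hlimit hA hφ).const_mul (((√b)⁻¹ : ℝ) : ℂ)
    have tc := tendsto_mul_integral_step hlim hcE p1 p2
    have tc' := tendsto_mul_integral_step (tendsto_const_nhds (x := μ)) hcE p1 p2
    have ta := (tendsto_mul_integral_step hlim haE p1 p2).const_mul ((√b : ℝ) : ℂ)
    have tg := tendsto_mul_integral_step (tendsto_const_nhds (x := (1 : ℝ))) hgE p1 p2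
    have tf := hf₂.2.2 _ (memLp_line_of_continuous p1.continuous p2)
    -- All terms are tested with step functions here; the corrections with constant coefficients `μ`
    -- and `1` serve only to replace the steps by `φ`.
    have t := ((((tX.sub tc').sub tc).add ta).add tg).add tf
    simp only [mul_zero, add_zero, sub_zero, zero_add, Complex.conj_ofReal] at t
    refine t.congr' ?_
    filter_upwards [hε0] with ε hε
    rw [hJ₁ u, hJ₁ f, hJ₂ u ε hε, hJ₂ f ε hε]
    have hs : ((√b : ℝ) : ℂ) ≠ 0 := by exact_mod_cast hsb.ne'
    simp only [deriv_const', sub_zero, Complex.ofReal_zero, mul_zero, integral_zero]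
    push_cast
    rw [hbs]
    field_simp
    ring
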